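/- Let $\mathcal{G}$ be a finite connected graph of finite groups (loops and multiple edges are allowed): vertex groups $G_v$ ($v\in V$), and for each unoriented edge $e$, given an orientation from $x=s(e)$ to $y=t(e)$, a group $G_e$ with embeddings into $G_x$ and $G_y$. Let $T$ be a spanning tree, and let $\Gamma$ be the fundamental group of $\mathcal{G}$ with respect to $T$: it is generated by all the groups $G_v$ and by one element $g_e$ for each edge $e$, subject to $g_e=1$ for $e\in T$ and $g_e\,\psi_{t,e}(a)\,g_e^{-1}=\psi_{s,e}(a)$ for all edges $e$ and all $a\in G_e$, where $\psi_{s,e},\psi_{t,e}$ are the embeddings of $G_e$ into the groups at the source and at the target of $e$. Suppose that $\Gamma$ is infinite. Let $s_n(\Gamma)$ be the number of subgroups of index $n$ in $\Gamma$, and let $$\mu(\Gamma)=\limsup_{n\to\infty}\frac{\log s_n(\Gamma)}{n\log n},\qquad \log 0=-\infty .$$ For each $v$ let $\rho_{v,1},\dots,\rho_{v,m_v}$ be the transitive permutation representations of $G_v$ up to equivalence, and let $n_{v,i}$ be the degree of $\rho_{v,i}$; for each $e$ let $\rho_{e,1},\dots,\rho_{e,m_e}$ be those of $G_e$. For a real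 vector $\alpha=(\alpha_{v,i})$ put $$\ell^{s}_{e,j}(\alpha)=\sum_{i=1}^{m_x} c_{e,j,i}\,\alpha_{x,i},\qquad x=s(e),$$ where $c_{e,j,i}$ is the multiplicity of $\rho_{e,j}$ in the restriction of $\rho_{x,i}$ to $G_e$ along $\psi_{s,e}$, and define $\ell^{t}_{e,j}(\alpha)$ in the same way with the target of $e$ and $\psi_{t,e}$. Consider the linear program with rational coefficients $$\text{maximize}\quad -\sum_{v}\sum_{i}\alpha_{v,i}+\sum_{e}\sum_{j}\ell^{s}_{e,j}(\alpha)$$ subject to $\alpha_{v,i}\ge 0$ for all $v,i$, to $\sum_i n_{v,i}\alpha_{v,i}=1$ for all $v$, and to $\ell^{s}_{e,j}(\alpha)=\ell^{t}_{e,j}(\alpha)$ for all $e,j$. Then this linear program has an optimum, which is attained, and $\mu(\Gamma)$ is equal to it; in particular, $\mu(\Gamma)$ is rational. Moreover the linear program can be computed effectively from $\mathcal{G}$: there is one computable function that maps the description of any finite graph of finite groups by finite data (multiplication tables of the groups, source and target of each edge, value tables of the embeddings) to the list of the coefficients of its linear program, with respect to some enumeration of the variables and of the constraints. -/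

import Mathlib

open Filter
open scoped ENNReal

noncomputable section

/-! ### Subgroup growth -/

/-- The growth coefficient `limsup log s_n / (n log n)`, where `s_n` is the number of subgroups of
index `n`. It is computed in the extended reals, with `log 0 = -∞`. -/
def growthCoeff (Γ : Type*) [Group Γ] : EReal :=
  limsup (fun n : ℕ =>
    ENNReal.log (({H : Subgroup Γ | H.index = n}.encard : ℕ∞) : ℝ≥0∞) /
      (((n : ℝ) * Real.log n : ℝ) : EReal)) atTop

/-! ### Permutation representations of finite groups -/

/-- Equivalence of two permutation representations of `G`. -/
def PermRepEquiv (G X Y : Type*) [Group G] [MulAction G X] [MulAction G Y] : Prop :=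
  ∃ φ : X ≃ Y, ∀ (g : G) (x : X), φ (g • x) = g • φ x

/-- Two subgroups are related if their coset actions are equivalent. -/
def cosetActionSetoid (G : Type*) [Group G] : Setoid (Subgroup G) where
  r H K := PermRepEquiv G (G ⧸ H) (G ⧸ K)
  iseqv :=
    { refl := fun _ => ⟨Equiv.refl _, fun _ _ => rfl⟩
      symm := by
        rintro H K ⟨φ, hφ⟩
        refine ⟨φ.symm, fun g x => ?_⟩
        rw [Equiv.symm_apply_eq, hφ, Equiv.apply_symm_apply]
      trans := by
        rintro H K L ⟨φ, hφ⟩ ⟨χ, hχ⟩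
        exact ⟨φ.trans χ, fun g x => by simp [hφ, hχ]⟩ }

/-- The equivalence classes of transitive permutation representations of `G`; every transitive
permutation representation is equivalent to a coset action. -/
def TransRep (G : Type*) [Group G] : Type _ :=
  Quotient (cosetActionSetoid G)

namespace TransRep

/-- A point stabilizer of a representative of the class `ρ`, which is the coset action of `G`
on `G ⧸ ρ.stab`. -/
def stab {G : Type*} [Group G] (ρ : TransRep G) : Subgroup G :=
  Quotient.out (s := cosetActionSetoid G) ρ

instance instFinite (G : Type*) [Group G] [Finite G] : Finite (TransRep G) :=
  inferInstanceAs (Finite (Quotient (cosetActionSetoid G)))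

instance instFintype (G : Type*) [Group G] [Finite G] : Fintype (TransRep G) :=
  Fintype.ofFinite _

/-- The number of points on which `ρ` acts. -/
def degree {G : Type*} [Group G] (ρ : TransRep G) : ℕ :=
  Nat.card (G ⧸ ρ.stab)

/-- The multiplicity of `ρ` in a permutation representation `X` of `G`: the number of orbits on
which `G` acts like `ρ`. -/
def multiplicity {G : Type*} [Group G] (ρ : TransRep G) (X : Type*) [MulAction G X] : ℕ :=
  Nat.card {ω : MulAction.orbitRel.Quotient G X // PermRepEquiv G ω.orbit (G ⧸ ρ.stab)}

/-- The multiplicity of `ρ` in the pull-back of `θ` along `ψ`. -/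
def restrictMult {A G : Type*} [Group A] [Group G] (ψ : A →* G)
    (ρ : TransRep A) (θ : TransRep G) : ℕ :=
  letI : MulAction A (G ⧸ θ.stab) := MulAction.compHom _ ψ
  ρ.multiplicity (G ⧸ θ.stab)

end TransRep

/-! ### Linear programs -/

/-- The linear program: maximize `∑ i, objective i * x i` over all real vectors `x ≥ 0` with
`∑ i, matrix k i * x i = rhs k` for all `k`. The coefficients are rational. -/
structure LinearProgram (ι κ : Type*) where
  objective : ι → ℚ
  matrix : κ → ι → ℚ
  rhs : κ → ℚ

/-- A rational number as numerator and denominator. -/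
def ratCode (q : ℚ) : ℤ × ℕ := (q.num, q.den)

/-- Finite data describing a linear program: the objective, and for each constraint the row of
coefficients together with the right hand side. -/
abbrev LPCode : Type := List (ℤ × ℕ) × List (List (ℤ × ℕ) × (ℤ × ℕ))

namespace LinearProgram

variable {ι κ : Type*}

def IsFeasible [Fintype ι] (L : LinearProgram ι κ) (x : ι → ℝ) : Prop :=
  (∀ i, 0 ≤ x i) ∧ ∀ k, ∑ i, (L.matrix k i : ℝ) * x i = (L.rhs k : ℝ)

/-- `m` is the optimum of the linear program, and it is attained. -/
def IsOptimum [Fintype ι] (L : LinearProgram ι κ) (m : ℝ) : Prop :=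
  IsGreatest {y : ℝ | ∃ x : ι → ℝ, L.IsFeasible x ∧ y = ∑ i, (L.objective i : ℝ) * x i} m

/-- The code of a linear program with respect to enumerations of its variables and constraints. -/
def code (L : LinearProgram ι κ) {n m : ℕ} (var : Fin n ≃ ι) (con : Fin m ≃ κ) : LPCode :=
  (List.ofFn fun i => ratCode (L.objective (var i)),
    List.ofFn fun k =>
      (List.ofFn fun i => ratCode (L.matrix (con k) (var i)), ratCode (L.rhs (con k))))

end LinearProgram

/-! ### Graphs of groups -/

/-- A graph of finite groups with vertex set `V`. The graph may have loops and multiple edges.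
The set `E` contains one edge `e` out of every pair of mutually reverse edges `e`, `ē`; the group
`G_e = G_ē` comes with its embeddings into the groups at both ends. -/
structure GraphOfGroups (V E : Type*) where
  src : E → V
  tgt : E → V
  vGroup : V → Type*
  eGroup : E → Type*
  [groupV : ∀ v, Group (vGroup v)]
  [groupE : ∀ e, Group (eGroup e)]
  [finiteV : ∀ v, Finite (vGroup v)]
  [finiteE : ∀ e, Finite (eGroup e)]
  srcMap : ∀ e, eGroup e →* vGroup (src e)
  tgtMap : ∀ e, eGroup e →* vGroup (tgt e)
  srcMap_injective : ∀ e, Function.Injective (srcMap e)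
  tgtMap_injective : ∀ e, Function.Injective (tgtMap e)

/-- The multiplication table of a finite group with respect to an enumeration. -/
def mulTable {G : Type*} [Group G] {n : ℕ} (enum : Fin n ≃ G) : List (List ℕ) :=
  List.ofFn fun i => List.ofFn fun j => (enum.symm (enum i * enum j) : ℕ)

/-- The value table of a map with respect to enumerations. -/
def mapTable {A G : Type*} {m n : ℕ} (enumA : Fin m ≃ A) (enumG : Fin n ≃ G) (ψ : A → G) :
    List ℕ :=
  List.ofFn fun i => (enumG.symm (ψ (enumA i)) : ℕ)

/-- Finite data describing a finite graph of finite groups: the multiplication tables of the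
vertex groups, and for each edge its source, its target, the multiplication table of its group,
and the value tables of the two embeddings. -/
abbrev GraphCode : Type :=
  List (List (List ℕ)) × List (ℕ × ℕ × List (List ℕ) × List ℕ × List ℕ)

namespace GraphOfGroups

attribute [instance] groupV groupE finiteV finiteE

variable {V E : Type*} (𝒢 : GraphOfGroups V E)

/-- The edges in `T` are those of a spanning tree: there are no loops and no multiple edges in `T`,
and the resulting simple graph on all of `V` is a tree. -/
def IsSpanningTree (T : Set E) : Prop :=
  (∀ e ∈ T, 𝒢.src e ≠ 𝒢.tgt e) ∧
  Set.InjOn (fun e => s(𝒢.src e, 𝒢.tgt e)) T ∧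
  (SimpleGraph.fromRel fun x y => ∃ e ∈ T, 𝒢.src e = x ∧ 𝒢.tgt e = y).IsTree

/-- The free product of all vertex groups and of the free group on the edges. -/
abbrev FreeProd : Type _ :=
  Monoid.Coprod (Monoid.CoprodI 𝒢.vGroup) (FreeGroup E)

/-- The element `g_e`. -/
def edgeElt (e : E) : 𝒢.FreeProd :=
  Monoid.Coprod.inr (FreeGroup.of e)

/-- The inclusion of a vertex group. -/
def vertexIncl (v : V) : 𝒢.vGroup v →* 𝒢.FreeProd :=
  Monoid.Coprod.inl.comp Monoid.CoprodI.of

/-- The relators: `g_e = 1` for `e` in `T`, and `g_e ψ_e(a) g_e⁻¹ = ψ_ē(a)`, where `ψ_e` is the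
embedding at the target and `ψ_ē` the one at the source of `e`. (The element that belongs to the
reverse edge `ē` is `g_e⁻¹`.) -/
def relators (T : Set E) : Set 𝒢.FreeProd :=
  {r | ∃ e ∈ T, r = 𝒢.edgeElt e} ∪
  {r | ∃ (e : E) (a : 𝒢.eGroup e),
    r = 𝒢.edgeElt e * 𝒢.vertexIncl _ (𝒢.tgtMap e a) * (𝒢.edgeElt e)⁻¹ *
      (𝒢.vertexIncl _ (𝒢.srcMap e a))⁻¹}

/-- The fundamental group of the graph of groups with respect to `T`. -/
abbrev FundamentalGroup (T : Set E) : Type _ :=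
  𝒢.FreeProd ⧸ Subgroup.normalClosure (𝒢.relators T)

/-- The variables of the linear program: the transitive permutation representations of all the
vertex groups, up to equivalence. -/
abbrev Var : Type _ := Σ v, TransRep (𝒢.vGroup v)

/-- The constraints of the linear program: one for each vertex, and one for each transitive
permutation representation of each edge group. -/
abbrev Con : Type _ := V ⊕ Σ e, TransRep (𝒢.eGroup e)

open Classical in
/-- The coefficient of the variable `i` in the linear form `ℓ` which gives the multiplicity of `ρ`
in the restriction to `G_e` of the representation at the source of `e`. -/
def srcCoeff (e : E) (ρ : TransRep (𝒢.eGroup e)) (i : 𝒢.Var) : ℚ :=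
  ∑ θ : TransRep (𝒢.vGroup (𝒢.src e)),
    if (⟨𝒢.src e, θ⟩ : 𝒢.Var) = i then (TransRep.restrictMult (𝒢.srcMap e) ρ θ : ℚ) else 0

open Classical in
/-- The same for the target of `e`. -/
def tgtCoeff (e : E) (ρ : TransRep (𝒢.eGroup e)) (i : 𝒢.Var) : ℚ :=
  ∑ θ : TransRep (𝒢.vGroup (𝒢.tgt e)),
    if (⟨𝒢.tgt e, θ⟩ : 𝒢.Var) = i then (TransRep.restrictMult (𝒢.tgtMap e) ρ θ : ℚ) else 0

open Classical in
/-- The linear program of the graph of groups. Maximize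
`- ∑_v ∑_θ α_{v,θ} + ∑_e ∑_ρ ℓ_{e,ρ}(α)` subject to `α ≥ 0`, to `∑_θ deg(θ) α_{v,θ} = 1` for every
vertex `v`, and to the equality, for every edge `e` and every `ρ`, of the multiplicities of `ρ` in
the representations of `G_e` that are induced from both ends of `e`. -/
def linearProgram [Fintype E] : LinearProgram 𝒢.Var 𝒢.Con where
  objective i := -1 + ∑ e : E, ∑ ρ : TransRep (𝒢.eGroup e), 𝒢.srcCoeff e ρ i
  matrix k i :=
    match k with
    | Sum.inl v => if i.1 = v then (i.2.degree : ℚ) else 0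
    | Sum.inr ⟨e, ρ⟩ => 𝒢.srcCoeff e ρ i - 𝒢.tgtCoeff e ρ i
  rhs k :=
    match k with
    | Sum.inl _ => 1
    | Sum.inr _ => 0

/-- The code of a graph of groups with respect to enumerations of the vertices, of the edges and of
all the groups. -/
def code {nV nE : ℕ} (enumV : Fin nV ≃ V) (enumE : Fin nE ≃ E)
    {sV : V → ℕ} (elemV : ∀ v, Fin (sV v) ≃ 𝒢.vGroup v)
    {sE : E → ℕ} (elemE : ∀ e, Fin (sE e) ≃ 𝒢.eGroup e) : GraphCode :=
  (List.ofFn fun i => mulTable (elemV (enumV i)),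
    List.ofFn fun j =>
      ((enumV.symm (𝒢.src (enumE j)) : ℕ),
        (enumV.symm (𝒢.tgt (enumE j)) : ℕ),
        mulTable (elemE (enumE j)),
        mapTable (elemE (enumE j)) (elemV (𝒢.src (enumE j))) (𝒢.srcMap (enumE j)),
        mapTable (elemE (enumE j)) (elemV (𝒢.tgt (enumE j))) (𝒢.tgtMap (enumE j))))

end GraphOfGroups

end

/-! ### Rational optima of linear programs -/

namespace LinearProgram

variable {ι κ : Type*} [Fintype ι] (L : LinearProgram ι κ)

/-! Write h_n for the number of homomorphisms from Γ to Sym(n). An `EdgeRep` with values in Sym(n)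
consists of an action of every vertex group on n points and, for every edge e, a bijection
intertwining the two resulting actions of G_e. Changing base along the spanning tree shows that
there are h_n · n!^(|V|-1) of them (`card_edgeRep_eq`).

For a finite group G acting on n points with k orbits, the automorphism group of the action has
order n^k up to a factor exp(O(n)) (`card_le_pow`, `pow_orbitCount_le`). Hence an equivalence class
of actions of G has n!/n^k members up to such a factor, and two equivalent actions of G_e have
n^(number of orbits of G_e) intertwiners, again up to such a factor. If the multiplicities of the
transitive constituents are n·α, then α is a feasible point exactly when the restrictions to all
edge groups match, and the classes with these multiplicities contribute n!^|V| · n^(n·objective(α)).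
There are only polynomially many classes. With q the optimum, this gives h_n/n! ≤ exp(O(n)) n^(qn)
for all n ≥ 1 (`card_edgeRep_le`). A rational optimal point (`exists_rational_optimum`) is realized
for every n divisible by its denominators (`exists_compatible_of_feasible`), which gives the
matching lower bound for these n (`le_card_edgeRep`).

Subgroups of index n are transitive actions with a base point, so s_n ≤ n·h_n/n!. Conversely,
splitting off the orbit of a point gives the recursion of the exponential formula, by which a
smaller growth of s_n would force a smaller growth of h_n/n! (`le_limsup_log_div`). This needs q ≥
0. Free actions give a feasible point with value -χ, where χ = ∑ 1/|G_v| - ∑ 1/|G_e|, and χ ≤ 0 when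
Γ is infinite (`euler_char_nonpos`).

For effectivity, subgroups are coded by bit masks, conjugacy classes by their least mask, and
multiplicities by counting group elements. All of this is bounded search in the tables, hence
primitive recursive (`primrec_lpCode`, `exists_lpCode_eq`). -/

theorem isCompact_feasible {B : ℝ} (hB : ∀ x, L.IsFeasible x → ∀ i, x i ≤ B) :
    IsCompact {x | L.IsFeasible x} := by
  have hsub : {x | L.IsFeasible x} ⊆ Set.Icc (fun _ => 0) (fun _ => B) :=
    fun x hx => ⟨fun i => hx.1 i, fun i => hB x hx i⟩
  refine IsCompact.of_isClosed_subset isCompact_Icc ?_ hsub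
  have : {x | L.IsFeasible x} = (⋂ i, {x : ι → ℝ | 0 ≤ x i}) ∩
      ⋂ k, {x : ι → ℝ | ∑ i, (L.matrix k i : ℝ) * x i = (L.rhs k : ℝ)} := by
    ext x; simp [IsFeasible]
  rw [this]
  refine IsClosed.inter (isClosed_iInter fun i => isClosed_le continuous_const
    (continuous_apply i)) (isClosed_iInter fun k => isClosed_eq ?_ continuous_const)
  fun_prop

/-- A ℚ-linear retraction of ℝ onto ℚ, applied to each coordinate, turns a real solution of a
rational linear system into a rational one and keeps zeros. -/
theorem exists_rat_projection : ∃ π : ℝ →ₗ[ℚ] ℚ, π 1 = 1 := by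
  obtain ⟨π, hπ⟩ := LinearMap.exists_leftInverse_of_injective (Algebra.linearMap ℚ ℝ)
    (LinearMap.ker_eq_bot.2 (algebraMap ℚ ℝ).injective)
  refine ⟨π, ?_⟩
  have := congrArg (fun f => f 1) hπ
  simpa using this

/-- A kernel vector supported on the support of a feasible point with an entry `< 0`: moving along
it reaches a feasible point with smaller support. -/
theorem exists_smaller_support {x y : ι → ℝ} (hx : L.IsFeasible x)
    (hy : ∀ k, ∑ i, (L.matrix k i : ℝ) * y i = 0) (hsupp : ∀ i, x i = 0 → y i = 0)
    {i₀ : ι} (hi₀ : y i₀ < 0) :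
    ∃ t : ℝ, L.IsFeasible (fun i => x i + t * y i) ∧
      ∃ i₁, x i₁ ≠ 0 ∧ x i₁ + t * y i₁ = 0 := by
  classical
  -- The ratio test: the smallest quotient is the largest step that keeps all coordinates
  -- nonnegative, and it annihilates the coordinate `i₁`.
  obtain ⟨i₁, hi₁, hmin⟩ := Finset.exists_min_image (Finset.univ.filter fun i => y i < 0)
    (fun i => x i / (-y i)) ⟨i₀, by simpa using hi₀⟩
  simp only [Finset.mem_filter, Finset.mem_univ, true_and] at hi₁ hmin
  refine ⟨x i₁ / (-y i₁), ⟨fun i => ?_, fun k => ?_⟩, i₁, fun h => ?_, ?_⟩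
  · rcases lt_or_ge (y i) 0 with h | h
    · have := hmin i h
      rw [le_div_iff₀ (by linarith)] at this
      linarith
    · have := div_nonneg (hx.1 i₁) (by linarith : 0 ≤ -y i₁)
      have := mul_nonneg this h
      linarith [hx.1 i]
  · have h1 := hx.2 k
    have h2 := hy k
    have : ∑ i, (L.matrix k i : ℝ) * (x i + x i₁ / (-y i₁) * y i) =
        ∑ i, (L.matrix k i : ℝ) * x i + x i₁ / (-y i₁) * ∑ i, (L.matrix k i : ℝ) * y i := by
      rw [Finset.mul_sum, ← Finset.sum_add_distrib]
      exact Finset.sum_congr rfl fun i _ => by ring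
    rw [this, h1, h2]; ring
  · have := hsupp i₁ h
    linarith
  · have : y i₁ ≠ 0 := hi₁.ne
    field_simp
    ring

/-- An optimal point of minimal support is the only solution of the equations with zeros where it
has zeros. Its rational projection is such a solution, so the point is rational. Nothing is assumed
about the signs of the projected coordinates. -/
theorem exists_rational_optimum (hne : ∃ x, L.IsFeasible x)
    {B : ℝ} (hB : ∀ x, L.IsFeasible x → ∀ i, x i ≤ B) :
    ∃ x : ι → ℚ, L.IsFeasible (fun i => (x i : ℝ)) ∧
      L.IsOptimum ((∑ i, L.objective i * x i : ℚ) : ℝ) := by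
  classical
  let c : (ι → ℝ) → ℝ := fun x => ∑ i, (L.objective i : ℝ) * x i
  obtain ⟨x₀, hx₀, hmax₀⟩ := (L.isCompact_feasible hB).exists_isMaxOn hne
    (f := c) (by fun_prop)
  let Opt : Set (ι → ℝ) := {x | L.IsFeasible x ∧ ∀ z, L.IsFeasible z → c z ≤ c x}
  have hOpt : x₀ ∈ Opt := ⟨hx₀, fun z hz => hmax₀ hz⟩
  let supp : (ι → ℝ) → ℕ := fun x => (Finset.univ.filter fun i => x i ≠ 0).card
  obtain ⟨x, ⟨hx, hmax⟩, hmin⟩ : ∃ x ∈ Opt, ∀ z ∈ Opt, supp x ≤ supp z := by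
    obtain ⟨n, ⟨x, hx, rfl⟩, hn⟩ := WellFounded.has_min (wellFounded_lt (α := ℕ)) (supp '' Opt)
      ⟨_, x₀, hOpt, rfl⟩
    exact ⟨x, hx, fun z hz => not_lt.1 (hn _ ⟨z, hz, rfl⟩)⟩
  have cadd : ∀ (y : ι → ℝ) (t : ℝ), c (fun i => x i + t * y i) = c x + t * c y := by
    intro y t
    simp only [c, Finset.mul_sum, ← Finset.sum_add_distrib]
    exact Finset.sum_congr rfl fun i _ => by ring
  -- kernel vectors supported on the support of `x` vanish
  have key : ∀ y : ι → ℝ, (∀ k, ∑ i, (L.matrix k i : ℝ) * y i = 0) → (∀ i, x i = 0 → y i = 0) →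
      ∀ i, 0 ≤ y i := by
    intro y hy hsupp i₀
    by_contra hneg
    push Not at hneg
    obtain ⟨t, htf, i₁, h1, h2⟩ := L.exists_smaller_support hx hy hsupp hneg
    -- the objective does not change along `y`
    have hcy : c y = 0 := by
      -- small steps in both directions stay feasible
      have hstep : ∃ ε > 0, ∀ s : ℝ, |s| ≤ ε → L.IsFeasible (fun i => x i + s * y i) := by
        have : ∀ i, ∃ ε > 0, ∀ s : ℝ, |s| ≤ ε → 0 ≤ x i + s * y i := by
          intro i
          rcases (hx.1 i).eq_or_lt with h | h
          · exact ⟨1, one_pos, fun s _ => by rw [← h, hsupp i h.symm]; simp⟩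
          · refine ⟨x i / (|y i| + 1), by positivity, fun s hs => ?_⟩
            have h3 : |s * y i| ≤ x i := by
              rw [abs_mul]
              calc |s| * |y i| ≤ x i / (|y i| + 1) * (|y i| + 1) := by
                    gcongr; linarith
                _ = x i := by field_simp
            linarith [neg_abs_le (s * y i)]
        choose ε hε hs using this
        -- The extra element 1 keeps the minimum defined when there are no variables.
        refine ⟨(Finset.univ.image ε ∪ {1}).min' (by simp), ?_, fun s hs' => ⟨fun i => ?_, fun k => ?_⟩⟩
        · rw [gt_iff_lt, Finset.lt_min'_iff]
          intro a ha
          simp only [Finset.mem_union, Finset.mem_image, Finset.mem_univ, true_and,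
            Finset.mem_singleton] at ha
          rcases ha with ⟨i, rfl⟩ | rfl
          · exact hε i
          · exact one_pos
        · exact hs i s (hs'.trans (Finset.min'_le _ _ (by simp)))
        · have : ∑ i, (L.matrix k i : ℝ) * (x i + s * y i) =
              ∑ i, (L.matrix k i : ℝ) * x i + s * ∑ i, (L.matrix k i : ℝ) * y i := by
            rw [Finset.mul_sum, ← Finset.sum_add_distrib]
            exact Finset.sum_congr rfl fun i _ => by ring
          rw [this, hx.2 k, hy k]; ring
      obtain ⟨ε, hε, hf⟩ := hstep
      have h3 := hmax _ (hf ε (by rw [abs_of_pos hε]))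
      have h4 := hmax _ (hf (-ε) (by rw [abs_neg, abs_of_pos hε]))
      rw [cadd] at h3 h4
      nlinarith
    have hopt : (fun i => x i + t * y i) ∈ Opt := ⟨htf, fun z hz => by
      rw [cadd, hcy]; simpa using hmax z hz⟩
    refine absurd (hmin _ hopt) (not_le.2 (Finset.card_lt_card ?_))
    refine Finset.ssubset_iff_of_subset (fun i hi => ?_) |>.2 ⟨i₁, by simpa using h1, by simpa using h2⟩
    simp only [Finset.mem_filter, Finset.mem_univ, true_and] at hi ⊢
    intro h
    exact hi (by rw [h, hsupp i h]; ring)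
  -- so `x` equals its rational projection
  obtain ⟨π, hπ⟩ := exists_rat_projection
  have hπq : ∀ q : ℚ, π (q : ℝ) = q := fun q => by
    have := π.map_smul q 1
    simpa [Rat.smul_def, hπ] using this
  have hproj : ∀ k, ∑ i, L.matrix k i * π (x i) = L.rhs k := fun k => by
    have := congrArg π (hx.2 k)
    rw [map_sum, hπq] at this
    rw [← this]
    refine Finset.sum_congr rfl fun i _ => ?_
    have := π.map_smul (L.matrix k i) (x i)
    rw [Rat.smul_def] at this
    simpa using this.symm
  have hy : ∀ k, ∑ i, (L.matrix k i : ℝ) * (x i - (π (x i) : ℝ)) = 0 := fun k => by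
    have h1 := hx.2 k
    have h2 : ∑ i, (L.matrix k i : ℝ) * (π (x i) : ℝ) = (L.rhs k : ℝ) := by
      exact_mod_cast congrArg (fun q : ℚ => (q : ℝ)) (hproj k)
    simp only [mul_sub, Finset.sum_sub_distrib, h1, h2, sub_self]
  have hs : ∀ i, x i = 0 → x i - (π (x i) : ℝ) = 0 := fun i hi => by simp [hi]
  -- Applying `key` to the difference and to its negative forces it to vanish.
  have h1 := key _ hy hs
  have h2 := key (fun i => -(x i - (π (x i) : ℝ))) (fun k => by
    simpa only [mul_neg, Finset.sum_neg_distrib, neg_eq_zero] using hy k)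
    (fun i hi => by rw [hs i hi, neg_zero])
  have heq : (fun i => ((π (x i) : ℚ) : ℝ)) = x := funext fun i => by
    have h3 := h1 i; have h4 := h2 i; linarith
  refine ⟨fun i => π (x i), by rw [heq]; exact hx, ⟨x, hx, ?_⟩, ?_⟩
  · push_cast
    exact Finset.sum_congr rfl fun i _ => by rw [congrFun heq i]
  · rintro _ ⟨z, hz, rfl⟩
    refine (hmax z hz).trans (le_of_eq ?_)
    push_cast
    exact Finset.sum_congr rfl fun i _ => by rw [congrFun heq i]

end LinearProgram

/-! ### Subgroups of finite index and permutation representations -/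

section SubgroupCount

variable {Γ : Type*} [Group Γ]

theorem exists_coset_equiv {m : ℕ} (H : Subgroup Γ) (hH : H.index = m + 1) :
    ∃ β : Γ ⧸ H ≃ Fin (m + 1), β ((1 : Γ) : Γ ⧸ H) = 0 := by
  have : Nat.card (Γ ⧸ H) = m + 1 := hH
  have hf : Finite (Γ ⧸ H) := Nat.finite_of_card_ne_zero (by omega)
  let β := (Finite.equivFin (Γ ⧸ H)).trans (finCongr this)
  exact ⟨β.trans (Equiv.swap (β ((1 : Γ) : Γ ⧸ H)) 0), by simp⟩

/-- The permutation representation on the cosets of `H`, transported along `β`. -/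
def cosetHom {H : Subgroup Γ} {X : Type*} (β : Γ ⧸ H ≃ X) : Γ →* Equiv.Perm X :=
  β.permCongrHom.toMonoidHom.comp (MulAction.toPermHom Γ (Γ ⧸ H))

theorem cosetHom_apply {H : Subgroup Γ} {X : Type*} (β : Γ ⧸ H ≃ X) (g : Γ) (x : Γ ⧸ H) :
    cosetHom β g (β x) = β (g • x) := by
  simp [cosetHom]

theorem cosetHom_apply_one {H : Subgroup Γ} {X : Type*} (β : Γ ⧸ H ≃ X) (g : Γ) :
    cosetHom β g (β ((1 : Γ) : Γ ⧸ H)) = β (g : Γ ⧸ H) := by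
  rw [cosetHom_apply, MulAction.Quotient.smul_coe, smul_eq_mul, mul_one]

theorem cosetHom_fix_iff {H : Subgroup Γ} {X : Type*} (β : Γ ⧸ H ≃ X) (g : Γ) :
    cosetHom β g (β ((1 : Γ) : Γ ⧸ H)) = β ((1 : Γ) : Γ ⧸ H) ↔ g ∈ H := by
  rw [cosetHom_apply_one, β.apply_eq_iff_eq, eq_comm, QuotientGroup.eq]
  simp

/-- Subgroups of index `m + 1`, together with a numbering of the non-trivial cosets, inject into
the permutation representations of degree `m + 1`. -/
theorem exists_injective_subgroup_perm (m : ℕ) :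
    ∃ f : {H : Subgroup Γ // H.index = m + 1} × Equiv.Perm (Fin m) →
      (Γ →* Equiv.Perm (Fin (m + 1))), Function.Injective f := by
  choose β hβ using fun H : {H : Subgroup Γ // H.index = m + 1} => exists_coset_equiv H.1 H.2
  -- The trivial coset is numbered 0 and `σ τ` renumbers only the others. Thus H is recovered as the
  -- stabilizer of 0, and then `τ` from the images of 0.
  let σ : Equiv.Perm (Fin m) → Equiv.Perm (Fin (m + 1)) :=
    fun τ => Equiv.Perm.decomposeFin.symm (0, τ)
  have hσ : ∀ τ, σ τ 0 = 0 := fun τ => Equiv.Perm.decomposeFin_symm_apply_zero 0 τ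
  refine ⟨fun p => cosetHom ((β p.1).trans (σ p.2)), ?_⟩
  rintro ⟨H, τ⟩ ⟨K, ρ⟩ h
  dsimp only at h
  have b1 : ∀ (H : {H : Subgroup Γ // H.index = m + 1}) τ,
      ((β H).trans (σ τ)) ((1 : Γ) : Γ ⧸ H.1) = 0 := fun H τ => by simp [hβ, hσ]
  have hHK : H = K := by
    ext g
    have h1 := cosetHom_fix_iff ((β H).trans (σ τ)) g
    have h2 := cosetHom_fix_iff ((β K).trans (σ ρ)) g
    rw [b1] at h1 h2
    rw [← h1, ← h2, h]
  subst hHK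
  have : σ τ = σ ρ := by
    ext1 x
    obtain ⟨g, rfl⟩ := (β H).surjective x
    obtain ⟨g, rfl⟩ := QuotientGroup.mk_surjective g
    have h1 := cosetHom_apply_one ((β H).trans (σ τ)) g
    have h2 := cosetHom_apply_one ((β H).trans (σ ρ)) g
    rw [b1] at h1 h2
    rw [h, h2] at h1
    exact h1.symm
  have := Equiv.Perm.decomposeFin.symm.injective this
  simp only [Prod.mk.injEq, true_and] at this
  rw [this]

theorem finite_subgroups_of_index (m : ℕ) [Finite (Γ →* Equiv.Perm (Fin (m + 1)))] :
    Finite {H : Subgroup Γ // H.index = m + 1} := by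
  obtain ⟨f, hf⟩ := exists_injective_subgroup_perm (Γ := Γ) m
  exact Finite.of_injective (fun H => f (H, 1)) fun H K h => (Prod.ext_iff.1 (hf h)).1

theorem card_subgroups_mul_factorial_le (m : ℕ) [Finite (Γ →* Equiv.Perm (Fin (m + 1)))] :
    Nat.card {H : Subgroup Γ // H.index = m + 1} * m.factorial ≤
      Nat.card (Γ →* Equiv.Perm (Fin (m + 1))) := by
  obtain ⟨f, hf⟩ := exists_injective_subgroup_perm (Γ := Γ) m
  have := Nat.card_le_card_of_injective f hf
  rwa [Nat.card_prod, Nat.card_perm, Nat.card_fin] at this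

theorem exists_sum_equiv_extending {j m : ℕ} (ι : Fin j → Fin m)
    (hι : Function.Injective ι) : ∃ e : Fin j ⊕ Fin (m - j) ≃ Fin m, ∀ x, e (Sum.inl x) = ι x := by
  classical
  have hc : Fintype.card {x // x ∉ Set.range ι} = m - j := by
    rw [Fintype.card_subtype_compl, Fintype.card_fin]
    congr 1
    rw [Fintype.card_congr (Equiv.ofInjective ι hι).symm, Fintype.card_fin]
  let e₂ : Fin (m - j) ≃ {x // x ∉ Set.range ι} := (Fintype.equivFinOfCardEq hc).symm
  exact ⟨(Equiv.sumCongr (Equiv.ofInjective ι hι) e₂).trans (Equiv.Set.sumCompl (Set.range ι)),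
    fun x => rfl⟩

/-- An action on m + 1 points is determined by the stabilizer of 0, by the position of its
nontrivial cosets among the nonzero points, and by the action off the orbit of 0. Surjectivity is
enough, since the recursion is only needed as an inequality. -/
theorem exists_surjective_perm (m : ℕ) :
    ∃ f : (Σ j : Fin (m + 1), {H : Subgroup Γ // H.index = j + 1} × (Fin j ↪ Fin m) ×
      (Γ →* Equiv.Perm (Fin (m - j)))) → (Γ →* Equiv.Perm (Fin (m + 1))),
      Function.Surjective f := by
  classical
  choose β hβ using fun (j : Fin (m + 1)) (H : {H : Subgroup Γ // H.index = j + 1}) =>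
    exists_coset_equiv H.1 H.2
  let ι : ∀ j : Fin (m + 1), (Fin j ↪ Fin m) → Fin (j + 1) → Fin (m + 1) :=
    fun j u => Fin.cons 0 (Fin.succ ∘ u)
  have hι : ∀ j u, Function.Injective (ι j u) := fun j u => by
    rw [Fin.cons_injective_iff]
    exact ⟨by rintro ⟨x, hx⟩; exact Fin.succ_ne_zero _ hx, (Fin.succ_injective _).comp u.injective⟩
  have hsub : ∀ j : Fin (m + 1), m + 1 - (j + 1) = m - j := fun j => by omega
  choose e he using fun (j : Fin (m + 1)) u =>
    exists_sum_equiv_extending (ι j u) (hι j u)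
  let e' : ∀ (j : Fin (m + 1)) (_ : Fin j ↪ Fin m), Fin (j + 1) ⊕ Fin (m - j) ≃ Fin (m + 1) :=
    fun j u => (Equiv.sumCongr (Equiv.refl _) (finCongr (hsub j).symm)).trans (e j u)
  have he' : ∀ j u x, e' j u (Sum.inl x) = ι j u x := fun j u x => by simp [e', he]
  refine ⟨fun p => (e' p.1 p.2.2.1).permCongrHom.toMonoidHom.comp
    ((Equiv.Perm.sumCongrHom _ _).comp ((cosetHom (β p.1 p.2.1)).prod p.2.2.2)), fun φ => ?_⟩
  let _ : MulAction Γ (Fin (m + 1)) := MulAction.compHom _ φ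
  have hsm : ∀ (g : Γ) (x : Fin (m + 1)), g • x = φ g x := fun _ _ => rfl
  let H := MulAction.stabilizer Γ (0 : Fin (m + 1))
  have hidx : H.index = Nat.card (MulAction.orbit Γ (0 : Fin (m + 1))) :=
    MulAction.index_stabilizer _ _
  have hpos : 0 < H.index := by
    rw [hidx]
    have : Nonempty (MulAction.orbit Γ (0 : Fin (m + 1))) := ⟨⟨0, MulAction.mem_orbit_self _⟩⟩
    exact Nat.card_pos
  have hle : H.index ≤ m + 1 := by
    rw [hidx]
    exact (Finite.card_subtype_le _).trans (by simp)
  -- The base point is not counted in `j`; the index is positive, so the subtraction is not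
  -- truncated.
  let j : Fin (m + 1) := ⟨H.index - 1, by omega⟩
  have hHj : H.index = j + 1 := by simp only [j]; omega
  let H' : {H : Subgroup Γ // H.index = j + 1} := ⟨H, hHj⟩
  -- the orbit map
  let o : Fin (j + 1) → Fin (m + 1) := fun x =>
    MulAction.ofQuotientStabilizer Γ (0 : Fin (m + 1)) ((β j H').symm x)
  have ho : Function.Injective o :=
    (MulAction.injective_ofQuotientStabilizer Γ (0 : Fin (m + 1))).comp (β j H').symm.injective
  have ho0 : o 0 = 0 := by
    have : (β j H').symm 0 = ((1 : Γ) : Γ ⧸ H) := by rw [Equiv.symm_apply_eq, hβ]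
    simp only [o]
    rw [this, MulAction.ofQuotientStabilizer_mk, one_smul]
  have hequiv : ∀ (g : Γ) x, φ g (o x) = o (cosetHom (β j H') g x) := fun g x => by
    obtain ⟨y, rfl⟩ := (β j H').surjective x
    rw [cosetHom_apply]
    simp only [o, Equiv.symm_apply_apply]
    rw [MulAction.ofQuotientStabilizer_smul, hsm]
  have hne : ∀ x : Fin j, o x.succ ≠ 0 := fun x hx =>
    Fin.succ_ne_zero x (ho (hx.trans ho0.symm))
  let u : Fin j ↪ Fin m := ⟨fun x => (o x.succ).pred (hne x), fun x y hxy => by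
    have := Fin.pred_inj.1 hxy
    exact Fin.succ_injective _ (ho this)⟩
  have hu : ι j u = o := by
    funext x
    refine Fin.cases ?_ (fun x => ?_) x
    · simp [ι, ho0]
    · simp only [ι, Fin.cons_succ, Function.comp_apply]
      exact Fin.succ_pred _ (hne x)
  -- the transported representation preserves the first summand
  let ψ : Γ →* Equiv.Perm (Fin (j + 1) ⊕ Fin (m - j)) :=
    (e' j u).symm.permCongrHom.toMonoidHom.comp φ
  have hψ : ∀ g x, ψ g x = (e' j u).symm (φ g (e' j u x)) := fun g x => by
    simp [ψ, Equiv.permCongr_apply]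
  have hψl : ∀ g x, ψ g (Sum.inl x) = Sum.inl (cosetHom (β j H') g x) := fun g x => by
    rw [hψ, he', hu, hequiv, ← hu, ← he', Equiv.symm_apply_apply]
  have hrange : ∀ g, ψ g ∈ (Equiv.Perm.sumCongrHom (Fin (j + 1)) (Fin (m - j))).range := fun g =>
    Equiv.Perm.mem_sumCongrHom_range_of_perm_mapsTo_inl (by
      rintro _ ⟨x, rfl⟩
      exact ⟨_, (hψl g x).symm⟩)
  let χ' : Γ →* Equiv.Perm (Fin (j + 1)) × Equiv.Perm (Fin (m - j)) :=
    (MonoidHom.ofInjective Equiv.Perm.sumCongrHom_injective).symm.toMonoidHom.comp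
      (ψ.codRestrict _ hrange)
  have hχ' : ∀ g, Equiv.Perm.sumCongrHom _ _ (χ' g) = ψ g := fun g => by
    have := MonoidHom.apply_ofInjective_symm (Equiv.Perm.sumCongrHom_injective
      (α := Fin (j + 1)) (β := Fin (m - j))) ⟨ψ g, hrange g⟩
    exact this
  have hfst : ∀ g, (χ' g).1 = cosetHom (β j H') g := fun g => by
    ext1 x
    have h1 := hψl g x
    rw [← hχ'] at h1
    simpa using h1
  refine ⟨⟨j, H', u, (MonoidHom.snd _ _).comp χ'⟩, ?_⟩
  ext1 g
  have h2 : ((cosetHom (β j H')).prod ((MonoidHom.snd _ _).comp χ')) g = χ' g :=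
    Prod.ext (hfst g).symm rfl
  have h3 : (e' j u).permCongrHom (ψ g) = φ g := by
    ext1 x
    simp [hψ, Equiv.permCongr_apply]
  simp only [MonoidHom.comp_apply, h2, hχ']
  exact h3

/-- The exponential formula before normalization: for a_n = h_n/n!, division by m! turns it into
(m+1) a_(m+1) ≤ ∑ s_(j+1) a_(m-j). -/
theorem card_perm_reps_le (hfin : ∀ n, Finite (Γ →* Equiv.Perm (Fin n))) (m : ℕ) :
    Nat.card (Γ →* Equiv.Perm (Fin (m + 1))) ≤
      ∑ j ∈ Finset.range (m + 1), Nat.card {H : Subgroup Γ // H.index = j + 1} *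
        (m.descFactorial j * Nat.card (Γ →* Equiv.Perm (Fin (m - j)))) := by
  obtain ⟨f, hf⟩ := exists_surjective_perm (Γ := Γ) m
  have := fun j => finite_subgroups_of_index (Γ := Γ) j
  refine (Nat.card_le_card_of_surjective f hf).trans (le_of_eq ?_)
  rw [Nat.card_sigma, ← Fin.sum_univ_eq_sum_range (fun j =>
    Nat.card {H : Subgroup Γ // H.index = j + 1} *
        (m.descFactorial j * Nat.card (Γ →* Equiv.Perm (Fin (m - j)))))]
  refine Finset.sum_congr rfl fun j _ => ?_
  rw [Nat.card_prod, Nat.card_prod, Nat.card_eq_fintype_card (α := Fin j ↪ Fin m),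
    Fintype.card_embedding_eq, Fintype.card_fin, Fintype.card_fin]

end SubgroupCount

/-! ### Growth of sequences linked by the exponential formula -/

section GrowthAnalysis

/-- The factor `A ^ n` absorbs the finitely many exceptions, which makes the bound usable in an
induction. -/
theorem exists_nat_power_bound {s : ℕ → ℝ} {lam : ℝ} (hlam : 0 ≤ lam)
    (h : ∀ᶠ n : ℕ in atTop, s n ≤ (n : ℝ) ^ (lam * n)) :
    ∃ A : ℝ, 1 ≤ A ∧ ∀ n : ℕ, 1 ≤ n → s n ≤ A ^ n * (n : ℝ) ^ (lam * n) := by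
  obtain ⟨N, hN⟩ := eventually_atTop.1 h
  refine ⟨1 + ∑ i ∈ Finset.range N, |s i|, ?_, fun n hn => ?_⟩
  · have := Finset.sum_nonneg (fun i (_ : i ∈ Finset.range N) => abs_nonneg (s i))
    linarith
  have hS := Finset.sum_nonneg (fun i (_ : i ∈ Finset.range N) => abs_nonneg (s i))
  have hn1 : (1 : ℝ) ≤ n := by exact_mod_cast hn
  have hpow : (1 : ℝ) ≤ (n : ℝ) ^ (lam * n) := Real.one_le_rpow hn1 (by positivity)
  rcases lt_or_ge n N with hlt | hge
  · have h1 : s n ≤ ∑ i ∈ Finset.range N, |s i| := (le_abs_self _).trans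
      (Finset.single_le_sum (f := fun i => |s i|) (fun i _ => abs_nonneg _) (Finset.mem_range.2 hlt))
    have h2 : 1 + ∑ i ∈ Finset.range N, |s i| ≤ (1 + ∑ i ∈ Finset.range N, |s i|) ^ n :=
      le_self_pow₀ (by linarith) (by omega)
    nlinarith
  · refine (hN n hge).trans (le_mul_of_one_le_left (by positivity) (one_le_pow₀ (by linarith)))

/-- A bound `A ^ k * k ^ (λ k)` for the coefficients of a power series in the recursion for its
exponential passes to that exponential. -/
theorem exp_recursion_bound {s a : ℕ → ℝ} (ha0 : a 0 = 1) (ha : ∀ n, 0 ≤ a n)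
    (hrec : ∀ m : ℕ, (m + 1) * a (m + 1) ≤ ∑ j ∈ Finset.range (m + 1), s (j + 1) * a (m - j))
    {lam A : ℝ} (hlam : 0 ≤ lam) (hA : 1 ≤ A)
    (hs : ∀ n : ℕ, 1 ≤ n → s n ≤ A ^ n * (n : ℝ) ^ (lam * n)) :
    ∀ n : ℕ, a n ≤ (2 * A) ^ n * (n : ℝ) ^ (lam * n) := by
  intro n
  induction n using Nat.strong_induction_on with
  | _ n ih =>
    rcases n with _ | m
    · simp [ha0]
    have hm : (0 : ℝ) < (m + 1 : ℕ) := by positivity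
    -- The exponents of m + 1 add up because (j+1) + (m-j) = m+1. The 2 in `2 * A` is there to leave
    -- the factor (1/2)^(j+1), whose sum over j is at most 1.
    have hterm : ∀ j ∈ Finset.range (m + 1), s (j + 1) * a (m - j) ≤
        (2 * A) ^ (m + 1) * ((m + 1 : ℕ) : ℝ) ^ (lam * (m + 1 : ℕ)) * (1 / 2) ^ (j + 1) := by
      intro j hj
      rw [Finset.mem_range] at hj
      have h1 := hs (j + 1) (by omega)
      have h2 := ih (m - j) (by omega)
      have h3 : ((j + 1 : ℕ) : ℝ) ^ (lam * (j + 1 : ℕ)) ≤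
          ((m + 1 : ℕ) : ℝ) ^ (lam * (j + 1 : ℕ)) :=
        Real.rpow_le_rpow (by positivity) (by exact_mod_cast (by omega)) (by positivity)
      have h4 : ((m - j : ℕ) : ℝ) ^ (lam * (m - j : ℕ)) ≤
          ((m + 1 : ℕ) : ℝ) ^ (lam * (m - j : ℕ)) :=
        Real.rpow_le_rpow (by positivity) (by exact_mod_cast (by omega)) (by positivity)
      have h5 : ((m + 1 : ℕ) : ℝ) ^ (lam * (m + 1 : ℕ)) =
          ((m + 1 : ℕ) : ℝ) ^ (lam * (j + 1 : ℕ)) * ((m + 1 : ℕ) : ℝ) ^ (lam * (m - j : ℕ)) := by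
        rw [← Real.rpow_add hm]
        congr 1
        rw [← mul_add, ← Nat.cast_add]
        congr 2
        omega
      have h6 : (2 * A) ^ (m + 1) * (1 / 2) ^ (j + 1) = A ^ (j + 1) * (2 * A) ^ (m - j) := by
        have : m + 1 = (j + 1) + (m - j) := by omega
        rw [this, pow_add, mul_pow 2 A (j + 1)]
        have h2p : (2 : ℝ) ^ (j + 1) * (1 / 2) ^ (j + 1) = 1 := by
          rw [← mul_pow]; norm_num
        calc _ = ((2 : ℝ) ^ (j + 1) * (1 / 2) ^ (j + 1)) * (A ^ (j + 1) * (2 * A) ^ (m - j)) := by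
              ring
          _ = _ := by rw [h2p, one_mul]
      calc s (j + 1) * a (m - j)
          ≤ (A ^ (j + 1) * ((m + 1 : ℕ) : ℝ) ^ (lam * (j + 1 : ℕ))) *
            ((2 * A) ^ (m - j) * ((m + 1 : ℕ) : ℝ) ^ (lam * (m - j : ℕ))) := by
            refine mul_le_mul (h1.trans ?_) (h2.trans ?_) (ha _) (by positivity)
            · gcongr
            · gcongr
        _ = _ := by
            rw [h5, show ∀ x y z w : ℝ, x * (y * z) * w = (x * w) * (y * z) by intros; ring, h6]
            ring
    have hgeom : ∑ j ∈ Finset.range (m + 1), (1 / 2 : ℝ) ^ (j + 1) ≤ 1 := by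
      simp only [pow_succ, ← Finset.sum_mul]
      rw [geom_sum_eq (by norm_num)]
      have h1 : (0 : ℝ) ≤ (1 / 2) ^ (m + 1) := by positivity
      have h2 : ∀ x : ℝ, (x - 1) / (1 / 2 - 1) * (1 / 2) = 1 - x := fun x => by ring
      rw [h2]
      linarith
    have h7 := (hrec m).trans (Finset.sum_le_sum hterm)
    rw [← Finset.mul_sum] at h7
    have h8 : (0 : ℝ) ≤ (2 * A) ^ (m + 1) * ((m + 1 : ℕ) : ℝ) ^ (lam * (m + 1 : ℕ)) := by
      positivity
    have h9 : a (m + 1) ≤ (m + 1) * a (m + 1) :=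
      le_mul_of_one_le_left (ha _) (by linarith [(m.cast_nonneg : (0 : ℝ) ≤ m)])
    exact h9.trans (h7.trans (mul_le_of_le_one_right h8 hgeom))

/-- The exponential of a polynomial: its coefficients decay faster than any exponential. -/
theorem exp_recursion_decay {s a : ℕ → ℝ} (ha : ∀ n, 0 ≤ a n)
    (hrec : ∀ m : ℕ, (m + 1) * a (m + 1) ≤ ∑ j ∈ Finset.range (m + 1), s (j + 1) * a (m - j))
    {K : ℕ} (hs : ∀ n, K < n → s n = 0) {r : ℝ} (hr : 0 < r) (hr1 : r ≤ 1) :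
    ∃ C : ℝ, ∀ n : ℕ, a n ≤ C * r ^ n := by
  obtain ⟨S, hS0, hS⟩ : ∃ S : ℝ, 0 ≤ S ∧ ∀ n, s n ≤ S := by
    refine ⟨∑ i ∈ Finset.range (K + 1), |s i|, Finset.sum_nonneg fun _ _ => abs_nonneg _,
      fun n => ?_⟩
    rcases lt_or_ge K n with h | h
    · rw [hs n h]; exact Finset.sum_nonneg fun _ _ => abs_nonneg _
    · exact (le_abs_self _).trans (Finset.single_le_sum (f := fun i => |s i|)
        (fun i _ => abs_nonneg _) (Finset.mem_range.2 (by omega)))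
  -- At most K terms of the recursion survive, each at most S·C·r^(m+1-K). Beyond this N the factor
  -- m + 1 on the left outweighs S·K·r^(-K).
  obtain ⟨N, hN⟩ := exists_nat_ge (S * K * (r ^ K)⁻¹)
  obtain ⟨C, hC0, hC⟩ : ∃ C : ℝ, 0 ≤ C ∧ ∀ n ≤ N, a n ≤ C * r ^ n := by
    refine ⟨∑ i ∈ Finset.range (N + 1), a i / r ^ i, Finset.sum_nonneg fun i _ => by
      have := ha i; positivity, fun n hn => ?_⟩
    rw [← div_le_iff₀ (by positivity)]
    exact Finset.single_le_sum (f := fun i => a i / r ^ i) (fun i _ => by have := ha i; positivity)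
      (Finset.mem_range.2 (by omega))
  refine ⟨C, fun n => ?_⟩
  induction n using Nat.strong_induction_on with
  | _ n ih =>
    rcases le_or_gt n N with h | h
    · exact hC n h
    obtain ⟨m, rfl⟩ : ∃ m, n = m + 1 := ⟨n - 1, by omega⟩
    have hterm : ∀ j ∈ Finset.range (m + 1), s (j + 1) * a (m - j) ≤
        if j < K then S * (C * (r ^ (m + 1) * (r ^ K)⁻¹)) else 0 := by
      intro j hj
      rw [Finset.mem_range] at hj
      split_ifs with hjK
      · have h2 := ih (m - j) (by omega)
        have h3 : r ^ (m - j) ≤ r ^ (m + 1) * (r ^ K)⁻¹ := by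
          rw [← div_eq_mul_inv, le_div_iff₀ (by positivity), ← pow_add]
          exact pow_le_pow_of_le_one hr.le hr1 (by omega)
        calc s (j + 1) * a (m - j) ≤ S * a (m - j) := by gcongr; exacts [ha _, hS _]
          _ ≤ S * (C * r ^ (m - j)) := by gcongr
          _ ≤ _ := by gcongr
      · rw [hs (j + 1) (by omega), zero_mul]
    have h1 := (hrec m).trans (Finset.sum_le_sum hterm)
    have hpos : 0 ≤ S * (C * (r ^ (m + 1) * (r ^ K)⁻¹)) := by positivity
    have h2 : ∑ j ∈ Finset.range (m + 1),
        (if j < K then S * (C * (r ^ (m + 1) * (r ^ K)⁻¹)) else 0) ≤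
        K * (S * (C * (r ^ (m + 1) * (r ^ K)⁻¹))) := by
      rw [← Finset.sum_filter, Finset.sum_const, nsmul_eq_mul]
      gcongr
      calc _ ≤ (Finset.range K).card := Finset.card_le_card fun j hj => by
              simp only [Finset.mem_filter, Finset.mem_range] at hj ⊢; exact hj.2
        _ = K := Finset.card_range K
    have h3 : (N : ℝ) ≤ m + 1 := by exact_mod_cast h.le
    have h4 : K * (S * (C * (r ^ (m + 1) * (r ^ K)⁻¹))) ≤ (m + 1) * (C * r ^ (m + 1)) := by
      calc _ = (S * K * (r ^ K)⁻¹) * (C * r ^ (m + 1)) := by ring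
        _ ≤ _ := by gcongr; linarith
    have h5 := h1.trans (h2.trans h4)
    exact le_of_mul_le_mul_left h5 (by positivity)

theorem log_natCast_ennreal {k : ℕ} (hk : k ≠ 0) :
    ENNReal.log (((k : ℕ∞) : ℝ≥0∞)) = ((Real.log k : ℝ) : EReal) := by
  have : (((k : ℕ∞) : ℝ≥0∞)) = ENNReal.ofReal k := by simp
  rw [this, ENNReal.log_ofReal_of_pos (by exact_mod_cast Nat.pos_of_ne_zero hk)]

/-- `limsup log s_n / (n log n) ≤ q` from `s_n ≤ n e^{Cn} n^{qn}`. -/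
theorem limsup_log_div_le {s : ℕ → ℕ} {q C : ℝ}
    (h : ∀ n : ℕ, 1 ≤ n → (s n : ℝ) ≤ n * (Real.exp (C * n) * (n : ℝ) ^ (q * n))) :
    limsup (fun n : ℕ => ENNReal.log (((s n : ℕ∞) : ℝ≥0∞)) /
      (((n : ℝ) * Real.log n : ℝ) : EReal)) atTop ≤ (q : EReal) := by
  have key : ∀ n : ℕ, 2 ≤ n → ENNReal.log (((s n : ℕ∞) : ℝ≥0∞)) /
      (((n : ℝ) * Real.log n : ℝ) : EReal) ≤ ((q + (1 / n + C / Real.log n) : ℝ) : EReal) := by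
    intro n hn
    have hn' : (2 : ℝ) ≤ n := by exact_mod_cast hn
    have hlog : 0 < Real.log n := Real.log_pos (by linarith)
    have hpos : (0 : ℝ) < n * Real.log n := by positivity
    rcases Nat.eq_zero_or_pos (s n) with h0 | h0
    · rw [h0]
      simp only [Nat.cast_zero, ENat.toENNReal_zero, ENNReal.log_zero]
      rw [EReal.bot_div_of_pos_ne_top (by exact_mod_cast hpos) (EReal.coe_ne_top _)]
      exact bot_le
    · rw [log_natCast_ennreal h0.ne', ← EReal.coe_div, EReal.coe_le_coe_iff, div_le_iff₀ hpos]
      have h1 := Real.log_le_log (by exact_mod_cast h0) (h n (by omega))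
      rw [Real.log_mul (by positivity) (by positivity), Real.log_mul (by positivity) (by positivity),
        Real.log_exp, Real.log_rpow (by linarith)] at h1
      refine h1.trans (le_of_eq ?_)
      have : (n : ℝ) ≠ 0 := by positivity
      field_simp
      ring
  have htend : Tendsto (fun n : ℕ => ((q + (1 / n + C / Real.log n) : ℝ) : EReal)) atTop
      (nhds (q : EReal)) := by
    refine (continuous_coe_real_ereal.tendsto q).comp ?_
    have h1 : Tendsto (fun n : ℕ => C / Real.log n) atTop (nhds 0) :=
      (tendsto_const_nhds (x := C)).div_atTop (Real.tendsto_log_atTop.comp tendsto_natCast_atTop_atTop)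
    have h2 := (tendsto_one_div_atTop_nhds_zero_nat (𝕜 := ℝ)).add h1
    simpa using h2.const_add q
  rw [← htend.limsup_eq]
  exact limsup_le_limsup (eventually_atTop.2 ⟨2, key⟩)

/-- Otherwise some λ lies strictly between the limsup and q. If q > 0, the recursion carries the
exponent max(λ, 0) over to `a`, against the lower bound at large multiples of D. If q = 0, then λ <
0 and integrality makes s_n vanish for large n, so `a` decays faster than every exponential, again
too fast. -/
theorem le_limsup_log_div {s : ℕ → ℕ} {a : ℕ → ℝ} (ha0 : a 0 = 1) (ha : ∀ n, 0 ≤ a n)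
    (hrec : ∀ m : ℕ, (m + 1) * a (m + 1) ≤
      ∑ j ∈ Finset.range (m + 1), (s (j + 1) : ℝ) * a (m - j))
    {q C : ℝ} (hq : 0 ≤ q) {D : ℕ} (hD : 0 < D)
    (hlow : ∀ n : ℕ, 1 ≤ n → D ∣ n → Real.exp (-(C * n)) * (n : ℝ) ^ (q * n) ≤ a n) :
    (q : EReal) ≤ limsup (fun n : ℕ => ENNReal.log (((s n : ℕ∞) : ℝ≥0∞)) /
      (((n : ℝ) * Real.log n : ℝ) : EReal)) atTop := by
  by_contra hlt
  push Not at hlt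
  obtain ⟨lam, hlam1, hlam2⟩ := EReal.lt_iff_exists_real_btwn.1 hlt
  rw [EReal.coe_lt_coe_iff] at hlam2
  have hev := eventually_lt_of_limsup_lt hlam1
  -- eventually `s n ≤ n ^ (lam * n)`, and `s n = 0` if `lam < 0`
  have hev' : ∀ᶠ n : ℕ in atTop, s n ≠ 0 → (s n : ℝ) ≤ (n : ℝ) ^ (lam * n) := by
    filter_upwards [hev, eventually_ge_atTop 2] with n hn hn2 h0
    have hn' : (2 : ℝ) ≤ n := by exact_mod_cast hn2
    have hlog : 0 < Real.log n := Real.log_pos (by linarith)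
    have hpos : (0 : ℝ) < n * Real.log n := by positivity
    rw [log_natCast_ennreal h0, ← EReal.coe_div, EReal.coe_lt_coe_iff, div_lt_iff₀ hpos] at hn
    rw [← Real.log_le_log_iff (by exact_mod_cast Nat.pos_of_ne_zero h0) (by positivity),
      Real.log_rpow (by linarith)]
    linarith
  -- all large multiples of `D`
  have hlarge : ∀ B : ℝ, ∃ n : ℕ, 1 ≤ n ∧ D ∣ n ∧ B < Real.log n := by
    intro B
    have h1 : Tendsto (fun k : ℕ => Real.log ((D * k : ℕ) : ℝ)) atTop atTop :=
      Real.tendsto_log_atTop.comp (tendsto_natCast_atTop_atTop.comp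
        (tendsto_id.const_mul_atTop' hD))
    obtain ⟨k, hk1, hk2⟩ := ((h1.eventually_gt_atTop B).and (eventually_ge_atTop 1)).exists
    exact ⟨D * k, Nat.mul_pos hD hk2, Dvd.intro _ rfl, hk1⟩
  rcases hq.eq_or_lt with hq0 | hq0
  · subst hq0
    obtain ⟨K, hK⟩ := eventually_atTop.1 (hev'.and (eventually_ge_atTop 2))
    have hs0 : ∀ n, K < n → (s n : ℝ) = 0 := by
      intro n hn
      by_contra h0
      have h0' : s n ≠ 0 := fun h => h0 (by simp [h])
      obtain ⟨h1, h2⟩ := hK n hn.le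
      have h3 := h1 h0'
      have hn' : (2 : ℝ) ≤ n := by exact_mod_cast h2
      have h4 : (n : ℝ) ^ (lam * n) < 1 :=
        Real.rpow_lt_one_of_one_lt_of_neg (by linarith) (mul_neg_of_neg_of_pos hlam2 (by linarith))
      have h5 : (1 : ℝ) ≤ s n := by exact_mod_cast Nat.pos_of_ne_zero h0'
      linarith
    -- This rate beats the lower bound exp(-Cn) by a factor exp(-n).
    obtain ⟨C', hC'⟩ := exp_recursion_decay ha hrec hs0 (r := Real.exp (-(|C| + 1)))
      (Real.exp_pos _) (Real.exp_le_one_iff.2 (by linarith [abs_nonneg C]))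
    obtain ⟨n, hn1, hnD, hn⟩ := hlarge (C' + 1)
    have h1 := (hlow n hn1 hnD).trans (hC' n)
    have hn' : (1 : ℝ) ≤ n := by exact_mod_cast hn1
    rw [zero_mul, Real.rpow_zero, mul_one, ← Real.exp_nat_mul] at h1
    have h2 : Real.exp (n * -(|C| + 1)) ≤ Real.exp (-(C * n)) * Real.exp (-n) := by
      rw [← Real.exp_add, Real.exp_le_exp]
      have := mul_le_mul_of_nonneg_right (le_abs_self C) (by linarith : (0 : ℝ) ≤ n)
      linarith
    have h3 : C' * Real.exp (n * -(|C| + 1)) ≤ |C'| * (Real.exp (-(C * n)) * Real.exp (-n)) :=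
      mul_le_mul (le_abs_self _) h2 (Real.exp_pos _).le (abs_nonneg _)
    have h4 : Real.exp (-(C * n)) * 1 ≤ Real.exp (-(C * n)) * (|C'| * Real.exp (-n)) := by
      linarith
    have h5 := le_of_mul_le_mul_left h4 (Real.exp_pos _)
    have h6 : Real.log n ≤ n := (Real.log_le_sub_one_of_pos (by linarith)).trans (by linarith)
    have h7 : C' < Real.exp n := by linarith [Real.add_one_le_exp (n : ℝ)]
    have h8 : 0 < C' := by
      by_contra h
      have := mul_nonpos_of_nonpos_of_nonneg (not_lt.1 h) (Real.exp_pos (n * -(|C| + 1))).le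
      linarith [Real.exp_pos (-(C * n))]
    rw [abs_of_pos h8, Real.exp_neg, ← div_eq_mul_inv, le_div_iff₀ (Real.exp_pos _)] at h5
    linarith
  -- The recursion bound needs a nonnegative exponent.
  · set lam' := max lam 0
    have hl0 : 0 ≤ lam' := le_max_right _ _
    have hl1 : lam' < q := max_lt hlam2 hq0
    have hev'' : ∀ᶠ n : ℕ in atTop, (s n : ℝ) ≤ (n : ℝ) ^ (lam' * n) := by
      filter_upwards [hev', eventually_ge_atTop 1] with n hn hn1
      have hn' : (1 : ℝ) ≤ n := by exact_mod_cast hn1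
      by_cases h0 : s n = 0
      · rw [h0, Nat.cast_zero]; positivity
      · exact (hn h0).trans (Real.rpow_le_rpow_of_exponent_le hn' (by gcongr; exact le_max_left _ _))
    obtain ⟨A, hA, hsA⟩ := exists_nat_power_bound hl0 hev''
    have hbound := exp_recursion_bound ha0 ha hrec hl0 hA hsA
    -- Above this value of log n, the power n^((q-λ')n) exceeds exp(Cn)·(2A)^n.
    obtain ⟨n, hn1, hnD, hn⟩ := hlarge ((C + Real.log (2 * A)) / (q - lam'))
    have hn' : (0 : ℝ) < n := by exact_mod_cast hn1
    have h1 := Real.log_le_log (by positivity) ((hlow n hn1 hnD).trans (hbound n))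
    rw [Real.log_mul (by positivity) (by positivity), Real.log_mul (by positivity) (by positivity),
      Real.log_exp, Real.log_rpow hn', Real.log_rpow hn', Real.log_pow] at h1
    rw [div_lt_iff₀ (by linarith)] at hn
    nlinarith

end GrowthAnalysis

noncomputable section

/-! ### Finite sets with a group action -/

namespace PermRepEquiv

variable {G X Y Z : Type*} [Group G] [MulAction G X] [MulAction G Y] [MulAction G Z]

theorem symm (h : PermRepEquiv G X Y) : PermRepEquiv G Y X := by
  obtain ⟨φ, hφ⟩ := h
  exact ⟨φ.symm, fun g x => by rw [Equiv.symm_apply_eq, hφ, Equiv.apply_symm_apply]⟩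

theorem trans (h : PermRepEquiv G X Y) (h' : PermRepEquiv G Y Z) : PermRepEquiv G X Z := by
  obtain ⟨φ, hφ⟩ := h
  obtain ⟨χ, hχ⟩ := h'
  exact ⟨φ.trans χ, fun g x => by simp [hφ, hχ]⟩

theorem sigma {ι : Type*} {X Y : ι → Type*} [∀ i, MulAction G (X i)] [∀ i, MulAction G (Y i)]
    (h : ∀ i, PermRepEquiv G (X i) (Y i)) : PermRepEquiv G (Σ i, X i) (Σ i, Y i) := by
  choose φ hφ using h
  refine ⟨Equiv.sigmaCongrRight φ, ?_⟩
  rintro g ⟨i, x⟩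
  simp [hφ]

theorem sigma_reindex {ι κ : Type*} (e : ι ≃ κ) {Y : κ → Type*} [∀ i, MulAction G (Y i)] :
    PermRepEquiv G (Σ i, Y (e i)) (Σ i, Y i) :=
  ⟨Equiv.sigmaCongrLeft e, fun _ _ => rfl⟩

end PermRepEquiv

/-- The set `X` on which `A` acts through `ψ`. -/
def PullbackAction {A G : Type*} [Group A] [Group G] (_ : A →* G) (X : Type*) : Type _ := X

namespace PullbackAction

variable {A B G X : Type*} [Group A] [Group B] [Group G] [MulAction G X]

instance (ψ : A →* G) : MulAction A (PullbackAction ψ X) := MulAction.compHom X ψ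

instance (ψ : A →* G) [Finite X] : Finite (PullbackAction ψ X) := inferInstanceAs (Finite X)

theorem permRepEquiv {Y : Type*} [MulAction G Y] (ψ : A →* G) (h : PermRepEquiv G X Y) :
    PermRepEquiv A (PullbackAction ψ X) (PullbackAction ψ Y) := by
  obtain ⟨φ, hφ⟩ := h
  exact ⟨φ, fun a x => hφ (ψ a) x⟩

theorem permRepEquiv_sigma {ι : Type*} {X : ι → Type*} [∀ i, MulAction G (X i)] (ψ : A →* G) :
    PermRepEquiv A (PullbackAction ψ (Σ i, X i)) (Σ i, PullbackAction ψ (X i)) :=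
  ⟨Equiv.refl _, fun _ _ => rfl⟩

end PullbackAction

/-- The number of orbits. -/
def orbitCount (G X : Type*) [Group G] [MulAction G X] : ℕ :=
  Nat.card (MulAction.orbitRel.Quotient G X)

instance orbitQuotientFinite (G X : Type*) [Group G] [MulAction G X] [Finite X] :
    Finite (MulAction.orbitRel.Quotient G X) :=
  inferInstanceAs (Finite (Quotient _))

/-- The orbit quotients of equivalent actions. -/
def orbitQuotientCongr {G X Y : Type*} [Group G] [MulAction G X] [MulAction G Y] (φ : X ≃ Y)
    (hφ : ∀ (g : G) x, φ (g • x) = g • φ x) :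
    MulAction.orbitRel.Quotient G X ≃ MulAction.orbitRel.Quotient G Y :=
  Quotient.congr φ fun x y => by
    simp only [MulAction.orbitRel_apply, MulAction.mem_orbit_iff]
    exact exists_congr fun g => by rw [← hφ, φ.apply_eq_iff_eq]

theorem PermRepEquiv.orbitCount_eq {G X Y : Type*} [Group G] [MulAction G X] [MulAction G Y]
    (h : PermRepEquiv G X Y) : orbitCount G X = orbitCount G Y := by
  obtain ⟨φ, hφ⟩ := h
  exact Nat.card_congr (orbitQuotientCongr φ hφ)

/-- The orbits of a disjoint union. -/
def orbitQuotientSigma (G : Type*) [Group G] {ι : Type*} (X : ι → Type*)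
    [∀ i, MulAction G (X i)] :
    MulAction.orbitRel.Quotient G (Σ i, X i) ≃ Σ i, MulAction.orbitRel.Quotient G (X i) where
  toFun := Quotient.lift (fun p => ⟨p.1, Quotient.mk _ p.2⟩) (by
    rintro ⟨i, x⟩ ⟨j, y⟩ ⟨g, hg⟩
    simp only [Sigma.smul_mk, Sigma.mk.injEq] at hg
    obtain ⟨rfl, hg⟩ := hg
    simp only [Sigma.mk.injEq, heq_eq_eq, true_and]
    exact Quotient.sound ⟨g, eq_of_heq hg⟩)
  invFun p := Quotient.map (sa := MulAction.orbitRel G (X p.1)) (Sigma.mk p.1) (by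
    rintro x y ⟨g, rfl⟩
    exact ⟨g, rfl⟩) p.2
  left_inv := by
    rintro ⟨p⟩
    rfl
  right_inv := by
    rintro ⟨i, ⟨x⟩⟩
    rfl

/-! ### Orbit types and their multiplicities -/

namespace TransRep

variable {G : Type*} [Group G]

/-- The class of the coset action on `G ⧸ H`. -/
def mk (H : Subgroup G) : TransRep G := Quotient.mk (cosetActionSetoid G) H

theorem mk_eq_mk {H K : Subgroup G} : mk H = mk K ↔ PermRepEquiv G (G ⧸ H) (G ⧸ K) :=
  Quotient.eq (r := cosetActionSetoid G)

theorem mk_stab (ρ : TransRep G) : mk ρ.stab = ρ := Quotient.out_eq _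

variable {X : Type*} [MulAction G X]

theorem orbit_permRepEquiv (x : X) :
    PermRepEquiv G (MulAction.orbit G x) (G ⧸ MulAction.stabilizer G x) := by
  refine PermRepEquiv.symm ⟨(MulAction.orbitEquivQuotientStabilizer G x).symm, fun g q => ?_⟩
  obtain ⟨q, rfl⟩ := QuotientGroup.mk_surjective q
  apply Subtype.ext
  rw [MulAction.Quotient.smul_coe, MulAction.orbitEquivQuotientStabilizer_symm_apply,
    MulAction.orbit.coe_smul, MulAction.orbitEquivQuotientStabilizer_symm_apply, smul_eq_mul,
    mul_smul]

/-- The class of the action on the orbit of `x`. -/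
def ofPoint (x : X) : TransRep G := mk (MulAction.stabilizer G x)

theorem ofPoint_smul (g : G) (x : X) : ofPoint (G := G) (g • x) = ofPoint x := by
  rw [ofPoint, ofPoint, mk_eq_mk]
  have h : MulAction.orbit G (g • x) = MulAction.orbit G x := MulAction.orbit_smul g x
  have h1 : PermRepEquiv G (MulAction.orbit G (g • x)) (MulAction.orbit G x) :=
    ⟨Equiv.setCongr h, fun _ _ => rfl⟩
  exact ((orbit_permRepEquiv (g • x)).symm.trans h1).trans (orbit_permRepEquiv x)

/-- The class of the action on an orbit. -/
def ofOrbit : MulAction.orbitRel.Quotient G X → TransRep G :=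
  Quotient.lift ofPoint (by rintro _ y ⟨g, rfl⟩; exact ofPoint_smul g y)

/-- This turns the multiplicities into fibre sizes of the map `ofOrbit`, so that sums over classes
become counts of orbits. -/
theorem permRepEquiv_orbit_iff (ω : MulAction.orbitRel.Quotient G X) (ρ : TransRep G) :
    PermRepEquiv G ω.orbit (G ⧸ ρ.stab) ↔ ofOrbit ω = ρ := by
  obtain ⟨x, rfl⟩ := Quotient.mk_surjective ω
  have h := orbit_permRepEquiv (G := G) x
  change PermRepEquiv G (MulAction.orbit G x) _ ↔ mk (MulAction.stabilizer G x) = ρ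
  have h2 : mk (MulAction.stabilizer G x) = ρ ↔ mk (MulAction.stabilizer G x) = mk ρ.stab := by
    rw [mk_stab]
  rw [h2, mk_eq_mk]
  exact ⟨fun h' => h.symm.trans h', fun h' => h.trans h'⟩

theorem multiplicity_eq (ρ : TransRep G) (X : Type*) [MulAction G X] : ρ.multiplicity X =
    Nat.card {ω : MulAction.orbitRel.Quotient G X // ofOrbit ω = ρ} :=
  Nat.card_congr (Equiv.subtypeEquivRight fun ω => permRepEquiv_orbit_iff ω ρ)

theorem multiplicity_congr (ρ : TransRep G) {Y : Type*} [MulAction G Y] (h : PermRepEquiv G X Y) :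
    ρ.multiplicity X = ρ.multiplicity Y := by
  obtain ⟨φ, hφ⟩ := h
  rw [multiplicity_eq, multiplicity_eq]
  refine Nat.card_congr (Equiv.subtypeEquiv (orbitQuotientCongr φ hφ) ?_)
  rintro ⟨x⟩
  have : MulAction.stabilizer G (φ x) = MulAction.stabilizer G x := by
    ext g
    rw [MulAction.mem_stabilizer_iff, MulAction.mem_stabilizer_iff, ← hφ, φ.apply_eq_iff_eq]
  change mk (MulAction.stabilizer G x) = ρ ↔ mk (MulAction.stabilizer G (φ x)) = ρ
  rw [this]

theorem multiplicity_sigma {ι : Type*} [Fintype ι] (X : ι → Type*) [∀ i, MulAction G (X i)]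
    [∀ i, Finite (X i)] (ρ : TransRep G) :
    ρ.multiplicity (Σ i, X i) = ∑ i, ρ.multiplicity (X i) := by
  simp only [multiplicity_eq]
  rw [← Nat.card_sigma]
  refine Nat.card_congr ((Equiv.subtypeEquiv (orbitQuotientSigma G X)
    (q := fun p => ofOrbit p.2 = ρ) ?_).trans
    ⟨fun p => ⟨p.1.1, p.1.2, p.2⟩, fun p => ⟨⟨p.1, p.2.1⟩, p.2.2⟩, fun _ => rfl, fun _ => rfl⟩)
  rintro ⟨⟨i, x⟩⟩
  have : MulAction.stabilizer G (⟨i, x⟩ : Σ i, X i) = MulAction.stabilizer G x := by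
    ext g
    simp [MulAction.mem_stabilizer_iff]
  change mk (MulAction.stabilizer G (⟨i, x⟩ : Σ i, X i)) = ρ ↔ mk (MulAction.stabilizer G x) = ρ
  rw [this]

open Classical in
theorem multiplicity_coset (ρ θ : TransRep G) :
    ρ.multiplicity (G ⧸ θ.stab) = if θ = ρ then 1 else 0 := by
  rw [multiplicity_eq]
  have hu : ∀ ω : MulAction.orbitRel.Quotient G (G ⧸ θ.stab),
      ω = Quotient.mk _ ((1 : G) : G ⧸ θ.stab) := by
    rintro ⟨⟨g⟩⟩
    exact Quotient.sound ⟨g, by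
      change g • ((1 : G) : G ⧸ θ.stab) = (g : G ⧸ θ.stab)
      rw [MulAction.Quotient.smul_coe, smul_eq_mul, mul_one]⟩
  have h1 : ofOrbit (Quotient.mk (MulAction.orbitRel G _) ((1 : G) : G ⧸ θ.stab)) = θ := by
    change mk (MulAction.stabilizer G ((1 : G) : G ⧸ θ.stab)) = θ
    rw [MulAction.stabilizer_quotient, mk_stab]
  split_ifs with h
  · rw [Nat.card_eq_one_iff_unique]
    exact ⟨⟨fun a b => Subtype.ext ((hu a.1).trans (hu b.1).symm)⟩, ⟨⟨_, h1.trans h⟩⟩⟩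
  · rw [Nat.card_eq_zero]
    left
    exact ⟨fun a => h (by rw [← a.2, hu a.1, h1])⟩

/-- The disjoint union of `k θ` copies of every transitive permutation representation `θ`. -/
abbrev Model (k : TransRep G → ℕ) : Type _ :=
  Σ p : (Σ θ : TransRep G, Fin (k θ)), G ⧸ p.1.stab

theorem multiplicity_model [Finite G] (k : TransRep G → ℕ) (ρ : TransRep G) :
    ρ.multiplicity (Model k) = k ρ := by
  classical
  rw [multiplicity_sigma, Fintype.sum_sigma]
  simp [multiplicity_coset]

theorem card_model [Finite G] (k : TransRep G → ℕ) : Nat.card (Model k) = ∑ θ, k θ * θ.degree := by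
  rw [Nat.card_sigma, Fintype.sum_sigma]
  simp [degree]

/-- The normal form of a finite permutation representation, obtained by sorting its orbits by class.
It shows that the multiplicities determine the representation. -/
theorem permRepEquiv_model (X : Type*) [MulAction G X] [Finite X] :
    PermRepEquiv G X (Model fun θ : TransRep G => θ.multiplicity X) := by
  let Ω := MulAction.orbitRel.Quotient G X
  -- the decomposition into orbits
  have h1 : PermRepEquiv G X (Σ ω : Ω, ω.orbit) := by
    refine PermRepEquiv.symm ⟨(MulAction.selfEquivSigmaOrbits' G X).symm, ?_⟩
    rintro g ⟨ω, x⟩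
    rfl
  have h2 : PermRepEquiv G (Σ ω : Ω, ω.orbit) (Σ ω : Ω, G ⧸ (ofOrbit ω).stab) :=
    PermRepEquiv.sigma fun ω => (permRepEquiv_orbit_iff ω _).2 rfl
  -- numbering the orbits of every class
  have he : ∀ θ : TransRep G, Nonempty ({ω : Ω // ofOrbit ω = θ} ≃ Fin (θ.multiplicity X)) :=
    fun θ => ⟨(Finite.equivFin _).trans (finCongr (multiplicity_eq θ X).symm)⟩
  let e := fun θ => Classical.choice (he θ)
  let E : Ω ≃ Σ θ : TransRep G, Fin (θ.multiplicity X) :=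
    (Equiv.sigmaFiberEquiv (ofOrbit : Ω → TransRep G)).symm.trans (Equiv.sigmaCongrRight e)
  have h3 : PermRepEquiv G (Σ ω : Ω, G ⧸ (E ω).1.stab)
      (Model fun θ : TransRep G => θ.multiplicity X) :=
    PermRepEquiv.sigma_reindex (G := G) E (Y := fun p => G ⧸ p.1.stab)
  exact (h1.trans h2).trans h3

theorem permRepEquiv_of_multiplicity_eq [Finite G] {X Y : Type*} [MulAction G X] [MulAction G Y] [Finite X]
    [Finite Y] (h : ∀ θ : TransRep G, θ.multiplicity X = θ.multiplicity Y) : PermRepEquiv G X Y := by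
  have h1 := permRepEquiv_model (G := G) X
  rw [funext h] at h1
  exact h1.trans (permRepEquiv_model Y).symm

theorem sum_multiplicity_mul_degree [Finite G] (X : Type*) [MulAction G X] [Finite X] :
    ∑ θ : TransRep G, θ.multiplicity X * θ.degree = Nat.card X := by
  obtain ⟨φ, -⟩ := permRepEquiv_model (G := G) X
  rw [Nat.card_congr φ, card_model]

theorem sum_multiplicity [Finite G] (X : Type*) [MulAction G X] [Finite X] :
    ∑ θ : TransRep G, θ.multiplicity X = orbitCount G X := by
  simp only [multiplicity_eq]
  rw [← Nat.card_sigma]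
  exact Nat.card_congr (Equiv.sigmaFiberEquiv _)

theorem multiplicity_le (θ : TransRep G) (X : Type*) [MulAction G X] [Finite X] :
    θ.multiplicity X ≤ Nat.card X := by
  rw [multiplicity_eq]
  exact (Finite.card_subtype_le _).trans (Nat.card_le_card_of_surjective _ Quotient.mk_surjective)

theorem degree_pos [Finite G] (θ : TransRep G) : 0 < θ.degree := Nat.card_pos

/-- Pulling back commutes with disjoint unions, so the normal form reduces the count to single coset
actions. This is the source of the linearity of the forms ℓ. -/
theorem multiplicity_pullback [Finite G] {A : Type*} [Group A] (ψ : A →* G) (ρ : TransRep A)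
    (X : Type*) [MulAction G X] [Finite X] :
    ρ.multiplicity (PullbackAction ψ X) =
      ∑ θ : TransRep G, restrictMult ψ ρ θ * θ.multiplicity X := by
  rw [multiplicity_congr ρ (PullbackAction.permRepEquiv ψ (permRepEquiv_model (G := G) X)),
    multiplicity_congr ρ (PullbackAction.permRepEquiv_sigma ψ), multiplicity_sigma,
    Fintype.sum_sigma]
  refine Finset.sum_congr rfl fun θ _ => ?_
  change ∑ _y : Fin (θ.multiplicity X), restrictMult ψ ρ θ = _
  rw [Finset.sum_const, Finset.card_univ, Fintype.card_fin, smul_eq_mul, mul_comm]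

end TransRep

/-! ### Counting equivalences -/

/-- The equivalences between two permutation representations. -/
def EquivariantEquiv (G X Y : Type*) [Group G] [MulAction G X] [MulAction G Y] : Type _ :=
  {σ : X ≃ Y // ∀ (g : G) (x : X), σ (g • x) = g • σ x}

namespace EquivariantEquiv

variable {G X Y Z : Type*} [Group G] [MulAction G X] [MulAction G Y] [MulAction G Z]

instance [Finite X] [Finite Y] : Finite (EquivariantEquiv G X Y) :=
  inferInstanceAs (Finite (Subtype _))

theorem nonempty_iff : Nonempty (EquivariantEquiv G X Y) ↔ PermRepEquiv G X Y :=
  ⟨fun ⟨σ⟩ => ⟨σ.1, σ.2⟩, fun ⟨σ, h⟩ => ⟨⟨σ, h⟩⟩⟩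

theorem card_congr_right (h : PermRepEquiv G Y Z) :
    Nat.card (EquivariantEquiv G X Y) = Nat.card (EquivariantEquiv G X Z) := by
  obtain ⟨φ, hφ⟩ := h
  refine Nat.card_congr (Equiv.subtypeEquiv (Equiv.equivCongr (Equiv.refl X) φ) fun _ => ?_)
  refine forall_congr' fun g => forall_congr' fun x => ?_
  simp [← hφ]

theorem card_congr_left (h : PermRepEquiv G X Y) :
    Nat.card (EquivariantEquiv G X Z) = Nat.card (EquivariantEquiv G Y Z) := by
  obtain ⟨φ, hφ⟩ := h
  refine Nat.card_congr (Equiv.subtypeEquiv (Equiv.equivCongr φ (Equiv.refl Z)) fun σ => ?_)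
  refine forall_congr' fun g => ?_
  refine ⟨fun h y => ?_, fun h x => ?_⟩
  · obtain ⟨x, rfl⟩ := φ.surjective y
    simp [← hφ, h]
  · have := h (φ x)
    simpa [← hφ] using this

/-- An intertwiner is determined by the image of one point in each orbit. -/
theorem card_le_pow [Finite X] [Finite Y] :
    Nat.card (EquivariantEquiv G X Y) ≤ Nat.card Y ^ orbitCount G X := by
  have : Function.Injective (fun (σ : EquivariantEquiv G X Y)
      (ω : MulAction.orbitRel.Quotient G X) => σ.1 (Quotient.out ω)) := by
    intro σ τ h
    refine Subtype.ext (Equiv.ext fun x => ?_)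
    have hx : (MulAction.orbitRel G X).r (Quotient.out (Quotient.mk (MulAction.orbitRel G X) x)) x :=
      Quotient.mk_out (s := MulAction.orbitRel G X) x
    obtain ⟨g, hg⟩ := (MulAction.orbitRel G X).symm hx
    have h1 : σ.1 (Quotient.out (Quotient.mk (MulAction.orbitRel G X) x)) = τ.1 _ :=
      congrFun h (Quotient.mk _ x)
    dsimp only at hg
    rw [← hg, σ.2, τ.2, h1]
  have h2 := Nat.card_le_card_of_injective _ this
  rwa [Nat.card_fun] at h2

/-- Copies of the same coset action can be permuted freely. -/
theorem prod_factorial_le_card_model [Finite G] (k : TransRep G → ℕ) :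
    ∏ θ, (k θ).factorial ≤
      Nat.card (EquivariantEquiv G (TransRep.Model k) (TransRep.Model k)) := by
  let f : (∀ θ : TransRep G, Equiv.Perm (Fin (k θ))) →
      EquivariantEquiv G (TransRep.Model k) (TransRep.Model k) := fun σ =>
    ⟨⟨fun p => ⟨⟨p.1.1, σ p.1.1 p.1.2⟩, p.2⟩, fun p => ⟨⟨p.1.1, (σ p.1.1).symm p.1.2⟩, p.2⟩,
      by rintro ⟨⟨θ, i⟩, x⟩; simp, by rintro ⟨⟨θ, i⟩, x⟩; simp⟩, by rintro g ⟨⟨θ, i⟩, x⟩; rfl⟩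
  have hf : Function.Injective f := by
    intro σ τ h
    funext θ
    ext1 i
    have h1 := congrArg (fun e => e.1 ⟨⟨θ, i⟩, ((1 : G) : G ⧸ θ.stab)⟩) h
    have h2 := congrArg Sigma.fst h1
    simpa [f] using h2
  have h2 := Nat.card_le_card_of_injective _ hf
  simpa [Nat.card_pi, Fintype.card_perm] using h2

theorem pow_le_exp_mul_factorial (N k : ℕ) : (N : ℝ) ^ k ≤ Real.exp N * k.factorial := by
  rw [← div_le_iff₀ (by positivity)]
  exact Real.pow_div_factorial_le_exp N (by positivity) k

/-- The counterpart of `card_le_pow`: apply N^k ≤ e^N k! to the multiplicity of each class and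
compare the product of the factorials with the permutations of equal orbits. -/
theorem pow_orbitCount_le [Finite G] [Finite X] :
    (Nat.card X : ℝ) ^ orbitCount G X ≤
      Real.exp (Fintype.card (TransRep G) * Nat.card X) * Nat.card (EquivariantEquiv G X X) := by
  have h := TransRep.permRepEquiv_model (G := G) X
  rw [card_congr_left h, card_congr_right h, ← TransRep.sum_multiplicity, ← Finset.prod_pow_eq_pow_sum]
  have h1 := prod_factorial_le_card_model (fun θ : TransRep G => θ.multiplicity X)
  calc ∏ θ : TransRep G, (Nat.card X : ℝ) ^ θ.multiplicity X
      ≤ ∏ θ : TransRep G, (Real.exp (Nat.card X) * (θ.multiplicity X).factorial) :=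
        Finset.prod_le_prod (fun _ _ => by positivity) fun _ _ => pow_le_exp_mul_factorial _ _
    _ = Real.exp (Fintype.card (TransRep G) * Nat.card X) *
          ((∏ θ : TransRep G, (θ.multiplicity X).factorial : ℕ) : ℝ) := by
        rw [Finset.prod_mul_distrib, Finset.prod_const, Finset.card_univ, ← Real.exp_nat_mul]
        push_cast
        rfl
    _ ≤ _ := by gcongr

end EquivariantEquiv

end

noncomputable section

/-! ### Counting permutation representations on a fixed set -/

section HomCount

variable {G X : Type*} [Group G]

/-- `X` with the action of `G` given by `φ`. -/
abbrev ActionSet (φ : G →* Equiv.Perm X) : Type _ := PullbackAction φ X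

instance finiteMonoidHom {G P : Type*} [Group G] [Group P] [Finite G] [Finite P] :
    Finite (G →* P) :=
  Finite.of_injective (fun f : G →* P => (f : G → P)) DFunLike.coe_injective

/-- Intertwiners as permutations. -/
def equivariantEquivConj {φ φ' : G →* Equiv.Perm X} :
    EquivariantEquiv G (ActionSet φ) (ActionSet φ') ≃
      {σ : Equiv.Perm X // ∀ g, σ * φ g * σ⁻¹ = φ' g} :=
  Equiv.subtypeEquivRight fun (σ : Equiv.Perm X) => forall_congr' fun g => by
    rw [mul_inv_eq_iff_eq_mul, Equiv.ext_iff]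
    rfl

/-- The action of `P` by conjugation on the homomorphisms to `P`. -/
@[reducible] def conjHomAction (G P : Type*) [Group G] [Group P] : MulAction P (G →* P) where
  smul σ φ := (MulAut.conj σ).toMonoidHom.comp φ
  one_smul φ := by
    change (MulAut.conj 1).toMonoidHom.comp φ = φ
    ext g; simp
  mul_smul σ τ φ := by
    change (MulAut.conj (σ * τ)).toMonoidHom.comp φ =
      (MulAut.conj σ).toMonoidHom.comp ((MulAut.conj τ).toMonoidHom.comp φ)
    ext g; simp

theorem conjHomAction_smul_eq_iff {P : Type*} [Group P] {σ : P} {φ φ' : G →* P} :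
    (letI := conjHomAction G P; σ • φ) = φ' ↔ ∀ g, σ * φ g * σ⁻¹ = φ' g :=
  DFunLike.ext_iff

theorem permRepEquiv_iff_exists_conj {φ φ' : G →* Equiv.Perm X} :
    PermRepEquiv G (ActionSet φ) (ActionSet φ') ↔
      ∃ σ : Equiv.Perm X, (letI := conjHomAction G (Equiv.Perm X); σ • φ) = φ' := by
  rw [← EquivariantEquiv.nonempty_iff, equivariantEquivConj.nonempty_congr, nonempty_subtype]
  exact exists_congr fun σ => conjHomAction_smul_eq_iff.symm

variable [Finite X]

/-- Orbit and stabilizer for conjugation by Sym(X): the orbit of `φ` is its equivalence class, the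
stabilizer is its automorphism group. -/
theorem card_class_mul_card_aut (φ : G →* Equiv.Perm X) :
    Nat.card {φ' : G →* Equiv.Perm X // PermRepEquiv G (ActionSet φ) (ActionSet φ')} *
      Nat.card (EquivariantEquiv G (ActionSet φ) (ActionSet φ)) = (Nat.card X).factorial := by
  let _ := conjHomAction G (Equiv.Perm X)
  have h1 : Nat.card {φ' : G →* Equiv.Perm X // PermRepEquiv G (ActionSet φ) (ActionSet φ')} =
      (MulAction.stabilizer (Equiv.Perm X) φ).index := by
    rw [MulAction.index_stabilizer]
    exact Nat.card_congr (Equiv.subtypeEquivRight fun φ' => permRepEquiv_iff_exists_conj)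
  have h2 : Nat.card (EquivariantEquiv G (ActionSet φ) (ActionSet φ)) =
      Nat.card (MulAction.stabilizer (Equiv.Perm X) φ) := by
    refine Nat.card_congr (equivariantEquivConj.trans (Equiv.subtypeEquivRight fun σ => ?_))
    exact (conjHomAction_smul_eq_iff (σ := σ) (φ := φ) (φ' := φ)).symm
  rw [h1, h2, mul_comm, Subgroup.card_mul_index, Nat.card_perm]

variable [Finite G]

/-- By Burnside's lemma, the stabilizer orders add up to |Sym(X)| times the number of classes. A
class is determined by its multiplicities, each of them between 0 and |X|. -/
theorem sum_card_aut_le [Fintype (G →* Equiv.Perm X)] :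
    ∑ φ : G →* Equiv.Perm X, Nat.card (EquivariantEquiv G (ActionSet φ) (ActionSet φ)) ≤
      (Nat.card X + 1) ^ Fintype.card (TransRep G) * (Nat.card X).factorial := by
  let _ := conjHomAction G (Equiv.Perm X)
  let Ω := MulAction.orbitRel.Quotient (Equiv.Perm X) (G →* Equiv.Perm X)
  rw [← Nat.card_sigma]
  have e : (Σ φ : G →* Equiv.Perm X, EquivariantEquiv G (ActionSet φ) (ActionSet φ)) ≃
      Ω × Equiv.Perm X :=
    (((Equiv.sigmaCongrRight fun φ => equivariantEquivConj.trans
      (Equiv.subtypeEquivRight fun σ =>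
        (conjHomAction_smul_eq_iff (σ := σ) (φ := φ) (φ' := φ)).symm)).trans
      ⟨fun p => (⟨p.2.1, p.1, p.2.2⟩ : Σ σ : Equiv.Perm X, MulAction.fixedBy (G →* Equiv.Perm X) σ),
        fun p => ⟨p.2.1, p.1, p.2.2⟩, fun _ => rfl, fun _ => rfl⟩)).trans
      (MulAction.sigmaFixedByEquivOrbitsProdGroup (Equiv.Perm X) (G →* Equiv.Perm X))
  rw [Nat.card_congr e, Nat.card_prod, Nat.card_perm]
  refine Nat.mul_le_mul_right _ ?_
  -- the class of a representation is determined by its multiplicities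
  let mult : Ω → (TransRep G → Fin (Nat.card X + 1)) := fun ω θ =>
    ⟨θ.multiplicity (ActionSet (Quotient.out ω)),
      Nat.lt_succ_of_le (TransRep.multiplicity_le θ (ActionSet (Quotient.out ω)))⟩
  have hinj : Function.Injective mult := by
    intro ω ω' h
    have h1 : PermRepEquiv G (ActionSet (Quotient.out ω')) (ActionSet (Quotient.out ω)) :=
      TransRep.permRepEquiv_of_multiplicity_eq fun θ => (Fin.ext_iff.1 (congrFun h θ)).symm
    obtain ⟨σ, hσ⟩ := permRepEquiv_iff_exists_conj.1 h1
    rw [← Quotient.out_eq ω, ← Quotient.out_eq ω']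
    exact Quotient.sound ⟨σ, hσ⟩
  have h2 := Nat.card_le_card_of_injective mult hinj
  rwa [Nat.card_fun, Nat.card_fin, Nat.card_eq_fintype_card (α := TransRep G)] at h2

/-- One exponential factor pays for replacing the powers by automorphism counts, the other for the
number of classes. -/
theorem sum_pow_orbitCount_le [Fintype (G →* Equiv.Perm X)] :
    ∑ φ : G →* Equiv.Perm X, (Nat.card X : ℝ) ^ orbitCount G (ActionSet φ) ≤
      Real.exp (2 * Fintype.card (TransRep G) * Nat.card X) * (Nat.card X).factorial := by
  set m := Fintype.card (TransRep G)
  set N := Nat.card X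
  have h1 : ((N : ℝ) + 1) ^ m ≤ Real.exp (m * N) := by
    rw [Real.exp_nat_mul]
    gcongr
    exact Real.add_one_le_exp _
  calc ∑ φ : G →* Equiv.Perm X, (N : ℝ) ^ orbitCount G (ActionSet φ)
      ≤ ∑ φ : G →* Equiv.Perm X, Real.exp (m * N) *
          Nat.card (EquivariantEquiv G (ActionSet φ) (ActionSet φ)) :=
        Finset.sum_le_sum fun φ _ => EquivariantEquiv.pow_orbitCount_le (G := G) (X := ActionSet φ)
    _ = Real.exp (m * N) * ((∑ φ : G →* Equiv.Perm X,
          Nat.card (EquivariantEquiv G (ActionSet φ) (ActionSet φ)) : ℕ) : ℝ) := by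
        rw [← Finset.mul_sum]; push_cast; rfl
    _ ≤ Real.exp (m * N) * (((N + 1) ^ m * N.factorial : ℕ) : ℝ) := by
        gcongr
        exact sum_card_aut_le
    _ = Real.exp (m * N) * (((N : ℝ) + 1) ^ m * N.factorial) := by push_cast; rfl
    _ ≤ Real.exp (m * N) * (Real.exp (m * N) * N.factorial) := by gcongr
    _ = _ := by rw [← mul_assoc, ← Real.exp_add]; ring_nf

/-- The transport of an action to a set of the same size. -/
theorem exists_hom_permRepEquiv {G X Y : Type*} [Group G] [MulAction G Y] (e : Y ≃ X) :
    ∃ φ : G →* Equiv.Perm X, PermRepEquiv G (ActionSet φ) Y :=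
  ⟨e.permCongrHom.toMonoidHom.comp (MulAction.toPermHom G Y),
    PermRepEquiv.symm ⟨e, fun g y => by
      change e (g • y) = e.permCongr (MulAction.toPerm g) (e y)
      simp [Equiv.permCongr_apply]⟩⟩

end HomCount

end

noncomputable section

/-! ### Spanning trees and representations of the fundamental group -/

namespace GraphOfGroups

variable {V E : Type*} (𝒢 : GraphOfGroups V E)

/-- A rooted spanning tree: its edges are numbered by the vertices other than the root `r`, each
edge joins its vertex to one of smaller depth. -/
theorem exists_parent_edges [Finite V] [Finite E] {T : Set E} (hT : 𝒢.IsSpanningTree T) (r : V) :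
    ∃ (d : V → ℕ) (p : {v : V // v ≠ r} ≃ T), ∀ v : {v : V // v ≠ r}, ∃ w : V, d w < d v ∧
      ((𝒢.src (p v) = v ∧ 𝒢.tgt (p v) = w) ∨ (𝒢.tgt (p v) = v ∧ 𝒢.src (p v) = w)) := by
  classical
  have := Fintype.ofFinite V
  have := Fintype.ofFinite E
  obtain ⟨hloop, hinj, htree⟩ := hT
  set S := SimpleGraph.fromRel fun x y => ∃ e ∈ T, 𝒢.src e = x ∧ 𝒢.tgt e = y
  have hadj : ∀ {x y}, S.Adj x y →
      ∃ e ∈ T, (𝒢.src e = x ∧ 𝒢.tgt e = y) ∨ (𝒢.tgt e = x ∧ 𝒢.src e = y) := by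
    intro x y h
    rw [SimpleGraph.fromRel_adj] at h
    obtain ⟨-, ⟨e, he, h1, h2⟩ | ⟨e, he, h1, h2⟩⟩ := h
    · exact ⟨e, he, Or.inl ⟨h1, h2⟩⟩
    · exact ⟨e, he, Or.inr ⟨h2, h1⟩⟩
  have hstep : ∀ v : {v : V // v ≠ r}, ∃ e ∈ T, ∃ w, S.dist r w < S.dist r v ∧
      ((𝒢.src e = v ∧ 𝒢.tgt e = w) ∨ (𝒢.tgt e = v ∧ 𝒢.src e = w)) := by
    intro v
    -- The depth is the distance from the root; the last step of a geodesic from `r` to `v` supplies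
    -- the edge assigned to `v`.
    obtain ⟨q, hq⟩ := (htree.1 r v).exists_walk_length_eq_dist
    have hnil : ¬ q.Nil := fun h => v.2 h.eq.symm
    have hA : S.Adj q.penultimate v := q.adj_penultimate hnil
    obtain ⟨e, he, h⟩ := hadj hA.symm
    refine ⟨e, he, q.penultimate, ?_, h⟩
    have h1 := SimpleGraph.dist_le q.dropLast
    have h2 : q.dropLast.length + 1 = q.length := by
      rw [SimpleGraph.Walk.length_dropLast_add_one hnil]
    omega
  choose p hpT w hw hend using hstep
  let p' : {v : V // v ≠ r} → T := fun v => ⟨p v, hpT v⟩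
  -- Two different vertices with the same edge would each be deeper than the other.
  have hp'inj : Function.Injective p' := by
    intro v v' h
    have h' : p v = p v' := congrArg Subtype.val h
    by_contra hne
    have hne' : (v : V) ≠ v' := fun h => hne (Subtype.ext h)
    have h1 := hend v
    have h2 := hend v'
    have h3 := hw v
    have h4 := hw v'
    rw [h'] at h1
    rcases h1 with ⟨a, b⟩ | ⟨a, b⟩ <;> rcases h2 with ⟨c, d⟩ | ⟨c, d⟩
    · exact hne' (a.symm.trans c)
    · rw [← b, c] at h3; rw [← d, a] at h4; omega
    · rw [← b, c] at h3; rw [← d, a] at h4; omega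
    · exact hne' (a.symm.trans c)
  -- The edge count of a tree makes the injection `p'` bijective.
  have hcard : Fintype.card T + 1 = Fintype.card V := by
    rw [← htree.card_edgeFinset]
    congr 1
    rw [← Set.toFinset_card]
    refine Finset.card_bij (fun e _ => s(𝒢.src e, 𝒢.tgt e)) ?_ ?_ ?_
    · intro e he
      rw [Set.mem_toFinset] at he
      rw [SimpleGraph.mem_edgeFinset, SimpleGraph.mem_edgeSet, SimpleGraph.fromRel_adj]
      exact ⟨hloop e he, Or.inl ⟨e, he, rfl, rfl⟩⟩
    · intro e he e' he' h
      exact hinj (by simpa using he) (by simpa using he') h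
    · intro s hs
      induction s with
      | _ x y =>
        rw [SimpleGraph.mem_edgeFinset, SimpleGraph.mem_edgeSet] at hs
        obtain ⟨e, he, ⟨rfl, rfl⟩ | ⟨rfl, rfl⟩⟩ := hadj hs
        · exact ⟨e, by simpa using he, rfl⟩
        · exact ⟨e, by simpa using he, Sym2.eq_swap⟩
  have hcard' : Fintype.card {v : V // v ≠ r} = Fintype.card T := by
    have : Fintype.card {v : V // v ≠ r} = Fintype.card V - 1 := by
      rw [Fintype.card_subtype_compl, Fintype.card_subtype_eq]
    omega
  refine ⟨S.dist r, Equiv.ofBijective p'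
    ((Fintype.bijective_iff_injective_and_card p').2 ⟨hp'inj, hcard'⟩), fun v => ?_⟩
  exact ⟨w v, hw v, hend v⟩

theorem IsSpanningTree.nonempty {T : Set E} {𝒢 : GraphOfGroups V E} (hT : 𝒢.IsSpanningTree T) :
    Nonempty V := hT.2.2.1.nonempty

theorem IsSpanningTree.card_add_one [Finite V] [Finite E] {T : Set E} {𝒢 : GraphOfGroups V E}
    (hT : 𝒢.IsSpanningTree T) : Nat.card T + 1 = Nat.card V := by
  classical
  have := Fintype.ofFinite V
  obtain ⟨r⟩ := hT.nonempty
  obtain ⟨-, p, -⟩ := 𝒢.exists_parent_edges hT r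
  have h1 : Fintype.card {v : V // v ≠ r} = Fintype.card V - 1 := by
    rw [Fintype.card_subtype_compl, Fintype.card_subtype_eq]
  have h2 : 0 < Fintype.card V := Fintype.card_pos_iff.2 ⟨r⟩
  rw [← Nat.card_congr p, Nat.card_eq_fintype_card, Nat.card_eq_fintype_card, h1]
  omega

theorem exists_fix_of_depth {V P : Type*} (d : V → ℕ) (F : ∀ v, (∀ w, d w < d v → P) → P) :
    ∃ h : V → P, ∀ v, h v = F v fun w _ => h w :=
  ⟨(measure d).wf.fix F, fun v => (measure d).wf.fix_eq F v⟩

/-- Every labelling of the edges of a spanning tree is a coboundary. -/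
theorem exists_gauge [Finite V] [Finite E] {T : Set E} (hT : 𝒢.IsSpanningTree T) {P : Type*}
    [Group P] (g : E → P) : ∃ h : V → P, ∀ e ∈ T, h (𝒢.src e) * g e * (h (𝒢.tgt e))⁻¹ = 1 := by
  classical
  obtain ⟨r⟩ := hT.nonempty
  obtain ⟨d, p, hp⟩ := 𝒢.exists_parent_edges hT r
  choose w hw hend using hp
  -- The value at `v` solves the equation of the edge assigned to `v`, given the value at its
  -- shallower end; the two formulas correspond to the two orientations of that edge.
  obtain ⟨h, hh⟩ := exists_fix_of_depth (P := P) d fun v h =>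
    if hv : v ≠ r then
      (if 𝒢.src (p ⟨v, hv⟩) = v then h (w ⟨v, hv⟩) (hw ⟨v, hv⟩) * (g (p ⟨v, hv⟩))⁻¹
      else h (w ⟨v, hv⟩) (hw ⟨v, hv⟩) * g (p ⟨v, hv⟩))
    else 1
  refine ⟨h, fun e he => ?_⟩
  obtain ⟨v, hv⟩ := p.surjective ⟨e, he⟩
  have hpe : ((p v : T) : E) = e := congrArg Subtype.val hv
  have h1 := hh v
  rw [dif_pos v.2] at h1
  have h2 := hend v
  simp only [Subtype.coe_eta, hpe] at h1 h2
  by_cases hs : 𝒢.src e = v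
  · rw [if_pos hs] at h1
    have ht : 𝒢.tgt e = w v := by
      rcases h2 with h2 | h2
      · exact h2.2
      · exact absurd (hs.trans h2.1.symm) (hT.1 e he)
    rw [hs, ht, h1]
    group
  · rw [if_neg hs] at h1
    rcases h2 with h2 | h2
    · exact absurd h2.1 hs
    · rw [h2.1, h2.2, h1]
      group

/-- Families of homomorphisms of the vertex groups to `P`, with an intertwiner for every edge. -/
def EdgeRep (P : Type*) [Group P] : Type _ :=
  {x : (∀ v, 𝒢.vGroup v →* P) × (E → P) // ∀ e a,
    x.2 e * x.1 (𝒢.tgt e) (𝒢.tgtMap e a) * (x.2 e)⁻¹ = x.1 (𝒢.src e) (𝒢.srcMap e a)}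

variable {𝒢}

/-- The change of base by elements `h v`. -/
def EdgeRep.gauge {P : Type*} [Group P] (h : V → P) (x : 𝒢.EdgeRep P) : 𝒢.EdgeRep P :=
  ⟨(fun v => (MulAut.conj (h v)).toMonoidHom.comp (x.1.1 v),
    fun e => h (𝒢.src e) * x.1.2 e * (h (𝒢.tgt e))⁻¹), fun e a => by
      simp [← x.2 e a, mul_assoc]⟩

theorem EdgeRep.gauge_gauge {P : Type*} [Group P] (h k : V → P) (x : 𝒢.EdgeRep P) :
    (x.gauge k).gauge h = x.gauge (h * k) := by
  refine Subtype.ext (Prod.ext (funext fun v => MonoidHom.ext fun a => ?_) (funext fun e => ?_))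
  · simp [EdgeRep.gauge]
  · simp [EdgeRep.gauge, mul_assoc]

theorem EdgeRep.gauge_one {P : Type*} [Group P] (x : 𝒢.EdgeRep P) : x.gauge 1 = x := by
  refine Subtype.ext (Prod.ext (funext fun v => MonoidHom.ext fun a => ?_) (funext fun e => ?_))
  · simp [EdgeRep.gauge]
  · simp [EdgeRep.gauge]

/-- Change of base as a permutation. -/
def EdgeRep.gaugeEquiv {P : Type*} [Group P] (h : V → P) : 𝒢.EdgeRep P ≃ 𝒢.EdgeRep P :=
  ⟨EdgeRep.gauge h, EdgeRep.gauge h⁻¹, fun x => by rw [gauge_gauge, inv_mul_cancel, gauge_one],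
    fun x => by rw [gauge_gauge, mul_inv_cancel, gauge_one]⟩

variable (𝒢)

instance (P : Type*) [Group P] [Finite P] [Finite V] [Finite E] : Finite (𝒢.EdgeRep P) :=
  inferInstanceAs (Finite (Subtype _))

/-- The homomorphism of the free product with given values on the generators. -/
def freeProdLift {P : Type*} [Group P] (φ : ∀ v, 𝒢.vGroup v →* P) (g : E → P) : 𝒢.FreeProd →* P :=
  Monoid.Coprod.lift (Monoid.CoprodI.lift φ) (FreeGroup.lift g)

@[simp] theorem freeProdLift_vertexIncl {P : Type*} [Group P] (φ : ∀ v, 𝒢.vGroup v →* P)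
    (g : E → P) (v : V) (a : 𝒢.vGroup v) : 𝒢.freeProdLift φ g (𝒢.vertexIncl v a) = φ v a := by
  simp [freeProdLift, vertexIncl]

@[simp] theorem freeProdLift_edgeElt {P : Type*} [Group P] (φ : ∀ v, 𝒢.vGroup v →* P)
    (g : E → P) (e : E) : 𝒢.freeProdLift φ g (𝒢.edgeElt e) = g e := by
  simp [freeProdLift, edgeElt]

theorem freeProdLift_eq {P : Type*} [Group P] (F : 𝒢.FreeProd →* P) :
    𝒢.freeProdLift (fun v => F.comp (𝒢.vertexIncl v)) (fun e => F (𝒢.edgeElt e)) = F := by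
  apply Monoid.Coprod.hom_ext
  · apply Monoid.CoprodI.ext_hom
    intro v
    ext a
    simp [freeProdLift, vertexIncl]
  · apply FreeGroup.ext_hom
    intro e
    simp [freeProdLift, edgeElt]

theorem normalClosure_relators_le (T : Set E) {P : Type*} [Group P] (F : 𝒢.FreeProd →* P)
    (h1 : ∀ e ∈ T, F (𝒢.edgeElt e) = 1)
    (h2 : ∀ e a, F (𝒢.edgeElt e) * F (𝒢.vertexIncl _ (𝒢.tgtMap e a)) * (F (𝒢.edgeElt e))⁻¹ =
      F (𝒢.vertexIncl _ (𝒢.srcMap e a))) :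
    Subgroup.normalClosure (𝒢.relators T) ≤ F.ker := by
  refine Subgroup.normalClosure_le_normal ?_
  rintro _ (⟨e, he, rfl⟩ | ⟨e, a, rfl⟩)
  · rw [SetLike.mem_coe, MonoidHom.mem_ker]
    exact h1 e he
  · rw [SetLike.mem_coe, MonoidHom.mem_ker, map_mul, map_mul, map_mul, map_inv, map_inv,
      mul_inv_eq_one]
    exact h2 e a

theorem mk_edgeElt_of_mem {T : Set E} {e : E} (he : e ∈ T) :
    (QuotientGroup.mk (𝒢.edgeElt e) : 𝒢.FundamentalGroup T) = 1 :=
  (QuotientGroup.eq_one_iff _).2 (Subgroup.subset_normalClosure (Or.inl ⟨e, he, rfl⟩))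

theorem mk_conj_vertexIncl (T : Set E) (e : E) (a : 𝒢.eGroup e) :
    (QuotientGroup.mk (𝒢.edgeElt e) : 𝒢.FundamentalGroup T) *
      QuotientGroup.mk (𝒢.vertexIncl _ (𝒢.tgtMap e a)) * (QuotientGroup.mk (𝒢.edgeElt e))⁻¹ =
      QuotientGroup.mk (𝒢.vertexIncl _ (𝒢.srcMap e a)) := by
  have h : (QuotientGroup.mk (𝒢.edgeElt e * 𝒢.vertexIncl _ (𝒢.tgtMap e a) * (𝒢.edgeElt e)⁻¹ *
      (𝒢.vertexIncl _ (𝒢.srcMap e a))⁻¹) : 𝒢.FundamentalGroup T) = 1 :=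
    (QuotientGroup.eq_one_iff _).2 (Subgroup.subset_normalClosure (Or.inr ⟨e, a, rfl⟩))
  rwa [QuotientGroup.mk_mul, QuotientGroup.mk_mul, QuotientGroup.mk_mul, QuotientGroup.mk_inv,
    QuotientGroup.mk_inv, mul_inv_eq_one] at h

/-- Homomorphisms of the fundamental group are the edge representations that are trivial on the
edges of the tree. -/
def fundamentalGroupHomEquiv (T : Set E) (P : Type*) [Group P] :
    (𝒢.FundamentalGroup T →* P) ≃ {x : 𝒢.EdgeRep P // ∀ e ∈ T, x.1.2 e = 1} where
  toFun f := ⟨⟨(fun v => (f.comp (QuotientGroup.mk' _)).comp (𝒢.vertexIncl v),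
      fun e => f (QuotientGroup.mk (𝒢.edgeElt e))), fun e a => by
        have h := congrArg f (𝒢.mk_conj_vertexIncl T e a)
        rwa [map_mul, map_mul, map_inv] at h⟩,
      fun e he => (congrArg f (𝒢.mk_edgeElt_of_mem he)).trans (map_one f)⟩
  invFun x := QuotientGroup.lift _ (𝒢.freeProdLift x.1.1.1 x.1.1.2)
    (𝒢.normalClosure_relators_le T _ (fun e he => by simpa using x.2 e he)
      (fun e a => by simpa using x.1.2 e a))
  left_inv f := by
    apply QuotientGroup.monoidHom_ext
    exact 𝒢.freeProdLift_eq (f.comp (QuotientGroup.mk' _))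
  right_inv x := by
    refine Subtype.ext (Subtype.ext (Prod.ext (funext fun v => MonoidHom.ext fun a => ?_)
      (funext fun e => ?_)))
    · exact 𝒢.freeProdLift_vertexIncl x.1.1.1 x.1.1.2 v a
    · exact 𝒢.freeProdLift_edgeElt x.1.1.1 x.1.1.2 e

/-- Edge representations fibre over the labellings of T. A gauge transformation that trivializes a
labelling identifies its fibre with the one over the trivial labelling, which is the set of
homomorphisms of the fundamental group. -/
theorem card_edgeRep_eq [Finite V] [Finite E] {T : Set E} (hT : 𝒢.IsSpanningTree T) (P : Type*)
    [Group P] [Finite P] :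
    Nat.card (𝒢.EdgeRep P) =
      Nat.card (𝒢.FundamentalGroup T →* P) * Nat.card P ^ (Nat.card T) := by
  classical
  have := Fintype.ofFinite (T → P)
  let res : 𝒢.EdgeRep P → (T → P) := fun x e => x.1.2 e
  have hfib : ∀ t : T → P, Nat.card {x : 𝒢.EdgeRep P // res x = t} =
      Nat.card (𝒢.FundamentalGroup T →* P) := by
    intro t
    obtain ⟨h, hh⟩ := 𝒢.exists_gauge hT fun e => if he : e ∈ T then t ⟨e, he⟩ else 1
    rw [Nat.card_congr (𝒢.fundamentalGroupHomEquiv T P)]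
    refine Nat.card_congr (Equiv.subtypeEquiv (EdgeRep.gaugeEquiv h) fun x => ?_)
    rw [funext_iff, Subtype.forall]
    refine forall_congr' fun e => forall_congr' fun he => ?_
    have h1 := hh e he
    rw [dif_pos he] at h1
    change x.1.2 e = t ⟨e, he⟩ ↔ h (𝒢.src e) * x.1.2 e * (h (𝒢.tgt e))⁻¹ = 1
    rw [← h1]
    simp
  rw [Nat.card_congr (Equiv.sigmaFiberEquiv res).symm, Nat.card_sigma]
  simp only [hfib, Finset.sum_const, Finset.card_univ, smul_eq_mul]
  rw [mul_comm, ← Nat.card_eq_fintype_card, Nat.card_fun]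

/-- Once the actions of the vertex groups are fixed, the intertwiners at different edges are chosen
independently. -/
theorem card_edgeRep_eq_sum [Finite V] [Fintype E] {X : Type*} [Finite X]
    [Fintype (∀ v, 𝒢.vGroup v →* Equiv.Perm X)] :
    Nat.card (𝒢.EdgeRep (Equiv.Perm X)) = ∑ φ : ∀ v, 𝒢.vGroup v →* Equiv.Perm X,
      ∏ e, Nat.card (EquivariantEquiv (𝒢.eGroup e)
        (ActionSet ((φ (𝒢.tgt e)).comp (𝒢.tgtMap e)))
        (ActionSet ((φ (𝒢.src e)).comp (𝒢.srcMap e)))) := by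
  simp only [← Nat.card_pi]
  rw [← Nat.card_sigma]
  refine Nat.card_congr (Equiv.trans ?_ (Equiv.sigmaCongrRight fun φ =>
    Equiv.piCongrRight fun e => equivariantEquivConj.symm))
  exact ⟨fun x => ⟨x.1.1, fun e => ⟨x.1.2 e, fun a => x.2 e a⟩⟩,
    fun x => ⟨(x.1, fun e => (x.2 e).1), fun e a => (x.2 e).2 a⟩, fun _ => rfl, fun _ => rfl⟩

end GraphOfGroups

end

noncomputable section

/-! ### The linear program and permutation representations -/

namespace TransRep

variable {A X : Type*} [Group A] [MulAction A X]

theorem degree_mk_bot : (mk (⊥ : Subgroup A)).degree = Nat.card A := by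
  obtain ⟨φ, -⟩ := mk_eq_mk.1 (mk_stab (mk (⊥ : Subgroup A)))
  rw [degree, Nat.card_congr φ]
  exact Nat.card_congr QuotientGroup.quotientBot.toEquiv

theorem multiplicity_of_free (hfree : ∀ x : X, MulAction.stabilizer A x = ⊥) {ρ : TransRep A}
    (hρ : ρ ≠ mk ⊥) : ρ.multiplicity X = 0 := by
  rw [multiplicity_eq, Nat.card_eq_zero]
  left
  refine ⟨fun ⟨ω, hω⟩ => hρ ?_⟩
  obtain ⟨x, rfl⟩ := Quotient.mk_surjective ω
  rw [← hω, ← hfree x]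
  rfl

variable [Finite A] [Finite X]

theorem multiplicity_mk_bot_of_free (hfree : ∀ x : X, MulAction.stabilizer A x = ⊥) :
    (mk (⊥ : Subgroup A)).multiplicity X * Nat.card A = Nat.card X := by
  classical
  rw [← sum_multiplicity_mul_degree (G := A) X, Finset.sum_eq_single (mk ⊥), degree_mk_bot]
  · intro ρ _ hρ
    rw [multiplicity_of_free hfree hρ, zero_mul]
  · simp

theorem orbitCount_of_free (hfree : ∀ x : X, MulAction.stabilizer A x = ⊥) :
    orbitCount A X * Nat.card A = Nat.card X := by
  classical
  rw [← multiplicity_mk_bot_of_free hfree, ← sum_multiplicity (G := A) X,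
    Finset.sum_eq_single (mk ⊥)]
  · exact fun ρ _ hρ => multiplicity_of_free hfree hρ
  · simp

theorem orbitCount_div_of_free (hfree : ∀ x : X, MulAction.stabilizer A x = ⊥) {N : ℕ}
    (hX : Nat.card X = N) (hN : N ≠ 0) : (orbitCount A X : ℝ) / N = 1 / Nat.card A := by
  have h1 : (orbitCount A X : ℝ) * Nat.card A = N := by
    rw [← hX]; exact_mod_cast orbitCount_of_free hfree
  have h2 : (Nat.card A : ℝ) ≠ 0 := by exact_mod_cast Nat.card_pos.ne'
  rw [div_eq_div_iff (by exact_mod_cast hN) h2, h1, one_mul]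

/-- A finite free action is a multiple of the regular one, so its size determines it. -/
theorem permRepEquiv_of_free {Y : Type*} [MulAction A Y] [Finite Y]
    (hX : ∀ x : X, MulAction.stabilizer A x = ⊥) (hY : ∀ y : Y, MulAction.stabilizer A y = ⊥)
    (hcard : Nat.card X = Nat.card Y) : PermRepEquiv A X Y := by
  refine permRepEquiv_of_multiplicity_eq fun ρ => ?_
  by_cases hρ : ρ = mk ⊥
  · subst hρ
    have h1 := multiplicity_mk_bot_of_free hX
    rw [hcard, ← multiplicity_mk_bot_of_free hY] at h1
    exact Nat.eq_of_mul_eq_mul_right Nat.card_pos h1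
  · rw [multiplicity_of_free hX hρ, multiplicity_of_free hY hρ]

end TransRep

namespace GraphOfGroups

variable {V E : Type*} (𝒢 : GraphOfGroups V E)

theorem sum_srcCoeff_mul [Fintype V] (e : E) (ρ : TransRep (𝒢.eGroup e)) (x : 𝒢.Var → ℝ) :
    ∑ i, (𝒢.srcCoeff e ρ i : ℝ) * x i =
      ∑ θ, (TransRep.restrictMult (𝒢.srcMap e) ρ θ : ℝ) * x ⟨𝒢.src e, θ⟩ := by
  classical
  simp only [srcCoeff, Rat.cast_sum, Finset.sum_mul]
  rw [Finset.sum_comm]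
  refine Finset.sum_congr rfl fun θ _ => ?_
  rw [Finset.sum_eq_single ⟨𝒢.src e, θ⟩]
  · simp
  · intro i _ hi
    rw [if_neg hi.symm]; simp
  · simp

theorem sum_tgtCoeff_mul [Fintype V] (e : E) (ρ : TransRep (𝒢.eGroup e)) (x : 𝒢.Var → ℝ) :
    ∑ i, (𝒢.tgtCoeff e ρ i : ℝ) * x i =
      ∑ θ, (TransRep.restrictMult (𝒢.tgtMap e) ρ θ : ℝ) * x ⟨𝒢.tgt e, θ⟩ := by
  classical
  simp only [tgtCoeff, Rat.cast_sum, Finset.sum_mul]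
  rw [Finset.sum_comm]
  refine Finset.sum_congr rfl fun θ _ => ?_
  rw [Finset.sum_eq_single ⟨𝒢.tgt e, θ⟩]
  · simp
  · intro i _ hi
    rw [if_neg hi.symm]; simp
  · simp

variable [Fintype V] [Fintype E]

theorem isFeasible_iff (x : 𝒢.Var → ℝ) : 𝒢.linearProgram.IsFeasible x ↔
    (∀ i, 0 ≤ x i) ∧ (∀ v, ∑ θ : TransRep (𝒢.vGroup v), (θ.degree : ℝ) * x ⟨v, θ⟩ = 1) ∧
    ∀ e (ρ : TransRep (𝒢.eGroup e)),
      ∑ θ, (TransRep.restrictMult (𝒢.srcMap e) ρ θ : ℝ) * x ⟨𝒢.src e, θ⟩ =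
      ∑ θ, (TransRep.restrictMult (𝒢.tgtMap e) ρ θ : ℝ) * x ⟨𝒢.tgt e, θ⟩ := by
  classical
  refine and_congr Iff.rfl ?_
  rw [Sum.forall]
  refine and_congr (forall_congr' fun v => ?_) ?_
  · simp only [linearProgram, Rat.cast_one]
    rw [Fintype.sum_sigma, Finset.sum_eq_single v]
    · simp
    · intro w _ hw
      simp [hw]
    · simp
  · rw [Sigma.forall]
    refine forall_congr' fun e => forall_congr' fun ρ => ?_
    simp only [linearProgram, Rat.cast_sub, sub_mul, Finset.sum_sub_distrib, Rat.cast_zero]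
    rw [sum_srcCoeff_mul, sum_tgtCoeff_mul, sub_eq_zero]

theorem objective_eq (x : 𝒢.Var → ℝ) : ∑ i, (𝒢.linearProgram.objective i : ℝ) * x i =
    -∑ i, x i + ∑ e, ∑ ρ : TransRep (𝒢.eGroup e),
      ∑ θ, (TransRep.restrictMult (𝒢.srcMap e) ρ θ : ℝ) * x ⟨𝒢.src e, θ⟩ := by
  simp only [linearProgram, Rat.cast_add, Rat.cast_neg, Rat.cast_one, Rat.cast_sum, add_mul,
    Finset.sum_add_distrib, ← sum_srcCoeff_mul, Finset.sum_mul]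
  congr 1
  · simp
  · rw [Finset.sum_comm]
    exact Finset.sum_congr rfl fun e _ => Finset.sum_comm

theorem feasible_le_one {x : 𝒢.Var → ℝ} (hx : 𝒢.linearProgram.IsFeasible x) (i : 𝒢.Var) :
    x i ≤ 1 := by
  rw [isFeasible_iff] at hx
  obtain ⟨h0, h1, -⟩ := hx
  obtain ⟨v, θ⟩ := i
  have h2 : (θ.degree : ℝ) * x ⟨v, θ⟩ ≤ 1 := by
    rw [← h1 v]
    exact Finset.single_le_sum (f := fun θ : TransRep (𝒢.vGroup v) => (θ.degree : ℝ) * x ⟨v, θ⟩)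
      (fun θ _ => mul_nonneg (by positivity) (h0 _)) (Finset.mem_univ θ)
  have h3 : (1 : ℝ) ≤ θ.degree := by exact_mod_cast TransRep.degree_pos θ
  have := h0 ⟨v, θ⟩
  nlinarith

/-! ### Feasible points and compatible families of actions -/

section Actions

variable {X : Type*}

/-- The action of an edge group through the vertex group at the source. -/
abbrev SrcSet (φ : ∀ v, 𝒢.vGroup v →* Equiv.Perm X) (e : E) : Type _ :=
  ActionSet ((φ (𝒢.src e)).comp (𝒢.srcMap e))

/-- The action of an edge group through the vertex group at the target. -/
abbrev TgtSet (φ : ∀ v, 𝒢.vGroup v →* Equiv.Perm X) (e : E) : Type _ :=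
  ActionSet ((φ (𝒢.tgt e)).comp (𝒢.tgtMap e))

/-- The total number of orbits of the vertex groups. -/
def vertexOrbits (φ : ∀ v, 𝒢.vGroup v →* Equiv.Perm X) : ℕ :=
  ∑ v, orbitCount (𝒢.vGroup v) (ActionSet (φ v))

/-- The total number of orbits of the edge groups. -/
def edgeOrbits (φ : ∀ v, 𝒢.vGroup v →* Equiv.Perm X) : ℕ :=
  ∑ e, orbitCount (𝒢.eGroup e) (𝒢.SrcSet φ e)

/-- The actions of every edge group through both ends are equivalent. -/
def Compatible (φ : ∀ v, 𝒢.vGroup v →* Equiv.Perm X) : Prop :=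
  ∀ e, PermRepEquiv (𝒢.eGroup e) (𝒢.TgtSet φ e) (𝒢.SrcSet φ e)

theorem multiplicity_comp {A G : Type*} [Group A] [Group G] [Finite G] [Finite X]
    (φ : G →* Equiv.Perm X) (ψ : A →* G) (ρ : TransRep A) :
    ρ.multiplicity (ActionSet (φ.comp ψ)) =
      ∑ θ, TransRep.restrictMult ψ ρ θ * θ.multiplicity (ActionSet φ) := by
  rw [← TransRep.multiplicity_pullback]
  exact TransRep.multiplicity_congr ρ ⟨Equiv.refl _, fun _ _ => rfl⟩

/-- The point consists of the multiplicities divided by |X|. The degree constraints count the points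
of X, the edge constraints hold because equivalent actions have equal multiplicities, and sums of
multiplicities are orbit counts. -/
theorem exists_feasible_of_compatible [Finite X] [Nonempty X]
    {φ : ∀ v, 𝒢.vGroup v →* Equiv.Perm X} (hφ : 𝒢.Compatible φ) :
    ∃ x, 𝒢.linearProgram.IsFeasible x ∧ ∑ i, (𝒢.linearProgram.objective i : ℝ) * x i =
      ((𝒢.edgeOrbits φ : ℝ) - 𝒢.vertexOrbits φ) / Nat.card X := by
  have hN : (0 : ℝ) < Nat.card X := by exact_mod_cast Nat.card_pos
  let x : 𝒢.Var → ℝ := fun i => (i.2.multiplicity (ActionSet (φ i.1)) : ℝ) / Nat.card X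
  have hres : ∀ {A : Type _} [Group A] (v : V) (ψ : A →* 𝒢.vGroup v) (ρ : TransRep A),
      ∑ θ, (TransRep.restrictMult ψ ρ θ : ℝ) * x ⟨v, θ⟩ =
        (ρ.multiplicity (ActionSet ((φ v).comp ψ)) : ℝ) / Nat.card X := by
    intro A _ v ψ ρ
    rw [multiplicity_comp]
    push_cast
    rw [Finset.sum_div]
    exact Finset.sum_congr rfl fun θ _ => by simp only [x]; ring
  refine ⟨x, (𝒢.isFeasible_iff x).2 ⟨fun i => by positivity, fun v => ?_, fun e ρ => ?_⟩, ?_⟩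
  · have h1 := TransRep.sum_multiplicity_mul_degree (G := 𝒢.vGroup v) (ActionSet (φ v))
    have h2 : (Nat.card X : ℝ) =
        ∑ θ : TransRep (𝒢.vGroup v), (θ.multiplicity (ActionSet (φ v)) : ℝ) * θ.degree := by
      exact_mod_cast h1.symm
    calc ∑ θ : TransRep (𝒢.vGroup v), (θ.degree : ℝ) * x ⟨v, θ⟩
        = (∑ θ : TransRep (𝒢.vGroup v), (θ.multiplicity (ActionSet (φ v)) : ℝ) * θ.degree) /
            Nat.card X := by
          rw [Finset.sum_div]
          exact Finset.sum_congr rfl fun θ _ => by simp only [x]; ring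
      _ = 1 := by rw [← h2, div_self hN.ne']
  · rw [hres, hres, TransRep.multiplicity_congr ρ (hφ e)]
  · rw [objective_eq]
    simp only [hres]
    rw [sub_div, neg_add_eq_sub]
    congr 1
    · rw [edgeOrbits, Nat.cast_sum, Finset.sum_div]
      refine Finset.sum_congr rfl fun e _ => ?_
      rw [← Finset.sum_div, ← TransRep.sum_multiplicity, Nat.cast_sum]
    · rw [vertexOrbits, Nat.cast_sum, Finset.sum_div, Fintype.sum_sigma]
      refine Finset.sum_congr rfl fun v _ => ?_
      rw [← Finset.sum_div, ← TransRep.sum_multiplicity, Nat.cast_sum]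

/-- D clears the denominators, so the numbers n·x_i are natural and can be prescribed as
multiplicities. The degree constraints give each model n points, and the edge constraints make the
restrictions equivalent. -/
theorem exists_compatible_of_feasible {x : 𝒢.Var → ℚ}
    (hx : 𝒢.linearProgram.IsFeasible fun i => (x i : ℝ)) :
    ∃ D : ℕ, 0 < D ∧ ∀ n : ℕ, D ∣ n → ∃ φ : ∀ v, 𝒢.vGroup v →* Equiv.Perm (Fin n),
      𝒢.Compatible φ ∧ (𝒢.edgeOrbits φ : ℝ) - 𝒢.vertexOrbits φ =
        ((∑ i, 𝒢.linearProgram.objective i * x i : ℚ) : ℝ) * n := by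
  refine ⟨∏ i, (x i).den, Finset.prod_pos fun i _ => (x i).den_pos, fun n hn => ?_⟩
  have hobj := 𝒢.objective_eq (fun i => (x i : ℝ))
  rw [isFeasible_iff] at hx
  obtain ⟨h0, h1, h2⟩ := hx
  have hk : ∀ i, ∃ k : ℕ, (k : ℝ) = n * (x i : ℝ) := by
    intro i
    obtain ⟨c, hc⟩ := (Finset.dvd_prod_of_mem (fun i => (x i).den) (Finset.mem_univ i)).trans hn
    have hx0 : 0 ≤ x i := by exact_mod_cast h0 i
    obtain ⟨a, ha⟩ := Int.eq_ofNat_of_zero_le (Rat.num_nonneg.2 hx0)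
    refine ⟨c * a, ?_⟩
    have h3 : (n : ℚ) * x i = c * a := by
      have h4 : x i * (x i).den = (x i).num := Rat.mul_den_eq_num _
      rw [ha] at h4
      rw [hc]
      push_cast
      rw [mul_right_comm, mul_comm _ (x i), h4]
      push_cast
      ring
    exact_mod_cast h3.symm
  choose k hk using hk
  have hcard : ∀ v, Nat.card (TransRep.Model fun θ : TransRep (𝒢.vGroup v) => k ⟨v, θ⟩) = n := by
    intro v
    rw [TransRep.card_model]
    have h3 : ((∑ θ : TransRep (𝒢.vGroup v), k ⟨v, θ⟩ * θ.degree : ℕ) : ℝ) = n := by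
      push_cast
      rw [← mul_one (n : ℝ), ← h1 v, Finset.mul_sum]
      exact Finset.sum_congr rfl fun θ _ => by rw [hk]; ring
    exact_mod_cast h3
  have hmodel := fun v => exists_hom_permRepEquiv (G := 𝒢.vGroup v)
    ((Finite.equivFin (TransRep.Model fun θ : TransRep (𝒢.vGroup v) => k ⟨v, θ⟩)).trans
      (finCongr (hcard v)))
  choose φ hφ using hmodel
  have hmult : ∀ v (θ : TransRep (𝒢.vGroup v)), θ.multiplicity (ActionSet (φ v)) = k ⟨v, θ⟩ :=
    fun v θ => by rw [TransRep.multiplicity_congr θ (hφ v), TransRep.multiplicity_model]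
  have hres : ∀ {A : Type _} [Group A] (v : V) (ψ : A →* 𝒢.vGroup v) (ρ : TransRep A),
      (ρ.multiplicity (ActionSet ((φ v).comp ψ)) : ℝ) =
        n * ∑ θ, (TransRep.restrictMult ψ ρ θ : ℝ) * x ⟨v, θ⟩ := by
    intro A _ v ψ ρ
    rw [multiplicity_comp, Finset.mul_sum]
    push_cast
    exact Finset.sum_congr rfl fun θ _ => by rw [hmult, hk]; ring
  refine ⟨φ, fun e => TransRep.permRepEquiv_of_multiplicity_eq fun ρ => ?_, ?_⟩
  · have h3 : (ρ.multiplicity (𝒢.TgtSet φ e) : ℝ) = ρ.multiplicity (𝒢.SrcSet φ e) := by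
      rw [hres, hres, h2]
    exact_mod_cast h3
  · push_cast
    rw [hobj, edgeOrbits, vertexOrbits, Nat.cast_sum, Nat.cast_sum, add_mul, neg_mul,
      neg_add_eq_sub]
    congr 1
    · rw [Finset.sum_mul]
      refine Finset.sum_congr rfl fun e _ => ?_
      rw [← TransRep.sum_multiplicity, Nat.cast_sum, Finset.sum_mul]
      exact Finset.sum_congr rfl fun ρ _ => by rw [hres, mul_comm]
    · rw [Fintype.sum_sigma, Finset.sum_mul]
      refine Finset.sum_congr rfl fun v _ => ?_
      rw [← TransRep.sum_multiplicity, Nat.cast_sum, Finset.sum_mul]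
      exact Finset.sum_congr rfl fun θ _ => by rw [hmult, hk, mul_comm]

end Actions

theorem stabilizer_leftRegular {A P : Type*} [Group A] [Group P] {ψ : A →* P}
    (hψ : Function.Injective ψ) (y : ActionSet ((MulAction.toPermHom P P).comp ψ)) :
    MulAction.stabilizer A y = ⊥ := by
  rw [eq_bot_iff]
  intro a ha
  have h1 : ψ a * (show P from y) = y := MulAction.mem_stabilizer_iff.1 ha
  rw [Subgroup.mem_bot]
  exact (injective_iff_map_eq_one ψ).1 hψ a (mul_eq_right.1 h1)

/-- The free actions give a feasible point whose value is minus the Euler characteristic. -/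
theorem exists_feasible_free : ∃ x, 𝒢.linearProgram.IsFeasible x ∧
    ∑ i, (𝒢.linearProgram.objective i : ℝ) * x i =
      ∑ e, (1 : ℝ) / Nat.card (𝒢.eGroup e) - ∑ v, (1 : ℝ) / Nat.card (𝒢.vGroup v) := by
  classical
  -- Each vertex group embeds into the product of all of them, so left translation makes every
  -- vertex group act freely on one common finite set. Edge groups act freely too because their maps
  -- are injective.
  let P := ∀ v, 𝒢.vGroup v
  let φ : ∀ v, 𝒢.vGroup v →* Equiv.Perm P := fun v =>
    (MulAction.toPermHom P P).comp (MonoidHom.mulSingle 𝒢.vGroup v)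
  have hφinj : ∀ v, Function.Injective (MonoidHom.mulSingle 𝒢.vGroup v) := fun v =>
    Pi.mulSingle_injective v
  have hsrc : ∀ e (y : 𝒢.SrcSet φ e), MulAction.stabilizer (𝒢.eGroup e) y = ⊥ := fun e =>
    stabilizer_leftRegular (ψ := (MonoidHom.mulSingle 𝒢.vGroup (𝒢.src e)).comp (𝒢.srcMap e))
      ((hφinj _).comp (𝒢.srcMap_injective e))
  have htgt : ∀ e (y : 𝒢.TgtSet φ e), MulAction.stabilizer (𝒢.eGroup e) y = ⊥ := fun e =>
    stabilizer_leftRegular (ψ := (MonoidHom.mulSingle 𝒢.vGroup (𝒢.tgt e)).comp (𝒢.tgtMap e))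
      ((hφinj _).comp (𝒢.tgtMap_injective e))
  have hcompat : 𝒢.Compatible φ := fun e =>
    TransRep.permRepEquiv_of_free (htgt e) (hsrc e) rfl
  obtain ⟨x, hx, hval⟩ := 𝒢.exists_feasible_of_compatible hcompat
  refine ⟨x, hx, ?_⟩
  rw [hval, edgeOrbits, vertexOrbits, sub_div, Nat.cast_sum, Nat.cast_sum, Finset.sum_div,
    Finset.sum_div]
  congr 1
  · exact Finset.sum_congr rfl fun e _ =>
      TransRep.orbitCount_div_of_free (hsrc e) rfl Nat.card_pos.ne'
  · exact Finset.sum_congr rfl fun v _ =>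
      TransRep.orbitCount_div_of_free (stabilizer_leftRegular (hφinj v)) rfl Nat.card_pos.ne'

end GraphOfGroups

end

noncomputable section

/-! ### The growth of the number of permutation representations -/

namespace GraphOfGroups

variable {V E : Type*} (𝒢 : GraphOfGroups V E)

theorem card_eGroup_le_src (e : E) : Nat.card (𝒢.eGroup e) ≤ Nat.card (𝒢.vGroup (𝒢.src e)) :=
  Nat.card_le_card_of_injective _ (𝒢.srcMap_injective e)

/-- A proper subgroup has at most half the order. -/
theorem two_mul_card_le {A G : Type*} [Group A] [Group G] [Finite G] {ψ : A →* G}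
    (hψ : Function.Injective ψ) (hns : ¬ Function.Surjective ψ) :
    2 * Nat.card A ≤ Nat.card G := by
  have h1 : Nat.card A = Nat.card ψ.range := Nat.card_congr (MonoidHom.ofInjective hψ).toEquiv
  have h2 := Subgroup.card_mul_index ψ.range
  have h3 : ψ.range.index ≠ 1 := fun h => hns (MonoidHom.range_eq_top.1 (Subgroup.index_eq_one.1 h))
  have h4 : ψ.range.index ≠ 0 := Subgroup.index_ne_zero_of_finite
  rw [h1, ← h2, mul_comm]
  exact Nat.mul_le_mul_left _ (by omega)

theorem closure_eq_top {K : Subgroup 𝒢.FreeProd} (hv : ∀ v a, 𝒢.vertexIncl v a ∈ K)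
    (he : ∀ e, 𝒢.edgeElt e ∈ K) : K = ⊤ := by
  rw [eq_top_iff]
  intro x _
  have h := 𝒢.freeProdLift_eq (MonoidHom.id _)
  have h2 : K.subtype.comp (𝒢.freeProdLift (fun v => (𝒢.vertexIncl v).codRestrict K (hv v))
      (fun e => ⟨𝒢.edgeElt e, he e⟩)) = MonoidHom.id _ := by
    rw [← 𝒢.freeProdLift_eq (K.subtype.comp _), ← h]
    congr 1
  have h3 := DFunLike.congr_fun h2 x
  rw [MonoidHom.id_apply] at h3
  rw [← h3]
  exact SetLike.coe_mem _

/-- If the fundamental group is infinite, then its Euler characteristic is not positive. -/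
theorem euler_char_nonpos [Fintype V] [Fintype E] {T : Set E} (hT : 𝒢.IsSpanningTree T)
    [Infinite (𝒢.FundamentalGroup T)] :
    ∑ v, (1 : ℝ) / Nat.card (𝒢.vGroup v) ≤ ∑ e, (1 : ℝ) / Nat.card (𝒢.eGroup e) := by
  classical
  by_contra hlt
  push Not at hlt
  have hVne := hT.nonempty
  -- With a largest group at the root, 1/|G_r| is the least of the terms. Every other vertex is paid
  -- for by the edge assigned to it. An edge outside T, or an assigned edge whose group is proper in
  -- G_v, leaves a surplus of at least 1/|G_r|, so neither can occur when χ is positive.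
  obtain ⟨r, -, hr⟩ := Finset.exists_max_image Finset.univ (fun v => Nat.card (𝒢.vGroup v))
    Finset.univ_nonempty
  obtain ⟨d, p, hp⟩ := 𝒢.exists_parent_edges hT r
  choose w hw hend using hp
  set cV : V → ℝ := fun v => (1 : ℝ) / Nat.card (𝒢.vGroup v) with hcV
  set cE : E → ℝ := fun e => (1 : ℝ) / Nat.card (𝒢.eGroup e) with hcE
  have hposV : ∀ v, (0 : ℝ) < Nat.card (𝒢.vGroup v) := fun v => by exact_mod_cast Nat.card_pos
  have hposE : ∀ e, (0 : ℝ) < Nat.card (𝒢.eGroup e) := fun e => by exact_mod_cast Nat.card_pos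
  have hcr : ∀ v, cV r ≤ cV v := fun v =>
    one_div_le_one_div_of_le (hposV v) (by exact_mod_cast hr v (Finset.mem_univ v))
  have hcE0 : ∀ e, 0 ≤ cE e := fun e => by positivity
  have hsum : ∑ v, cV v = cV r + ∑ v : {v : V // v ≠ r}, cV v := by
    rw [← Finset.add_sum_erase _ _ (Finset.mem_univ r)]
    congr 1
    exact (Finset.sum_subtype _ (by simp) _)
  have hpar : ∀ v : {v : V // v ≠ r}, cV v ≤ cE (p v) := by
    intro v
    refine one_div_le_one_div_of_le (hposE _) ?_
    rcases hend v with h | h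
    · rw [← h.1]; exact_mod_cast 𝒢.card_eGroup_le_src _
    · rw [← h.1]; exact_mod_cast Nat.card_le_card_of_injective _ (𝒢.tgtMap_injective _)
  have hsumT : ∑ v : {v : V // v ≠ r}, cE (p v) = ∑ e ∈ Finset.univ.filter (· ∈ T), cE e := by
    rw [p.sum_comp (fun e : T => cE e)]
    exact (Finset.sum_subtype _ (by simp) _).symm
  have hsumE : ∑ v : {v : V // v ≠ r}, cE (p v) ≤ ∑ e, cE e := by
    rw [hsumT]
    exact Finset.sum_le_sum_of_subset_of_nonneg (Finset.subset_univ _) fun e _ _ => hcE0 e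
  -- no edges outside of the tree
  have hall : ∀ e, e ∈ T := by
    intro e₀
    by_contra he₀
    have h1 : cE e₀ + ∑ v : {v : V // v ≠ r}, cE (p v) ≤ ∑ e, cE e := by
      rw [hsumT, ← Finset.sum_insert (by simpa using he₀)]
      exact Finset.sum_le_sum_of_subset_of_nonneg (Finset.subset_univ _) fun e _ _ => hcE0 e
    have h2 : cV r ≤ cE e₀ := (hcr (𝒢.src e₀)).trans
      (one_div_le_one_div_of_le (hposE _) (by exact_mod_cast 𝒢.card_eGroup_le_src _))
    have h3 := Finset.sum_le_sum fun v (_ : v ∈ Finset.univ) => hpar v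
    linarith
  -- the groups of the tree edges are equal to the groups at their outer ends
  have hcard : ∀ v : {v : V // v ≠ r}, ¬ 2 * Nat.card (𝒢.eGroup (p v)) ≤ Nat.card (𝒢.vGroup v) := by
    intro v₀ h
    have h1 : 2 * cV v₀ ≤ cE (p v₀) := by
      simp only [hcV, hcE]
      rw [mul_one_div, div_le_div_iff₀ (hposV _) (hposE _), one_mul]
      exact_mod_cast h
    have h2 : cV r + ∑ v : {v : V // v ≠ r}, cV v ≤ ∑ v : {v : V // v ≠ r}, cE (p v) := by
      rw [← Finset.add_sum_erase _ _ (Finset.mem_univ v₀),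
        ← Finset.add_sum_erase _ (fun v : {v : V // v ≠ r} => cE (p v)) (Finset.mem_univ v₀)]
      have h3 := Finset.sum_le_sum fun v (_ : v ∈ Finset.univ.erase v₀) => hpar v
      have h4 := hcr v₀
      linarith
    linarith
  -- so the fundamental group is the image of the root group
  let π : 𝒢.FreeProd →* 𝒢.FundamentalGroup T := QuotientGroup.mk' _
  let R : Subgroup (𝒢.FundamentalGroup T) := (π.comp (𝒢.vertexIncl r)).range
  have hedge : ∀ e a, π (𝒢.vertexIncl _ (𝒢.tgtMap e a)) = π (𝒢.vertexIncl _ (𝒢.srcMap e a)) := by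
    intro e a
    have h1 := 𝒢.mk_conj_vertexIncl T e a
    rw [𝒢.mk_edgeElt_of_mem (hall e), one_mul, inv_one, mul_one] at h1
    exact h1
  -- Induction on the depth: every element of G_v comes from the assigned edge group, and the edge
  -- relation with g_e = 1 moves it to the shallower end.
  have hR : ∀ n v, d v = n → ∀ a, π (𝒢.vertexIncl v a) ∈ R := by
    intro n
    induction n using Nat.strong_induction_on with
    | _ n ih =>
      intro v hv a
      by_cases hvr : v = r
      · subst hvr; exact ⟨a, rfl⟩
      · have hw' := hw ⟨v, hvr⟩
        have hc := hcard ⟨v, hvr⟩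
        have he := hend ⟨v, hvr⟩
        generalize ((p ⟨v, hvr⟩ : T) : E) = e at hc he
        generalize w ⟨v, hvr⟩ = u at hw' he
        rcases he with ⟨h1, h2⟩ | ⟨h1, h2⟩
        · dsimp only at h1 hc hw'
          subst h1 h2
          obtain ⟨b, rfl⟩ := not_not.1 (fun h => hc (two_mul_card_le (𝒢.srcMap_injective e) h)) a
          rw [← hedge]
          exact ih _ (hv ▸ hw') _ rfl _
        · dsimp only at h1 hc hw'
          subst h1 h2
          obtain ⟨b, rfl⟩ := not_not.1 (fun h => hc (two_mul_card_le (𝒢.tgtMap_injective e) h)) a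
          rw [hedge]
          exact ih _ (hv ▸ hw') _ rfl _
  have htop : R.comap π = ⊤ := 𝒢.closure_eq_top (fun v a => hR _ v rfl a) fun e => by
    rw [Subgroup.mem_comap]
    have : π (𝒢.edgeElt e) = 1 := 𝒢.mk_edgeElt_of_mem (hall e)
    rw [this]
    exact one_mem R
  have hsurj : Function.Surjective (π.comp (𝒢.vertexIncl r)) := by
    intro y
    obtain ⟨x, rfl⟩ := QuotientGroup.mk'_surjective _ y
    have h1 : x ∈ R.comap π := htop ▸ Subgroup.mem_top x
    exact h1
  have := Finite.of_surjective _ hsurj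
  exact not_finite (𝒢.FundamentalGroup T)

/-! ### Bounds for the number of representations, and the growth coefficient -/

section Counting

variable [Fintype V] [Fintype E]

/-- The number of edge representations is at most `n!^|V| n^(qn)` up to an exponential factor. -/
theorem card_edgeRep_le {q : ℝ} (hq : ∀ x, 𝒢.linearProgram.IsFeasible x →
    ∑ i, (𝒢.linearProgram.objective i : ℝ) * x i ≤ q) {n : ℕ} (hn : 1 ≤ n) :
    (Nat.card (𝒢.EdgeRep (Equiv.Perm (Fin n))) : ℝ) ≤ (n : ℝ) ^ (q * n) *
      (Real.exp ((∑ v, 2 * (Fintype.card (TransRep (𝒢.vGroup v)) : ℝ)) * n) *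
        (n.factorial : ℝ) ^ Fintype.card V) := by
  classical
  have : NeZero n := ⟨by omega⟩
  have := fun v => Fintype.ofFinite (𝒢.vGroup v →* Equiv.Perm (Fin n))
  have hn' : (0 : ℝ) < n := by exact_mod_cast hn
  -- An incompatible family contributes 0. For a compatible one, optimality gives edgeOrbits ≤ qn +
  -- vertexOrbits. The bound is a product over the vertices, so the sum over families factors into
  -- sums over single groups.
  have key : ∀ φ : ∀ v, 𝒢.vGroup v →* Equiv.Perm (Fin n),
      ((∏ e, Nat.card (EquivariantEquiv (𝒢.eGroup e) (𝒢.TgtSet φ e) (𝒢.SrcSet φ e)) : ℕ) : ℝ) ≤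
        (n : ℝ) ^ (q * n) * ∏ v, (n : ℝ) ^ orbitCount (𝒢.vGroup v) (ActionSet (φ v)) := by
    intro φ
    by_cases hφ : 𝒢.Compatible φ
    · obtain ⟨x, hx, hval⟩ := 𝒢.exists_feasible_of_compatible hφ
      have h1 := hq x hx
      rw [hval, Nat.card_fin, div_le_iff₀ hn'] at h1
      have h2 : ∏ e, Nat.card (EquivariantEquiv (𝒢.eGroup e) (𝒢.TgtSet φ e) (𝒢.SrcSet φ e)) ≤
          n ^ 𝒢.edgeOrbits φ := by
        rw [edgeOrbits, ← Finset.prod_pow_eq_pow_sum]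
        refine Finset.prod_le_prod' fun e _ => ?_
        have h3 := EquivariantEquiv.card_le_pow (G := 𝒢.eGroup e) (X := 𝒢.TgtSet φ e)
          (Y := 𝒢.SrcSet φ e)
        rw [(hφ e).orbitCount_eq] at h3
        exact h3.trans (le_of_eq (by congr 1; exact Nat.card_fin n))
      rw [Finset.prod_pow_eq_pow_sum]
      calc _ ≤ ((n ^ 𝒢.edgeOrbits φ : ℕ) : ℝ) := by exact_mod_cast h2
        _ = (n : ℝ) ^ (𝒢.edgeOrbits φ : ℝ) := by rw [Real.rpow_natCast]; push_cast; rfl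
        _ ≤ (n : ℝ) ^ (q * n + 𝒢.vertexOrbits φ) :=
          Real.rpow_le_rpow_of_exponent_le (by exact_mod_cast hn) (by linarith)
        _ = _ := by rw [Real.rpow_add hn', Real.rpow_natCast]; rfl
    · obtain ⟨e, he⟩ := not_forall.1 hφ
      rw [← EquivariantEquiv.nonempty_iff, not_nonempty_iff] at he
      rw [Finset.prod_eq_zero (Finset.mem_univ e) Nat.card_of_isEmpty]
      push_cast
      positivity
  rw [card_edgeRep_eq_sum]
  push_cast
  calc _ ≤ ∑ φ : ∀ v, 𝒢.vGroup v →* Equiv.Perm (Fin n), (n : ℝ) ^ (q * n) *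
          ∏ v, (n : ℝ) ^ orbitCount (𝒢.vGroup v) (ActionSet (φ v)) :=
        Finset.sum_le_sum fun φ _ => by exact_mod_cast key φ
    _ = (n : ℝ) ^ (q * n) * ∏ v, ∑ φ : 𝒢.vGroup v →* Equiv.Perm (Fin n),
          (n : ℝ) ^ orbitCount (𝒢.vGroup v) (ActionSet φ) := by
        rw [← Finset.mul_sum, Fintype.prod_sum]
    _ ≤ (n : ℝ) ^ (q * n) * ∏ v,
          (Real.exp (2 * Fintype.card (TransRep (𝒢.vGroup v)) * n) * n.factorial) := by
        gcongr with v
        have h := sum_pow_orbitCount_le (G := 𝒢.vGroup v) (X := Fin n)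
        rwa [Nat.card_fin] at h
    _ = _ := by
        rw [Finset.prod_mul_distrib, Finset.prod_const, Finset.card_univ, Finset.sum_mul,
          Real.exp_sum]

/-- A lower bound for the number of edge representations from one compatible family. -/
theorem le_card_edgeRep {n : ℕ} (hn : 1 ≤ n) {φ₀ : ∀ v, 𝒢.vGroup v →* Equiv.Perm (Fin n)}
    (hφ₀ : 𝒢.Compatible φ₀) :
    (n.factorial : ℝ) ^ Fintype.card V * (n : ℝ) ^ 𝒢.edgeOrbits φ₀ ≤
      Nat.card (𝒢.EdgeRep (Equiv.Perm (Fin n))) * ((n : ℝ) ^ 𝒢.vertexOrbits φ₀ *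
        Real.exp ((∑ e, (Fintype.card (TransRep (𝒢.eGroup e)) : ℝ)) * n)) := by
  classical
  have : NeZero n := ⟨by omega⟩
  have := fun v => Fintype.ofFinite (𝒢.vGroup v →* Equiv.Perm (Fin n))
  -- Only families equivalent to `φ₀` at every vertex are kept; they all have the same number of
  -- intertwiners, the constant `c` below.
  let cls : ∀ v, Finset (𝒢.vGroup v →* Equiv.Perm (Fin n)) := fun v =>
    Finset.univ.filter fun φ => PermRepEquiv (𝒢.vGroup v) (ActionSet (φ₀ v)) (ActionSet φ)
  have hcls : ∀ v, (n.factorial : ℝ) ≤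
      (cls v).card * (n : ℝ) ^ orbitCount (𝒢.vGroup v) (ActionSet (φ₀ v)) := by
    intro v
    have h1 := card_class_mul_card_aut (φ₀ v)
    rw [Nat.card_fin, Nat.card_eq_fintype_card, Fintype.card_subtype] at h1
    have h2 := EquivariantEquiv.card_le_pow (G := 𝒢.vGroup v) (X := ActionSet (φ₀ v))
      (Y := ActionSet (φ₀ v))
    have h3 : Nat.card (ActionSet (φ₀ v)) = n := Nat.card_fin n
    rw [h3] at h2
    rw [← h1]
    exact_mod_cast Nat.mul_le_mul_left _ h2
  let c : ℝ := ∏ e, (Nat.card (EquivariantEquiv (𝒢.eGroup e) (𝒢.SrcSet φ₀ e) (𝒢.SrcSet φ₀ e)) : ℝ)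
  have hc : (n : ℝ) ^ 𝒢.edgeOrbits φ₀ ≤
      Real.exp ((∑ e, (Fintype.card (TransRep (𝒢.eGroup e)) : ℝ)) * n) * c := by
    rw [edgeOrbits, ← Finset.prod_pow_eq_pow_sum, Finset.sum_mul, Real.exp_sum,
      ← Finset.prod_mul_distrib]
    refine Finset.prod_le_prod (fun e _ => by positivity) fun e _ => ?_
    have h := EquivariantEquiv.pow_orbitCount_le (G := 𝒢.eGroup e) (X := 𝒢.SrcSet φ₀ e)
    have h3 : Nat.card (𝒢.SrcSet φ₀ e) = n := Nat.card_fin n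
    rwa [h3] at h
  have hsum : (∏ v, ((cls v).card : ℝ)) * c ≤ Nat.card (𝒢.EdgeRep (Equiv.Perm (Fin n))) := by
    rw [card_edgeRep_eq_sum]
    have h1 : ∀ φ ∈ Fintype.piFinset cls, (∏ e, Nat.card (EquivariantEquiv (𝒢.eGroup e)
        (𝒢.TgtSet φ e) (𝒢.SrcSet φ e)) : ℝ) = c := by
      intro φ hφ
      have h2 : ∀ v, PermRepEquiv (𝒢.vGroup v) (ActionSet (φ₀ v)) (ActionSet (φ v)) := fun v => by
        simpa [cls] using (Fintype.mem_piFinset.1 hφ) v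
      refine Finset.prod_congr rfl fun e _ => ?_
      have hs : PermRepEquiv (𝒢.eGroup e) (𝒢.SrcSet φ₀ e) (𝒢.SrcSet φ e) :=
        PullbackAction.permRepEquiv (𝒢.srcMap e) (h2 (𝒢.src e))
      have ht : PermRepEquiv (𝒢.eGroup e) (𝒢.TgtSet φ₀ e) (𝒢.TgtSet φ e) :=
        PullbackAction.permRepEquiv (𝒢.tgtMap e) (h2 (𝒢.tgt e))
      rw [EquivariantEquiv.card_congr_left (ht.symm.trans (hφ₀ e)),
        ← EquivariantEquiv.card_congr_right hs]
    have h2 : (∏ v, ((cls v).card : ℝ)) * c = ∑ φ ∈ Fintype.piFinset cls,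
        (∏ e, Nat.card (EquivariantEquiv (𝒢.eGroup e) (𝒢.TgtSet φ e) (𝒢.SrcSet φ e)) : ℝ) := by
      rw [Finset.sum_congr rfl h1, Finset.sum_const, Fintype.card_piFinset, nsmul_eq_mul]
      push_cast
      rfl
    rw [h2]
    push_cast
    exact Finset.sum_le_sum_of_subset_of_nonneg (Finset.subset_univ _) fun φ _ _ => by positivity
  calc (n.factorial : ℝ) ^ Fintype.card V * (n : ℝ) ^ 𝒢.edgeOrbits φ₀
      ≤ (∏ v, ((cls v).card : ℝ) * (n : ℝ) ^ orbitCount (𝒢.vGroup v) (ActionSet (φ₀ v))) *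
          (Real.exp ((∑ e, (Fintype.card (TransRep (𝒢.eGroup e)) : ℝ)) * n) * c) := by
        gcongr
        rw [← Finset.card_univ, ← Finset.prod_const]
        exact Finset.prod_le_prod (fun v _ => by positivity) fun v _ => hcls v
    _ = ((∏ v, ((cls v).card : ℝ)) * c) * ((n : ℝ) ^ 𝒢.vertexOrbits φ₀ *
          Real.exp ((∑ e, (Fintype.card (TransRep (𝒢.eGroup e)) : ℝ)) * n)) := by
        rw [Finset.prod_mul_distrib, Finset.prod_pow_eq_pow_sum, vertexOrbits]
        ring
    _ ≤ _ := by gcongr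

theorem finite_fundamentalGroup_hom (T : Set E) (P : Type*) [Group P] [Finite P] :
    Finite (𝒢.FundamentalGroup T →* P) :=
  Finite.of_equiv _ (𝒢.fundamentalGroupHomEquiv T P).symm

theorem exists_isFeasible : ∃ x, 𝒢.linearProgram.IsFeasible x := by
  obtain ⟨x, hx, -⟩ := 𝒢.exists_feasible_free
  exact ⟨x, hx⟩

/-- The growth coefficient is the optimum of the linear program. -/
theorem exists_rat_growthCoeff {T : Set E} (hT : 𝒢.IsSpanningTree T) (Γ : Type*) [Group Γ]
    [Infinite Γ] (iso : Γ ≃* 𝒢.FundamentalGroup T) :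
    ∃ q : ℚ, 𝒢.linearProgram.IsOptimum (q : ℝ) ∧ growthCoeff Γ = ((q : ℝ) : EReal) := by
  obtain ⟨x, hx, hopt⟩ := 𝒢.linearProgram.exists_rational_optimum
    𝒢.exists_isFeasible (B := 1) fun x hx i => 𝒢.feasible_le_one hx i
  obtain ⟨q, hqdef⟩ : ∃ q : ℚ, q = ∑ i, 𝒢.linearProgram.objective i * x i := ⟨_, rfl⟩
  rw [← hqdef] at hopt
  refine ⟨q, hopt, ?_⟩
  have hmax : ∀ y, 𝒢.linearProgram.IsFeasible y →
      ∑ i, (𝒢.linearProgram.objective i : ℝ) * y i ≤ q := fun y hy => hopt.2 ⟨y, hy, rfl⟩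
  have : Infinite (𝒢.FundamentalGroup T) := Infinite.of_injective iso iso.injective
  -- This is where it matters that Γ is infinite: a finite group has no subgroups of large index,
  -- and its growth coefficient is -∞.
  have hq0 : (0 : ℝ) ≤ q := by
    obtain ⟨y, hy, hval⟩ := 𝒢.exists_feasible_free
    have h1 := hmax y hy
    have h2 := 𝒢.euler_char_nonpos hT
    rw [hval] at h1
    linarith
  -- the number of permutation representations
  have hhom : ∀ n, Nat.card (Γ →* Equiv.Perm (Fin n)) =
      Nat.card (𝒢.FundamentalGroup T →* Equiv.Perm (Fin n)) := fun n =>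
    Nat.card_congr ⟨fun f => f.comp iso.symm.toMonoidHom, fun f => f.comp iso.toMonoidHom,
      fun f => by ext1 y; simp,
      fun f => MonoidHom.ext fun y => congrArg f (iso.apply_symm_apply y)⟩
  have hfin : ∀ n, Finite (Γ →* Equiv.Perm (Fin n)) := fun n => by
    have := 𝒢.finite_fundamentalGroup_hom T (Equiv.Perm (Fin n))
    exact Finite.of_injective (fun f : Γ →* Equiv.Perm (Fin n) => f.comp iso.symm.toMonoidHom)
      fun f g h => by
        ext1 y
        have := DFunLike.congr_fun h (iso y)
        simpa using this
  let h : ℕ → ℕ := fun n => Nat.card (Γ →* Equiv.Perm (Fin n))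
  let s : ℕ → ℕ := fun n => Nat.card {H : Subgroup Γ // H.index = n}
  let a : ℕ → ℝ := fun n => (h n : ℝ) / n.factorial
  have hfac : ∀ n : ℕ, (0 : ℝ) < n.factorial := fun n => by positivity
  -- Since |T| = |V| - 1, one factorial is left over, and it becomes the denominator in `a n`.
  have hcount : ∀ n, (Nat.card (𝒢.EdgeRep (Equiv.Perm (Fin n))) : ℝ) =
      a n * (n.factorial : ℝ) ^ Fintype.card V := by
    intro n
    rw [𝒢.card_edgeRep_eq hT, Nat.card_perm, Nat.card_fin, ← hhom, ← Nat.card_eq_fintype_card,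
      ← hT.card_add_one, pow_succ]
    simp only [a, h]
    have := hfac n
    push_cast
    field_simp
  have ha0 : a 0 = 1 := by
    have : h 0 = 1 := by
      have h1 : Subsingleton (Γ →* Equiv.Perm (Fin 0)) :=
        ⟨fun f g => by ext1 y; exact Subsingleton.elim _ _⟩
      exact Nat.card_eq_one_iff_unique.2 ⟨h1, inferInstance⟩
    simp [a, this]
  have ha : ∀ n, 0 ≤ a n := fun n => by positivity
  have hrec : ∀ m : ℕ, (m + 1) * a (m + 1) ≤
      ∑ j ∈ Finset.range (m + 1), (s (j + 1) : ℝ) * a (m - j) := by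
    intro m
    have h1 : (h (m + 1) : ℝ) ≤ ∑ j ∈ Finset.range (m + 1),
        (s (j + 1) : ℝ) * (m.descFactorial j * h (m - j)) := by
      exact_mod_cast card_perm_reps_le hfin m
    have h2 : (m + 1) * a (m + 1) = h (m + 1) / m.factorial := by
      simp only [a, Nat.factorial_succ]
      push_cast
      have := hfac m
      field_simp
    rw [h2, div_le_iff₀ (hfac m), Finset.sum_mul]
    refine h1.trans (Finset.sum_le_sum fun j hj => le_of_eq ?_)
    have h3 : ((m - j).factorial : ℝ) * m.descFactorial j = m.factorial := by
      exact_mod_cast Nat.factorial_mul_descFactorial (by simpa [Nat.lt_succ_iff] using hj)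
    simp only [a]
    rw [← h3]
    have := hfac (m - j)
    field_simp
  have hs : ∀ n : ℕ, 1 ≤ n → (s n : ℝ) ≤ n * a n := by
    intro n hn
    obtain ⟨m, rfl⟩ : ∃ m, n = m + 1 := ⟨n - 1, by omega⟩
    have := hfin (m + 1)
    have h1 : (s (m + 1) : ℝ) * m.factorial ≤ h (m + 1) := by
      exact_mod_cast card_subgroups_mul_factorial_le (Γ := Γ) m
    simp only [a, Nat.factorial_succ]
    push_cast
    rw [← mul_div_assoc, mul_div_mul_left _ _ (by positivity), le_div_iff₀ (hfac m)]
    exact h1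
  have hupper : ∀ n : ℕ, 1 ≤ n →
      a n ≤ Real.exp ((∑ v, 2 * (Fintype.card (TransRep (𝒢.vGroup v)) : ℝ)) * n) *
        (n : ℝ) ^ ((q : ℝ) * n) := by
    intro n hn
    have h1 := 𝒢.card_edgeRep_le hmax hn
    rw [hcount, ← mul_assoc] at h1
    have h2 := le_of_mul_le_mul_right h1 (pow_pos (hfac n) _)
    linarith
  obtain ⟨D, hD, hlow⟩ := 𝒢.exists_compatible_of_feasible hx
  have hlower : ∀ n : ℕ, 1 ≤ n → D ∣ n →
      Real.exp (-((∑ e, (Fintype.card (TransRep (𝒢.eGroup e)) : ℝ)) * n)) *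
        (n : ℝ) ^ ((q : ℝ) * n) ≤ a n := by
    intro n hn hDn
    have hn' : (0 : ℝ) < n := by exact_mod_cast hn
    obtain ⟨φ, hφ, hval⟩ := hlow n hDn
    rw [← hqdef] at hval
    have h1 := 𝒢.le_card_edgeRep hn hφ
    rw [hcount, mul_comm (a n), mul_assoc] at h1
    have h2 := le_of_mul_le_mul_left h1 (pow_pos (hfac n) _)
    have h3 : (n : ℝ) ^ 𝒢.edgeOrbits φ = (n : ℝ) ^ ((q : ℝ) * n) * (n : ℝ) ^ 𝒢.vertexOrbits φ := by
      rw [← Real.rpow_natCast, ← Real.rpow_natCast, ← Real.rpow_add hn']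
      congr 1
      linarith
    rw [h3, mul_left_comm, mul_comm] at h2
    have h4 := le_of_mul_le_mul_left h2 (pow_pos hn' _)
    rw [Real.exp_neg, inv_mul_le_iff₀ (Real.exp_pos _), mul_comm (Real.exp _)]
    exact h4
  have hgrowth : growthCoeff Γ = limsup (fun n : ℕ => ENNReal.log (((s n : ℕ∞) : ℝ≥0∞)) /
      (((n : ℝ) * Real.log n : ℝ) : EReal)) atTop := by
    -- Index 0 stands for infinite index, where there may be infinitely many subgroups; for n ≥ 1
    -- the extended cardinality agrees with `s n`.
    refine limsup_congr (eventually_atTop.2 ⟨1, fun n hn => ?_⟩)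
    obtain ⟨m, rfl⟩ : ∃ m, n = m + 1 := ⟨n - 1, by omega⟩
    have := hfin (m + 1)
    have hfs : Set.Finite {H : Subgroup Γ | H.index = m + 1} :=
      Set.finite_coe_iff.1 (finite_subgroups_of_index (Γ := Γ) m)
    have h1 : {H : Subgroup Γ | H.index = m + 1}.encard = ((s (m + 1) : ℕ) : ℕ∞) := by
      rw [← hfs.cast_ncard_eq]
      rfl
    rw [h1]
  rw [hgrowth]
  exact le_antisymm (limsup_log_div_le fun n hn => (hs n hn).trans
    (mul_le_mul_of_nonneg_left (hupper n hn) (by positivity)))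
    (le_limsup_log_div ha0 ha hrec hq0 hD hlower)

end Counting

end GraphOfGroups

end

noncomputable section

/-! ### Transitive permutation representations and conjugacy classes of subgroups -/

namespace TransRep

variable {G : Type*} [Group G]

theorem mem_stabilizer_coset {H : Subgroup G} (g x : G) :
    x ∈ MulAction.stabilizer G (g : G ⧸ H) ↔ g⁻¹ * x * g ∈ H := by
  rw [MulAction.mem_stabilizer_iff, MulAction.Quotient.smul_coe, eq_comm, QuotientGroup.eq,
    smul_eq_mul, mul_assoc]

theorem ofPoint_coset {H : Subgroup G} (g : G) : ofPoint (G := G) (g : G ⧸ H) = mk H := by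
  have h1 : (g : G ⧸ H) = g • ((1 : G) : G ⧸ H) := by
    rw [MulAction.Quotient.smul_coe, smul_eq_mul, mul_one]
  rw [h1, ofPoint_smul, ofPoint, MulAction.stabilizer_quotient]

/-- Two coset actions are equivalent if and only if the subgroups are conjugate. -/
theorem mk_eq_mk_iff_conj {H K : Subgroup G} :
    mk H = mk K ↔ ∃ g : G, ∀ x, x ∈ H ↔ g⁻¹ * x * g ∈ K := by
  constructor
  · intro h
    obtain ⟨φ, hφ⟩ := mk_eq_mk.1 h
    obtain ⟨g, hg⟩ := QuotientGroup.mk_surjective (φ ((1 : G) : G ⧸ H))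
    refine ⟨g, fun x => ?_⟩
    rw [← mem_stabilizer_coset, hg, MulAction.mem_stabilizer_iff, ← hφ, φ.apply_eq_iff_eq,
      ← MulAction.mem_stabilizer_iff, MulAction.stabilizer_quotient]
  · rintro ⟨g, hg⟩
    rw [← ofPoint_coset (H := K) g, ofPoint]
    congr 1
    ext x
    rw [hg, mem_stabilizer_coset]

variable {X : Type*} [MulAction G X]

/-- The points of class `ρ` fibre over the orbits of class `ρ`, with `ρ.degree` points in each.
Counting points instead of orbits is what makes the multiplicity computable from tables. -/
theorem card_ofPoint_eq [Finite X] (ρ : TransRep G) :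
    Nat.card {x : X // ofPoint (G := G) x = ρ} = ρ.multiplicity X * ρ.degree := by
  classical
  let f : {x : X // ofPoint (G := G) x = ρ} →
      {ω : MulAction.orbitRel.Quotient G X // ofOrbit ω = ρ} := fun x => ⟨Quotient.mk _ x.1, x.2⟩
  have := Fintype.ofFinite {ω : MulAction.orbitRel.Quotient G X // ofOrbit ω = ρ}
  have hfib : ∀ ω, Nat.card {x // f x = ω} = ρ.degree := by
    intro ω
    obtain ⟨φ, -⟩ := (permRepEquiv_orbit_iff ω.1 ρ).2 ω.2
    rw [degree, ← Nat.card_congr φ]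
    refine Nat.card_congr ⟨fun x => ⟨x.1.1, ?_⟩, fun y => ⟨⟨y.1, ?_⟩, ?_⟩, fun _ => rfl, fun _ => rfl⟩
    · exact MulAction.orbitRel.Quotient.mem_orbit.2 (congrArg Subtype.val x.2)
    · exact (congrArg ofOrbit (MulAction.orbitRel.Quotient.mem_orbit.1 y.2)).trans ω.2
    · exact Subtype.ext (MulAction.orbitRel.Quotient.mem_orbit.1 y.2)
  rw [Nat.card_congr (Equiv.sigmaFiberEquiv f).symm, Nat.card_sigma, multiplicity_eq]
  simp only [hfib, Finset.sum_const, Finset.card_univ, smul_eq_mul, Nat.card_eq_fintype_card]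

theorem degree_mk (K : Subgroup G) : (mk K).degree = K.index := by
  obtain ⟨φ, -⟩ := mk_eq_mk.1 (mk_stab (mk K))
  exact Nat.card_congr φ

/-- The multiplicities in a restriction, by counting elements of the group. -/
theorem restrictMult_mul {A : Type*} [Group A] [Finite A] [Finite G] (ψ : A →* G)
    (K : Subgroup A) (H : Subgroup G) :
    restrictMult ψ (mk K) (mk H) * (Nat.card A * Nat.card H) =
      Nat.card {g : G // ∃ a : A, ∀ y, y ∈ K ↔ g⁻¹ * ψ (a * y * a⁻¹) * g ∈ H} * Nat.card K := by
  have h0 : PermRepEquiv A (PullbackAction ψ (G ⧸ (mk H).stab)) (PullbackAction ψ (G ⧸ H)) :=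
    PullbackAction.permRepEquiv ψ (mk_eq_mk.1 (mk_stab (mk H)))
  have h1 := multiplicity_congr (mk K) h0
  change restrictMult ψ (mk K) (mk H) = _ at h1
  have h2 := card_ofPoint_eq (X := PullbackAction ψ (G ⧸ H)) (mk K)
  rw [degree_mk] at h2
  have hstab : ∀ (g : G) (a : A), a ∈ MulAction.stabilizer A
      (show PullbackAction ψ (G ⧸ H) from (g : G ⧸ H)) ↔ g⁻¹ * ψ a * g ∈ H := fun g a =>
    mem_stabilizer_coset g (ψ a)
  have h3 : ∀ g : G, (ofPoint (G := A) (show PullbackAction ψ (G ⧸ H) from (g : G ⧸ H)) = mk K ↔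
      ∃ a : A, ∀ y, y ∈ K ↔ g⁻¹ * ψ (a * y * a⁻¹) * g ∈ H) := by
    intro g
    rw [ofPoint, mk_eq_mk_iff_conj]
    refine exists_congr fun a => ⟨fun h y => ?_, fun h x => ?_⟩
    · rw [← hstab, h]
      group
    · rw [h, hstab]
      group
  -- The condition depends only on the coset gH, so each coset is counted |H| times.
  have h4 : Nat.card {g : G // ∃ a : A, ∀ y, y ∈ K ↔ g⁻¹ * ψ (a * y * a⁻¹) * g ∈ H} =
      Nat.card {x : PullbackAction ψ (G ⧸ H) // ofPoint (G := A) x = mk K} * Nat.card H := by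
    rw [← Nat.card_prod]
    refine Nat.card_congr ((Equiv.subtypeEquiv Subgroup.groupEquivQuotientProdSubgroup
      (q := fun p => ofPoint (G := A) (show PullbackAction ψ (G ⧸ H) from p.1) = mk K) ?_).trans
      ⟨fun p => (⟨p.1.1, p.2⟩, p.1.2), fun p => ⟨(p.1.1, p.2), p.1.2⟩, fun _ => rfl, fun _ => rfl⟩)
    intro g
    rw [← h3]
    exact Iff.rfl
  rw [h4, h2, h1, ← Subgroup.card_mul_index K]
  ring

end TransRep

/-! ### Subgroups as bit masks -/

namespace GroupTable

/-- The product according to a multiplication table. -/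
def mul (t : List (List ℕ)) (i j : ℕ) : ℕ := (t.getD i []).getD j 0

/-- The elements marked by the bits of `N` form a subgroup. -/
def IsSub (t : List (List ℕ)) (N : ℕ) : Prop :=
  (∃ i < t.length, N.testBit i = true) ∧ ∀ i < t.length, ∀ j < t.length,
    (N.testBit i = true ∧ N.testBit j = true) → N.testBit (mul t i j) = true

/-- The subgroups marked by the bits of `N` and `M` are conjugate. -/
def Conj (t : List (List ℕ)) (N M : ℕ) : Prop :=
  ∃ g < t.length, ∀ i < t.length, ∀ j < t.length, mul t j g = mul t g i → N.testBit i = M.testBit j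

/-- `N` is the least bit mask in a conjugacy class of subgroups. -/
def Canon (t : List (List ℕ)) (N : ℕ) : Prop :=
  IsSub t N ∧ ∀ M < N, IsSub t M → ¬ Conj t N M

open Classical in
/-- Bit masks of representatives of the conjugacy classes of subgroups. -/
def reps (t : List (List ℕ)) : List ℕ := (List.range (2 ^ t.length)).filter fun N => Canon t N

/-- The number of elements marked by the bits of `N`. -/
def order (t : List (List ℕ)) (N : ℕ) : ℕ := ((List.range t.length).filter fun i => N.testBit i).length

/-- The index of the subgroup marked by the bits of `N`. -/
def degree (t : List (List ℕ)) (N : ℕ) : ℕ := t.length / order t N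

/-- The stabilizer of the coset of `g` is conjugate to the subgroup with bit mask `K`. -/
def Fixes (tA tG : List (List ℕ)) (ψ : List ℕ) (K H g : ℕ) : Prop :=
  ∃ a < tA.length, ∀ x < tA.length, ∀ y < tA.length, mul tA x a = mul tA a y →
    (K.testBit y = true ↔ ∃ j < tG.length, mul tG g j = mul tG (ψ.getD x 0) g ∧ H.testBit j = true)

open Classical in
/-- The multiplicity of the coset action of `K` in the restriction of the one of `H`. -/
def restrictMult (tA tG : List (List ℕ)) (ψ : List ℕ) (K H : ℕ) : ℕ :=
  ((List.range tG.length).filter fun g => Fixes tA tG ψ K H g).length * order tA K /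
    (tA.length * order tG H)

theorem length_filter_range (n : ℕ) (p : ℕ → Bool) :
    ((List.range n).filter p).length = Nat.card {i : Fin n // p i = true} := by
  have h : (List.range n).filter p = (List.range n).filter fun i => decide (p i = true) := by simp
  rw [h, Nat.card_eq_fintype_card, Fintype.card_subtype, Finset.card_filter,
    Fin.sum_univ_eq_sum_range (fun i => if p i = true then 1 else 0) n, ← Finset.card_filter]
  rfl

theorem getD_mapTable {A G : Type*} {m n : ℕ} (enum : Fin n ≃ G) (enumA : Fin m ≃ A) (ψ : A → G) (i : Fin m) :
    (mapTable enumA enum ψ).getD i 0 = enum.symm (ψ (enumA i)) := by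
  simp [mapTable]

/-! ### Correctness of the table operations for an enumerated group -/

section Enumerated

variable {G : Type*} [Group G] {n : ℕ} (enum : Fin n ≃ G)

theorem length_mulTable : (mulTable enum).length = n := by simp [mulTable]

theorem mul_mulTable (i j : Fin n) : mul (mulTable enum) i j = enum.symm (enum i * enum j) := by
  simp [mul, mulTable]

theorem mul_mulTable_eq_iff (i j k l : Fin n) :
    mul (mulTable enum) i j = mul (mulTable enum) k l ↔ enum i * enum j = enum k * enum l := by
  rw [mul_mulTable, mul_mulTable, Fin.val_inj, enum.symm.apply_eq_iff_eq]

theorem exists_lt_iff {n : ℕ} {p : ℕ → Prop} : (∃ i < n, p i) ↔ ∃ i : Fin n, p i :=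
  ⟨fun ⟨i, hi, h⟩ => ⟨⟨i, hi⟩, h⟩, fun ⟨i, h⟩ => ⟨i, i.2, h⟩⟩

theorem forall_lt_iff {n : ℕ} {p : ℕ → Prop} : (∀ i < n, p i) ↔ ∀ i : Fin n, p i :=
  ⟨fun h i => h i i.2, fun h i hi => h ⟨i, hi⟩⟩

/-- The bits of `N` mark the elements of `H`. -/
def Codes (N : ℕ) (H : Subgroup G) : Prop :=
  N < 2 ^ n ∧ ∀ i : Fin n, N.testBit i = true ↔ enum i ∈ H

variable {enum}

theorem exists_codes (enum : Fin n ≃ G) (H : Subgroup G) : ∃ N, Codes enum N H := by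
  classical
  exact ⟨Nat.ofBits fun i => decide (enum i ∈ H), Nat.ofBits_lt_two_pow _, fun i => by simp⟩

theorem Codes.subgroup_unique {N : ℕ} {H K : Subgroup G} (hH : Codes enum N H)
    (hK : Codes enum N K) : H = K := by
  ext g
  obtain ⟨i, rfl⟩ := enum.surjective g
  exact (hH.2 i).symm.trans (hK.2 i)

/-- In a finite group, a nonempty set closed under products contains the identity and all inverses,
because these are powers of its elements. -/
theorem isSub_iff {N : ℕ} (hN : N < 2 ^ n) :
    IsSub (mulTable enum) N ↔ ∃ H : Subgroup G, Codes enum N H := by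
  have := Finite.of_equiv _ enum
  have h0 : IsSub (mulTable enum) N ↔ (∃ i : Fin n, N.testBit i = true) ∧ ∀ i j : Fin n,
      N.testBit i = true → N.testBit j = true →
      N.testBit (enum.symm (enum i * enum j) : Fin n) = true := by
    rw [IsSub, length_mulTable, exists_lt_iff, forall_lt_iff]
    refine and_congr Iff.rfl (forall_congr' fun i => ?_)
    rw [forall_lt_iff]
    refine forall_congr' fun j => ?_
    rw [mul_mulTable, and_imp]
  rw [h0]
  constructor
  · rintro ⟨⟨i₀, hi₀⟩, hmul⟩
    let S : Subsemigroup G :=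
      { carrier := {g | N.testBit (enum.symm g : Fin n) = true}
        mul_mem' := fun {a b} ha hb => by simpa using hmul _ _ ha hb }
    -- A subsemigroup is only closed under positive powers, hence the exponent k + 1.
    have hS : ∀ (k : ℕ) {g : G}, g ∈ S → g ^ (k + 1) ∈ S := by
      intro k g hg
      induction k with
      | zero => simpa using hg
      | succ k ih => rw [pow_succ]; exact mul_mem ih hg
    have hone : (1 : G) ∈ S := by
      have h1 : enum i₀ ∈ S := by change N.testBit (enum.symm (enum i₀) : Fin n) = true; simpa
      have h2 := hS (orderOf (enum i₀) - 1) h1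
      rwa [Nat.sub_add_cancel (orderOf_pos _), pow_orderOf_eq_one] at h2
    let H : Subgroup G :=
      { S with
        one_mem' := hone
        inv_mem' := fun {g} hg => by
          have h2 : g⁻¹ = g ^ (orderOf g - 1) := by
            rw [inv_eq_iff_mul_eq_one, ← pow_succ', Nat.sub_add_cancel (orderOf_pos _),
              pow_orderOf_eq_one]
          rw [h2]
          rcases Nat.eq_zero_or_pos (orderOf g - 1) with h3 | h3
          · rw [h3, pow_zero]; exact hone
          · have h4 := hS (orderOf g - 1 - 1) (show g ∈ S from hg)
            rwa [Nat.sub_add_cancel h3] at h4 }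
    refine ⟨H, hN, fun i => ?_⟩
    change _ ↔ N.testBit (enum.symm (enum i) : Fin n) = true
    rw [Equiv.symm_apply_apply]
  · rintro ⟨H, -, hH⟩
    refine ⟨⟨enum.symm 1, by rw [hH, Equiv.apply_symm_apply]; exact one_mem H⟩, fun i j hi hj => ?_⟩
    rw [hH, Equiv.apply_symm_apply]
    exact mul_mem ((hH i).1 hi) ((hH j).1 hj)

/-- The equation jg = gi in `Conj` expresses i = g⁻¹jg without inverses. It says that j ∈ K if and
only if g⁻¹jg ∈ H, so the roles of H and K are exchanged first. -/
theorem conj_iff {N M : ℕ} {H K : Subgroup G} (hN : Codes enum N H) (hM : Codes enum M K) :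
    Conj (mulTable enum) N M ↔ TransRep.mk H = TransRep.mk K := by
  rw [eq_comm, TransRep.mk_eq_mk_iff_conj, Conj, length_mulTable, exists_lt_iff]
  refine (enum.exists_congr fun g => ?_)
  rw [forall_lt_iff]
  constructor
  · intro h x
    obtain ⟨j, rfl⟩ := enum.surjective x
    have h1 := h (enum.symm ((enum g)⁻¹ * enum j * enum g)) j j.2 (by
      rw [mul_mulTable_eq_iff, Equiv.apply_symm_apply]; group)
    rw [← hM.2 j, ← h1, hN.2, Equiv.apply_symm_apply]
  · intro h i
    rw [forall_lt_iff]
    intro j hij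
    rw [mul_mulTable_eq_iff] at hij
    rw [Bool.eq_iff_iff, hN.2, hM.2, h, mul_assoc, hij]
    group

theorem order_eq {N : ℕ} {H : Subgroup G} (hN : Codes enum N H) :
    order (mulTable enum) N = Nat.card H := by
  rw [order, length_filter_range, length_mulTable]
  exact Nat.card_congr (enum.subtypeEquiv fun i => hN.2 i)

variable (enum)

/-- The least bit mask of a point stabilizer in the class `θ`. -/
def canonCode (θ : TransRep G) : ℕ := sInf {N | ∃ H, Codes enum N H ∧ TransRep.mk H = θ}

theorem canonCode_spec (θ : TransRep G) :
    ∃ H, Codes enum (canonCode enum θ) H ∧ TransRep.mk H = θ := by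
  obtain ⟨N, hN⟩ := exists_codes enum θ.stab
  exact Nat.sInf_mem (s := {N | ∃ H, Codes enum N H ∧ TransRep.mk H = θ})
    ⟨N, θ.stab, hN, θ.mk_stab⟩

theorem canonCode_injective : Function.Injective (canonCode enum) := by
  intro θ θ' h
  obtain ⟨H, hH, rfl⟩ := canonCode_spec enum θ
  obtain ⟨K, hK, rfl⟩ := canonCode_spec enum θ'
  rw [h] at hH
  rw [hH.subgroup_unique hK]

/-- Minimality in the conjugacy class singles out one mask per class and can be tested by a search
among the smaller masks. -/
theorem mem_reps {N : ℕ} : N ∈ reps (mulTable enum) ↔ ∃ θ, canonCode enum θ = N := by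
  classical
  rw [reps, List.mem_filter, List.mem_range, length_mulTable, decide_eq_true_eq]
  constructor
  · rintro ⟨hN, hsub, hmin⟩
    obtain ⟨H, hH⟩ := (isSub_iff hN).1 hsub
    refine ⟨TransRep.mk H, le_antisymm (Nat.sInf_le ⟨H, hH, rfl⟩) ?_⟩
    by_contra hlt
    obtain ⟨K, hK, hKH⟩ := canonCode_spec enum (TransRep.mk H)
    exact hmin _ (not_le.1 hlt) ((isSub_iff hK.1).2 ⟨K, hK⟩) ((conj_iff hH hK).2 hKH.symm)
  · rintro ⟨θ, rfl⟩
    obtain ⟨H, hH, hθ⟩ := canonCode_spec enum θ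
    refine ⟨hH.1, (isSub_iff hH.1).2 ⟨H, hH⟩, fun M hM hsub hconj => ?_⟩
    obtain ⟨K, hK⟩ := (isSub_iff (hM.trans hH.1)).1 hsub
    exact absurd (Nat.sInf_le (s := {N | ∃ H, Codes enum N H ∧ TransRep.mk H = θ})
      ⟨K, hK, ((conj_iff hH hK).1 hconj).symm.trans hθ⟩) (not_le.2 hM)

theorem nodup_reps (t : List (List ℕ)) : (reps t).Nodup := List.nodup_range.filter _

theorem degree_eq (θ : TransRep G) : degree (mulTable enum) (canonCode enum θ) = θ.degree := by
  have := Finite.of_equiv _ enum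
  obtain ⟨H, hH, hθ⟩ := canonCode_spec enum θ
  have h1 : n = Nat.card G := by rw [← Nat.card_congr enum, Nat.card_fin]
  rw [degree, order_eq hH, length_mulTable, ← hθ, TransRep.degree_mk, h1,
    ← Subgroup.card_mul_index H, Nat.mul_div_cancel_left _ Nat.card_pos]

/-- The table version solves `TransRep.restrictMult_mul` for the multiplicity; the natural number
division in it is exact. -/
theorem restrictMult_eq {A : Type*} [Group A] {m : ℕ} (enumA : Fin m ≃ A) (ψ : A →* G)
    (ρ : TransRep A) (θ : TransRep G) :
    restrictMult (mulTable enumA) (mulTable enum) (mapTable enumA enum ψ) (canonCode enumA ρ)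
      (canonCode enum θ) = TransRep.restrictMult ψ ρ θ := by
  classical
  have := Finite.of_equiv _ enum
  have := Finite.of_equiv _ enumA
  obtain ⟨H, hH, hθ⟩ := canonCode_spec enum θ
  obtain ⟨K, hK, hρ⟩ := canonCode_spec enumA ρ
  have h1 : m = Nat.card A := by rw [← Nat.card_congr enumA, Nat.card_fin]
  have h2 := TransRep.restrictMult_mul ψ K H
  rw [restrictMult, order_eq hH, order_eq hK, length_filter_range, length_mulTable enumA,
    length_mulTable enum]
  have h3 : Nat.card {g : Fin n // decide (Fixes (mulTable enumA)
      (mulTable enum) (mapTable enumA enum ψ) (canonCode enumA ρ) (canonCode enum θ) g) = true} =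
      Nat.card {g : G // ∃ a : A, ∀ y, y ∈ K ↔ g⁻¹ * ψ (a * y * a⁻¹) * g ∈ H} := by
    refine Nat.card_congr (enum.subtypeEquiv fun g => ?_)
    rw [decide_eq_true_eq, Fixes, length_mulTable, length_mulTable, exists_lt_iff]
    refine enumA.exists_congr fun a => ?_
    rw [forall_lt_iff]
    -- The search for j with gj = ψ(x)g finds g⁻¹ψ(x)g without an inversion table.
    have hcond : ∀ x : Fin m, (∃ j < n, mul (mulTable enum) g j =
        mul (mulTable enum) ((mapTable enumA enum ψ).getD x 0) g ∧
        (canonCode enum θ).testBit j = true) ↔ (enum g)⁻¹ * ψ (enumA x) * enum g ∈ H := by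
      intro x
      rw [exists_lt_iff, getD_mapTable]
      constructor
      · rintro ⟨j, hj, hb⟩
        rw [mul_mulTable_eq_iff, Equiv.apply_symm_apply] at hj
        rw [mul_assoc, ← hj, inv_mul_cancel_left, ← hH.2]
        exact hb
      · intro h
        refine ⟨enum.symm ((enum g)⁻¹ * ψ (enumA x) * enum g), ?_, ?_⟩
        · rw [mul_mulTable_eq_iff, Equiv.apply_symm_apply, Equiv.apply_symm_apply]; group
        · rw [hH.2, Equiv.apply_symm_apply]; exact h
    constructor
    · intro h y
      obtain ⟨y, rfl⟩ := enumA.surjective y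
      have h4 := h (enumA.symm (enumA a * enumA y * (enumA a)⁻¹)) y y.2 (by
        rw [mul_mulTable_eq_iff, Equiv.apply_symm_apply]; group)
      rw [← hK.2, h4]
      have h5 := hcond (enumA.symm (enumA a * enumA y * (enumA a)⁻¹))
      rw [Equiv.apply_symm_apply] at h5
      exact h5
    · intro h x
      rw [forall_lt_iff]
      intro y hxy
      rw [mul_mulTable_eq_iff] at hxy
      have h5 := hcond x
      have h6 := h (enumA y)
      rw [← hxy, mul_inv_cancel_right] at h6
      rw [hK.2, h6]
      exact h5.symm
  rw [h3, ← h2, h1, hρ, hθ, Nat.mul_div_cancel]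
  exact Nat.mul_pos Nat.card_pos Nat.card_pos

end Enumerated

end GroupTable

end

noncomputable section

/-! ### Primitive recursive functions -/

section PrimrecLemmas

variable {α β : Type*} [Primcodable α] [Primcodable β]

theorem PrimrecPred.exists_lt_of {f : α → ℕ} {p : α → ℕ → Prop} (hf : Primrec f)
    (hp : PrimrecPred fun x : α × ℕ => p x.1 x.2) : PrimrecPred fun a => ∃ i < f a, p a i := by
  have h1 : PrimrecRel fun (i : ℕ) (a : α) => p a i := hp.comp (Primrec.snd.pair Primrec.fst)
  exact (h1.exists_mem_list.comp (Primrec.list_range.comp hf) Primrec.id).of_eq (by simp)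

theorem PrimrecPred.forall_lt_of {f : α → ℕ} {p : α → ℕ → Prop} (hf : Primrec f)
    (hp : PrimrecPred fun x : α × ℕ => p x.1 x.2) : PrimrecPred fun a => ∀ i < f a, p a i := by
  have h1 : PrimrecRel fun (i : ℕ) (a : α) => p a i := hp.comp (Primrec.snd.pair Primrec.fst)
  exact (h1.forall_mem_list.comp (Primrec.list_range.comp hf) Primrec.id).of_eq (by simp)

theorem Primrec.filter_range_of {f : α → ℕ} {p : α → ℕ → Prop} [∀ a, DecidablePred (p a)]
    (hf : Primrec f) (hp : PrimrecPred fun x : α × ℕ => p x.1 x.2) :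
    Primrec fun a => (List.range (f a)).filter fun i => p a i := by
  classical
  have h1 : PrimrecRel fun (i : ℕ) (a : α) => p a i := hp.comp (Primrec.snd.pair Primrec.fst)
  exact (h1.listFilter.comp (Primrec.list_range.comp hf) Primrec.id).of_eq fun a =>
    List.filter_congr fun i _ => by simp

theorem PrimrecPred.imp_of {p q : α → Prop} (hp : PrimrecPred p) (hq : PrimrecPred q) :
    PrimrecPred fun a => p a → q a :=
  (hp.not.or hq).of_eq fun _ => imp_iff_not_or.symm

theorem PrimrecPred.iff_of {p q : α → Prop} (hp : PrimrecPred p) (hq : PrimrecPred q) :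
    PrimrecPred fun a => p a ↔ q a :=
  ((hp.imp_of hq).and (hq.imp_of hp)).of_eq fun _ => iff_def.symm

theorem Primrec.nat_pow_of {f g : α → ℕ} (hf : Primrec f) (hg : Primrec g) :
    Primrec fun a => f a ^ g a :=
  (Primrec₂.unpaired'.1 Nat.Primrec.pow).comp hf hg

theorem PrimrecPred.testBit_of {f g : α → ℕ} (hf : Primrec f) (hg : Primrec g) :
    PrimrecPred fun a => (f a).testBit (g a) = true :=
  (Primrec.eq.comp (Primrec.nat_mod.comp (Primrec.nat_div.comp hf
    (Primrec.nat_pow_of (Primrec.const 2) hg)) (Primrec.const 2)) (Primrec.const 1)).of_eq fun a => by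
      rw [Nat.testBit_eq_decide_div_mod_eq, decide_eq_true_eq]

theorem Primrec.sum_map_of {L : α → List β} {f : α → β → ℕ} (hL : Primrec L)
    (hf : Primrec fun x : α × β => f x.1 x.2) : Primrec fun a => ((L a).map (f a)).sum :=
  (Primrec.list_foldr (Primrec.list_map hL (Primrec₂.mk hf)) (Primrec.const 0)
    (h := fun _ p => p.1 + p.2) (Primrec₂.mk (Primrec.nat_add.comp (Primrec.fst.comp Primrec.snd)
      (Primrec.snd.comp Primrec.snd)))).of_eq fun _ => List.sum_eq_foldr.symm

/-- Integers are encoded by k ↦ 2k and -(k+1) ↦ 2k+1, so the code of a difference is piecewise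
natural number arithmetic. The predecessor accounts for the shift by one on the negative side. -/
theorem Primrec.int_sub_of {f g : α → ℕ} (hf : Primrec f) (hg : Primrec g) :
    Primrec fun a => ((f a : ℤ) - (g a : ℤ)) := by
  refine Primrec.encode_iff.1 ((Primrec.ite (Primrec.nat_le.comp hg hf)
    (Primrec.nat_double.comp (Primrec.nat_sub.comp hf hg))
    (Primrec.nat_double_succ.comp (Primrec.pred.comp (Primrec.nat_sub.comp hg hf)))).of_eq fun a => ?_)
  split_ifs with h
  · obtain ⟨k, hk⟩ := Nat.exists_eq_add_of_le h
    rw [hk, Nat.add_sub_cancel_left, Nat.cast_add, add_sub_cancel_left]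
    rfl
  · obtain ⟨k, hk⟩ := Nat.exists_eq_add_of_lt (not_le.1 h)
    have h1 : ((f a : ℤ) - (g a : ℤ)) = Int.negSucc k := by rw [hk, Int.negSucc_eq]; push_cast; ring
    have h2 : (g a - f a).pred = k := by rw [hk]; simp only [Nat.pred_eq_sub_one]; omega
    rw [h1, h2]
    rfl

end PrimrecLemmas

/-! ### Primitive recursiveness of the table operations -/

namespace GroupTable

variable {α : Type*} [Primcodable α]

open Primrec in
theorem primrec_mul {t : α → List (List ℕ)} {i j : α → ℕ} (ht : Primrec t) (hi : Primrec i)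
    (hj : Primrec j) : Primrec fun a => mul (t a) (i a) (j a) :=
  (list_getD 0).comp ((list_getD []).comp ht hi) hj

open Primrec in
theorem primrec_isSub {t : α → List (List ℕ)} {N : α → ℕ} (ht : Primrec t) (hN : Primrec N) :
    PrimrecPred fun a => IsSub (t a) (N a) := by
  refine (PrimrecPred.exists_lt_of (list_length.comp ht) (.testBit_of (hN.comp fst) snd)).and
    (PrimrecPred.forall_lt_of (list_length.comp ht)
      (PrimrecPred.forall_lt_of (list_length.comp (ht.comp fst)) ?_))
  have hi : Primrec fun x : (α × ℕ) × ℕ => x.1.2 := snd.comp fst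
  have hN' : Primrec fun x : (α × ℕ) × ℕ => N x.1.1 := hN.comp (fst.comp fst)
  exact ((PrimrecPred.testBit_of hN' hi).and (.testBit_of hN' snd)).imp_of
    (.testBit_of hN' (primrec_mul (ht.comp (fst.comp fst)) hi snd))

open Primrec in
theorem primrec_conj {t : α → List (List ℕ)} {N M : α → ℕ} (ht : Primrec t) (hN : Primrec N)
    (hM : Primrec M) : PrimrecPred fun a => Conj (t a) (N a) (M a) := by
  refine PrimrecPred.exists_lt_of (list_length.comp ht)
    (PrimrecPred.forall_lt_of (list_length.comp (ht.comp fst))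
      (PrimrecPred.forall_lt_of (list_length.comp (ht.comp (fst.comp fst))) ?_))
  have ha : Primrec fun x : ((α × ℕ) × ℕ) × ℕ => x.1.1.1 := fst.comp (fst.comp fst)
  have hg : Primrec fun x : ((α × ℕ) × ℕ) × ℕ => x.1.1.2 := snd.comp (fst.comp fst)
  have hi : Primrec fun x : ((α × ℕ) × ℕ) × ℕ => x.1.2 := snd.comp fst
  refine (Primrec.eq.comp (primrec_mul (ht.comp ha) snd hg)
    (primrec_mul (ht.comp ha) hg hi)).imp_of ?_
  exact ((PrimrecPred.testBit_of (hN.comp ha) hi).iff_of (.testBit_of (hM.comp ha) snd)).of_eq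
    fun x => Bool.eq_iff_iff.symm

open Primrec in
theorem primrec_reps {t : α → List (List ℕ)} (ht : Primrec t) : Primrec fun a => reps (t a) := by
  classical
  refine Primrec.filter_range_of (nat_pow_of (const 2) (list_length.comp ht)) ?_
  have ht' : Primrec fun x : α × ℕ => t x.1 := ht.comp fst
  refine (primrec_isSub ht' snd).and (PrimrecPred.forall_lt_of snd ?_)
  exact (primrec_isSub (ht'.comp fst) snd).imp_of
    (primrec_conj (ht'.comp fst) (snd.comp fst) snd).not

open Primrec in
theorem primrec_order {t : α → List (List ℕ)} {N : α → ℕ} (ht : Primrec t) (hN : Primrec N) :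
    Primrec fun a => order (t a) (N a) :=
  (list_length.comp (Primrec.filter_range_of (p := fun a i => (N a).testBit i = true)
    (list_length.comp ht) (.testBit_of (hN.comp fst) snd))).of_eq fun a => by simp [order]

open Primrec in
theorem primrec_degree {t : α → List (List ℕ)} {N : α → ℕ} (ht : Primrec t) (hN : Primrec N) :
    Primrec fun a => degree (t a) (N a) :=
  nat_div.comp (list_length.comp ht) (primrec_order ht hN)

open Primrec in
theorem primrec_fixes {tA tG : α → List (List ℕ)} {ψ : α → List ℕ} {K H g : α → ℕ}
    (hA : Primrec tA) (hG : Primrec tG) (hψ : Primrec ψ) (hK : Primrec K) (hH : Primrec H)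
    (hg : Primrec g) : PrimrecPred fun a => Fixes (tA a) (tG a) (ψ a) (K a) (H a) (g a) := by
  refine PrimrecPred.exists_lt_of (list_length.comp hA)
    (PrimrecPred.forall_lt_of (list_length.comp (hA.comp fst))
      (PrimrecPred.forall_lt_of (list_length.comp (hA.comp (fst.comp fst))) ?_))
  have ha : Primrec fun x : ((α × ℕ) × ℕ) × ℕ => x.1.1.1 := fst.comp (fst.comp fst)
  have hb : Primrec fun x : ((α × ℕ) × ℕ) × ℕ => x.1.1.2 := snd.comp (fst.comp fst)
  have hx : Primrec fun x : ((α × ℕ) × ℕ) × ℕ => x.1.2 := snd.comp fst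
  refine (Primrec.eq.comp (primrec_mul (hA.comp ha) hx hb)
    (primrec_mul (hA.comp ha) hb snd)).imp_of
    ((PrimrecPred.testBit_of (hK.comp ha) snd).iff_of
      (PrimrecPred.exists_lt_of (list_length.comp (hG.comp ha)) ?_))
  have ha' := ha.comp (fst (β := ℕ))
  exact (Primrec.eq.comp (primrec_mul (hG.comp ha') (hg.comp ha') snd)
    (primrec_mul (hG.comp ha') ((list_getD 0).comp (hψ.comp ha') (hx.comp fst))
      (hg.comp ha'))).and (.testBit_of (hH.comp ha') snd)

open Primrec in
theorem primrec_restrictMult {tA tG : α → List (List ℕ)} {ψ : α → List ℕ} {K H : α → ℕ}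
    (hA : Primrec tA) (hG : Primrec tG) (hψ : Primrec ψ) (hK : Primrec K) (hH : Primrec H) :
    Primrec fun a => restrictMult (tA a) (tG a) (ψ a) (K a) (H a) := by
  classical
  have h1 := Primrec.filter_range_of (p := fun a g => Fixes (tA a) (tG a) (ψ a) (K a) (H a) g)
    (list_length.comp hG) (primrec_fixes (hA.comp fst) (hG.comp fst) (hψ.comp fst) (hK.comp fst)
      (hH.comp fst) snd)
  exact (nat_div.comp (nat_mul.comp (list_length.comp h1) (primrec_order hA hK))
    (nat_mul.comp (list_length.comp hA) (primrec_order hG hH))).of_eq fun a => by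
      simp only [restrictMult]

end GroupTable

/-! ### The linear program of a coded graph of groups -/

namespace GraphCode

open GroupTable

/-- The multiplication table of the group at the vertex with number `v`. -/
def vertexTable (C : GraphCode) (v : ℕ) : List (List ℕ) := C.1.getD v []

/-- The data of the edge with number `e`. -/
def edge (C : GraphCode) (e : ℕ) : ℕ × ℕ × List (List ℕ) × List ℕ × List ℕ :=
  C.2.getD e (0, 0, [], [], [])

/-- The variables: number of the vertex and bit mask of the stabilizer. -/
def vars (C : GraphCode) : List (ℕ × ℕ) :=
  (List.range C.1.length).flatMap fun v => (reps (C.vertexTable v)).map fun N => (v, N)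

/-- The constraints: `(0, v, 0)` for a vertex, and `(1, e, M)` for an edge and a bit mask. -/
def cons (C : GraphCode) : List (ℕ × ℕ × ℕ) :=
  ((List.range C.1.length).map fun v => (0, v, 0)) ++
    (List.range C.2.length).flatMap fun e => (reps (C.edge e).2.2.1).map fun M => (1, e, M)

/-- The coefficient of a variable in the linear form of the source. -/
def srcCoeff (C : GraphCode) (e M : ℕ) (i : ℕ × ℕ) : ℕ :=
  if (C.edge e).1 = i.1 then
    restrictMult (C.edge e).2.2.1 (C.vertexTable i.1) (C.edge e).2.2.2.1 M i.2 else 0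

/-- The coefficient of a variable in the linear form of the target. -/
def tgtCoeff (C : GraphCode) (e M : ℕ) (i : ℕ × ℕ) : ℕ :=
  if (C.edge e).2.1 = i.1 then
    restrictMult (C.edge e).2.2.1 (C.vertexTable i.1) (C.edge e).2.2.2.2 M i.2 else 0

/-- The coefficient of a variable in the objective. -/
def objective (C : GraphCode) (i : ℕ × ℕ) : ℤ :=
  ((((List.range C.2.length).map fun e =>
    ((reps (C.edge e).2.2.1).map fun M => C.srcCoeff e M i).sum).sum : ℕ) : ℤ) - ((1 : ℕ) : ℤ)

/-- The coefficient of a variable in a constraint. -/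
def entry (C : GraphCode) (k : ℕ × ℕ × ℕ) (i : ℕ × ℕ) : ℤ :=
  ((if k.1 = 0 then if i.1 = k.2.1 then degree (C.vertexTable i.1) i.2 else 0
    else C.srcCoeff k.2.1 k.2.2 i : ℕ) : ℤ) -
  ((if k.1 = 0 then 0 else C.tgtCoeff k.2.1 k.2.2 i : ℕ) : ℤ)

/-- The right hand side of a constraint. -/
def rhs (k : ℕ × ℕ × ℕ) : ℤ := if k.1 = 0 then 1 else 0

/-- The code of the linear program. -/
def lpCode (C : GraphCode) : LPCode :=
  (C.vars.map fun i => (C.objective i, 1),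
    C.cons.map fun k => (C.vars.map fun i => (C.entry k i, 1), (rhs k, 1)))

/-! ### Primitive recursiveness of the coded linear program -/

section Primrec

open Primrec

variable {α : Type*} [Primcodable α]

theorem primrec_vertexTable {C : α → GraphCode} {v : α → ℕ} (hC : Primrec C) (hv : Primrec v) :
    Primrec fun a => (C a).vertexTable (v a) :=
  (list_getD []).comp (fst.comp hC) hv

theorem primrec_edge {C : α → GraphCode} {e : α → ℕ} (hC : Primrec C) (he : Primrec e) :
    Primrec fun a => (C a).edge (e a) :=
  (list_getD (0, 0, [], [], [])).comp (snd.comp hC) he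

theorem primrec_vars {C : α → GraphCode} (hC : Primrec C) : Primrec fun a => (C a).vars :=
  list_flatMap (list_range.comp (list_length.comp (fst.comp hC)))
    (Primrec₂.mk (list_map (primrec_reps (primrec_vertexTable (hC.comp fst) snd))
      (Primrec₂.mk (pair (snd.comp fst) snd))))

theorem primrec_edgeTable {C : α → GraphCode} {e : α → ℕ} (hC : Primrec C) (he : Primrec e) :
    Primrec fun a => ((C a).edge (e a)).2.2.1 :=
  fst.comp (snd.comp (snd.comp (primrec_edge hC he)))

theorem primrec_cons {C : α → GraphCode} (hC : Primrec C) : Primrec fun a => (C a).cons :=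
  list_append.comp
    (list_map (list_range.comp (list_length.comp (fst.comp hC)))
      (Primrec₂.mk (pair (const 0) (pair snd (const 0)))))
    (list_flatMap (list_range.comp (list_length.comp (snd.comp hC)))
      (Primrec₂.mk (list_map (primrec_reps (primrec_edgeTable (hC.comp fst) snd))
        (Primrec₂.mk (pair (const 1) (pair (snd.comp fst) snd))))))

theorem primrec_srcCoeff {C : α → GraphCode} {e M : α → ℕ} {i : α → ℕ × ℕ} (hC : Primrec C)
    (he : Primrec e) (hM : Primrec M) (hi : Primrec i) :
    Primrec fun a => (C a).srcCoeff (e a) (M a) (i a) :=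
  ite (Primrec.eq.comp (fst.comp (primrec_edge hC he)) (fst.comp hi))
    (primrec_restrictMult (primrec_edgeTable hC he) (primrec_vertexTable hC (fst.comp hi))
      (fst.comp (snd.comp (snd.comp (snd.comp (primrec_edge hC he))))) hM (snd.comp hi)) (const 0)

theorem primrec_tgtCoeff {C : α → GraphCode} {e M : α → ℕ} {i : α → ℕ × ℕ} (hC : Primrec C)
    (he : Primrec e) (hM : Primrec M) (hi : Primrec i) :
    Primrec fun a => (C a).tgtCoeff (e a) (M a) (i a) :=
  ite (Primrec.eq.comp (fst.comp (snd.comp (primrec_edge hC he))) (fst.comp hi))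
    (primrec_restrictMult (primrec_edgeTable hC he) (primrec_vertexTable hC (fst.comp hi))
      (snd.comp (snd.comp (snd.comp (snd.comp (primrec_edge hC he))))) hM (snd.comp hi)) (const 0)

/-- The coefficient is written as a difference of two natural numbers so that `int_sub_of` applies;
the entries of the matrix have the same form. -/
theorem primrec_objective {C : α → GraphCode} {i : α → ℕ × ℕ} (hC : Primrec C) (hi : Primrec i) :
    Primrec fun a => (C a).objective (i a) := by
  refine int_sub_of (sum_map_of (list_range.comp (list_length.comp (snd.comp hC)))
    (sum_map_of (primrec_reps (primrec_edgeTable (hC.comp fst) snd)) ?_)) (const 1)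
  exact primrec_srcCoeff (hC.comp (fst.comp fst)) (snd.comp fst) snd (hi.comp (fst.comp fst))

theorem primrec_entry {C : α → GraphCode} {k : α → ℕ × ℕ × ℕ} {i : α → ℕ × ℕ} (hC : Primrec C)
    (hk : Primrec k) (hi : Primrec i) : Primrec fun a => (C a).entry (k a) (i a) := by
  have hk1 : PrimrecPred fun a => (k a).1 = 0 := Primrec.eq.comp (fst.comp hk) (const 0)
  have hk2 : Primrec fun a => (k a).2.1 := fst.comp (snd.comp hk)
  have hk3 : Primrec fun a => (k a).2.2 := snd.comp (snd.comp hk)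
  exact int_sub_of (ite hk1 (ite (Primrec.eq.comp (fst.comp hi) hk2)
      (primrec_degree (primrec_vertexTable hC (fst.comp hi)) (snd.comp hi)) (const 0))
      (primrec_srcCoeff hC hk2 hk3 hi))
    (ite hk1 (const 0) (primrec_tgtCoeff hC hk2 hk3 hi))

theorem primrec_lpCode : Primrec lpCode := by
  refine pair (list_map (primrec_vars Primrec.id)
    (Primrec₂.mk (pair (primrec_objective fst snd) (const 1))))
    (list_map (primrec_cons Primrec.id) (Primrec₂.mk (pair
      (list_map (primrec_vars fst) (Primrec₂.mk (pair
        (primrec_entry (fst.comp fst) (snd.comp fst) snd) (const 1))))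
      (pair (ite (Primrec.eq.comp (fst.comp snd) (const 0)) (const 1) (const 0)) (const 1)))))

end Primrec

end GraphCode

/-- A list without repetitions of the values of an injective map enumerates its domain. -/
theorem exists_enumeration {α β : Type*} {enc : α → β} (henc : Function.Injective enc) {L : List β}
    (hL : L.Nodup) (hmem : ∀ b, b ∈ L ↔ ∃ a, enc a = b) :
    ∃ (n : ℕ) (var : Fin n ≃ α), L = List.ofFn fun i => enc (var i) := by
  have h1 : ∀ i : Fin L.length, ∃ a, enc a = L.get i := fun i => (hmem _).1 (L.get_mem i)
  choose f hf using h1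
  have hbij : Function.Bijective f := by
    constructor
    · intro i j hij
      refine (List.nodup_iff_injective_get.1 hL) ?_
      rw [← hf, ← hf, hij]
    · intro a
      obtain ⟨i, hi⟩ := List.get_of_mem ((hmem (enc a)).2 ⟨a, rfl⟩)
      exact ⟨i, henc (by rw [hf, hi])⟩
  refine ⟨L.length, Equiv.ofBijective f hbij, ?_⟩
  simp only [Equiv.ofBijective_apply, hf]
  exact (List.ofFn_get L).symm

theorem sum_map_eq_sum {α β M : Type*} [Fintype α] [AddCommMonoid M] {enc : α → β}
    (henc : Function.Injective enc) {L : List β} (hL : L.Nodup)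
    (hmem : ∀ b, b ∈ L ↔ ∃ a, enc a = b) (f : β → M) : (L.map f).sum = ∑ a, f (enc a) := by
  obtain ⟨n, var, rfl⟩ := exists_enumeration henc hL hmem
  rw [List.map_ofFn, List.sum_ofFn, ← var.sum_comp]
  rfl

theorem ratCode_intCast (z : ℤ) : ratCode (z : ℚ) = (z, 1) := by simp [ratCode]

/-! ### Agreement of the coded and the abstract linear program -/

namespace GraphOfGroups

open GroupTable

variable {V E : Type*} (𝒢 : GraphOfGroups V E) {nV nE : ℕ} (enumV : Fin nV ≃ V)
  (enumE : Fin nE ≃ E) {sV : V → ℕ} (elemV : ∀ v, Fin (sV v) ≃ 𝒢.vGroup v)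
  {sE : E → ℕ} (elemE : ∀ e, Fin (sE e) ≃ 𝒢.eGroup e)

theorem vertexTable_code (v : V) :
    GraphCode.vertexTable (𝒢.code enumV enumE elemV elemE) (enumV.symm v) = mulTable (elemV v) := by
  obtain ⟨i, rfl⟩ := enumV.surjective v
  simp [GraphCode.vertexTable, code]

theorem edge_code (e : E) : GraphCode.edge (𝒢.code enumV enumE elemV elemE) (enumE.symm e) =
    ((enumV.symm (𝒢.src e) : ℕ), (enumV.symm (𝒢.tgt e) : ℕ), mulTable (elemE e),
      mapTable (elemE e) (elemV (𝒢.src e)) (𝒢.srcMap e),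
      mapTable (elemE e) (elemV (𝒢.tgt e)) (𝒢.tgtMap e)) := by
  obtain ⟨i, rfl⟩ := enumE.surjective e
  simp [GraphCode.edge, code]

theorem length_code_fst : (𝒢.code enumV enumE elemV elemE).1.length = nV := by simp [code]

theorem length_code_snd : (𝒢.code enumV enumE elemV elemE).2.length = nE := by simp [code]

/-- The code of a variable. -/
def varCode (i : 𝒢.Var) : ℕ × ℕ := (enumV.symm i.1, canonCode (elemV i.1) i.2)

/-- The code of a constraint. -/
def conCode : 𝒢.Con → ℕ × ℕ × ℕ
  | Sum.inl v => (0, enumV.symm v, 0)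
  | Sum.inr i => (1, enumE.symm i.1, canonCode (elemE i.1) i.2)

theorem varCode_injective : Function.Injective (𝒢.varCode enumV elemV) := by
  rintro ⟨v, θ⟩ ⟨w, θ'⟩ h
  obtain ⟨h1, h2⟩ := Prod.ext_iff.1 h
  obtain rfl : v = w := enumV.symm.injective (Fin.ext h1)
  obtain rfl : θ = θ' := canonCode_injective (elemV v) h2
  rfl

theorem conCode_injective : Function.Injective (𝒢.conCode enumV enumE elemE) := by
  rintro (v | ⟨e, ρ⟩) (w | ⟨e', ρ'⟩) h
  · obtain ⟨-, h2⟩ := Prod.ext_iff.1 h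
    rw [enumV.symm.injective (Fin.ext (Prod.ext_iff.1 h2).1)]
  · exact absurd (Prod.ext_iff.1 h).1 (by simp [conCode])
  · exact absurd (Prod.ext_iff.1 h).1 (by simp [conCode])
  · obtain ⟨-, h2⟩ := Prod.ext_iff.1 h
    obtain ⟨h2, h3⟩ := Prod.ext_iff.1 h2
    obtain rfl : e = e' := enumE.symm.injective (Fin.ext h2)
    obtain rfl : ρ = ρ' := canonCode_injective (elemE e) h3
    rfl

theorem mem_vars_code (p : ℕ × ℕ) : p ∈ GraphCode.vars (𝒢.code enumV enumE elemV elemE) ↔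
    ∃ i, 𝒢.varCode enumV elemV i = p := by
  simp only [GraphCode.vars, List.mem_flatMap, List.mem_range, List.mem_map, length_code_fst]
  constructor
  · rintro ⟨k, hk, N, hN, rfl⟩
    have h1 := 𝒢.vertexTable_code enumV enumE elemV elemE (enumV ⟨k, hk⟩)
    rw [Equiv.symm_apply_apply] at h1
    rw [h1, mem_reps] at hN
    obtain ⟨θ, rfl⟩ := hN
    exact ⟨⟨enumV ⟨k, hk⟩, θ⟩, by simp [varCode]⟩
  · rintro ⟨⟨v, θ⟩, rfl⟩
    refine ⟨enumV.symm v, (enumV.symm v).2, canonCode (elemV v) θ, ?_, rfl⟩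
    rw [vertexTable_code, mem_reps]
    exact ⟨θ, rfl⟩

theorem mem_cons_code (p : ℕ × ℕ × ℕ) : p ∈ GraphCode.cons (𝒢.code enumV enumE elemV elemE) ↔
    ∃ k, 𝒢.conCode enumV enumE elemE k = p := by
  simp only [GraphCode.cons, List.mem_append, List.mem_flatMap, List.mem_range, List.mem_map,
    length_code_fst, length_code_snd]
  constructor
  · rintro (⟨k, hk, rfl⟩ | ⟨k, hk, N, hN, rfl⟩)
    · exact ⟨Sum.inl (enumV ⟨k, hk⟩), by simp [conCode]⟩
    · have h1 := 𝒢.edge_code enumV enumE elemV elemE (enumE ⟨k, hk⟩)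
      rw [Equiv.symm_apply_apply] at h1
      rw [h1, mem_reps] at hN
      obtain ⟨ρ, rfl⟩ := hN
      exact ⟨Sum.inr ⟨enumE ⟨k, hk⟩, ρ⟩, by simp [conCode]⟩
  · rintro ⟨v | ⟨e, ρ⟩, rfl⟩
    · exact Or.inl ⟨enumV.symm v, (enumV.symm v).2, rfl⟩
    · refine Or.inr ⟨enumE.symm e, (enumE.symm e).2, canonCode (elemE e) ρ, ?_, rfl⟩
      rw [edge_code, mem_reps]
      exact ⟨ρ, rfl⟩

theorem nodup_vars (C : GraphCode) : C.vars.Nodup := by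
  rw [GraphCode.vars, List.nodup_flatMap]
  refine ⟨fun v _ => (nodup_reps _).map fun N M h => (Prod.ext_iff.1 h).2,
    List.nodup_range.imp fun {v w} hvw => ?_⟩
  rw [Function.onFun, List.disjoint_left]
  intro p hp hq
  obtain ⟨N, -, rfl⟩ := List.mem_map.1 hp
  obtain ⟨M, -, h⟩ := List.mem_map.1 hq
  exact hvw (Prod.ext_iff.1 h).1.symm

theorem nodup_cons (C : GraphCode) : C.cons.Nodup := by
  rw [GraphCode.cons, List.nodup_append']
  refine ⟨List.nodup_range.map fun v w h => (Prod.ext_iff.1 (Prod.ext_iff.1 h).2).1, ?_, ?_⟩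
  · rw [List.nodup_flatMap]
    refine ⟨fun v _ => (nodup_reps _).map fun N M h => (Prod.ext_iff.1 (Prod.ext_iff.1 h).2).2,
      List.nodup_range.imp fun {v w} hvw => ?_⟩
    rw [Function.onFun, List.disjoint_left]
    intro p hp hq
    obtain ⟨N, -, rfl⟩ := List.mem_map.1 hp
    obtain ⟨M, -, h⟩ := List.mem_map.1 hq
    exact hvw (Prod.ext_iff.1 (Prod.ext_iff.1 h).2).1.symm
  · rw [List.disjoint_left]
    intro p hp hq
    obtain ⟨v, -, rfl⟩ := List.mem_map.1 hp
    obtain ⟨e, -, hq⟩ := List.mem_flatMap.1 hq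
    obtain ⟨M, -, h⟩ := List.mem_map.1 hq
    exact absurd (Prod.ext_iff.1 h).1 (by norm_num)

theorem srcCoeff_code (e : E) (ρ : TransRep (𝒢.eGroup e)) (i : 𝒢.Var) :
    (GraphCode.srcCoeff (𝒢.code enumV enumE elemV elemE) (enumE.symm e) (canonCode (elemE e) ρ)
      (𝒢.varCode enumV elemV i) : ℚ) = 𝒢.srcCoeff e ρ i := by
  classical
  obtain ⟨v, θ⟩ := i
  rw [GraphCode.srcCoeff, edge_code, varCode, vertexTable_code, srcCoeff]
  dsimp only
  by_cases h : 𝒢.src e = v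
  · subst h
    rw [if_pos rfl, restrictMult_eq, Finset.sum_eq_single θ]
    · simp
    · intro θ' _ hθ'
      rw [if_neg]
      simpa using hθ'
    · simp
  · rw [if_neg fun h' => h (enumV.symm.injective (Fin.ext h')), Finset.sum_eq_zero, Nat.cast_zero]
    intro θ' _
    rw [if_neg fun h' => h (congrArg Sigma.fst h')]

theorem tgtCoeff_code (e : E) (ρ : TransRep (𝒢.eGroup e)) (i : 𝒢.Var) :
    (GraphCode.tgtCoeff (𝒢.code enumV enumE elemV elemE) (enumE.symm e) (canonCode (elemE e) ρ)
      (𝒢.varCode enumV elemV i) : ℚ) = 𝒢.tgtCoeff e ρ i := by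
  classical
  obtain ⟨v, θ⟩ := i
  rw [GraphCode.tgtCoeff, edge_code, varCode, vertexTable_code, tgtCoeff]
  dsimp only
  by_cases h : 𝒢.tgt e = v
  · subst h
    rw [if_pos rfl, restrictMult_eq, Finset.sum_eq_single θ]
    · simp
    · intro θ' _ hθ'
      rw [if_neg]
      simpa using hθ'
    · simp
  · rw [if_neg fun h' => h (enumV.symm.injective (Fin.ext h')), Finset.sum_eq_zero, Nat.cast_zero]
    intro θ' _
    rw [if_neg fun h' => h (congrArg Sigma.fst h')]

variable [Fintype E]

theorem objective_code (i : 𝒢.Var) :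
    ((GraphCode.objective (𝒢.code enumV enumE elemV elemE) (𝒢.varCode enumV elemV i) : ℤ) : ℚ) =
      𝒢.linearProgram.objective i := by
  have h1 : ∀ e : E, ((reps (GraphCode.edge (𝒢.code enumV enumE elemV elemE)
      (enumE.symm e)).2.2.1).map fun M => GraphCode.srcCoeff (𝒢.code enumV enumE elemV elemE)
        (enumE.symm e) M (𝒢.varCode enumV elemV i)).sum =
      ∑ ρ : TransRep (𝒢.eGroup e), GraphCode.srcCoeff (𝒢.code enumV enumE elemV elemE)
        (enumE.symm e) (canonCode (elemE e) ρ) (𝒢.varCode enumV elemV i) := by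
    intro e
    rw [edge_code]
    have := sum_map_eq_sum (canonCode_injective (elemE e)) (nodup_reps (mulTable (elemE e)))
      (fun N => mem_reps (elemE e)) (fun M => GraphCode.srcCoeff
        (𝒢.code enumV enumE elemV elemE) (enumE.symm e) M (𝒢.varCode enumV elemV i))
    exact this
  have h2 := sum_map_eq_sum (enc := fun e : E => ((enumE.symm e : Fin nE) : ℕ))
    (fun e e' h => enumE.symm.injective (Fin.ext h)) (List.nodup_range (n := nE))
    (fun k => ⟨fun hk => ⟨enumE ⟨k, List.mem_range.1 hk⟩, by simp⟩,
      fun ⟨e, he⟩ => List.mem_range.2 (he ▸ (enumE.symm e).2)⟩)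
    (fun e => ((reps (GraphCode.edge (𝒢.code enumV enumE elemV elemE) e).2.2.1).map fun M =>
      GraphCode.srcCoeff (𝒢.code enumV enumE elemV elemE) e M (𝒢.varCode enumV elemV i)).sum)
  rw [GraphCode.objective, length_code_snd, h2]
  simp only [h1, linearProgram, ← srcCoeff_code 𝒢 enumV enumE elemV elemE]
  push_cast
  ring

theorem entry_code (k : 𝒢.Con) (i : 𝒢.Var) :
    ((GraphCode.entry (𝒢.code enumV enumE elemV elemE) (𝒢.conCode enumV enumE elemE k)
      (𝒢.varCode enumV elemV i) : ℤ) : ℚ) = 𝒢.linearProgram.matrix k i := by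
  classical
  rcases k with v | ⟨e, ρ⟩
  · obtain ⟨w, θ⟩ := i
    rw [GraphCode.entry, varCode, conCode, linearProgram]
    dsimp only
    rw [vertexTable_code, degree_eq]
    by_cases h : w = v
    · subst h
      simp
    · have h' : (enumV.symm w : ℕ) ≠ enumV.symm v := fun h' => h (enumV.symm.injective (Fin.ext h'))
      simp [h, h']
  · simp only [GraphCode.entry, conCode, linearProgram, ← srcCoeff_code 𝒢 enumV enumE elemV elemE,
      ← tgtCoeff_code 𝒢 enumV enumE elemV elemE]
    simp

theorem rhs_code (k : 𝒢.Con) :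
    ((GraphCode.rhs (𝒢.conCode enumV enumE elemE k) : ℤ) : ℚ) = 𝒢.linearProgram.rhs k := by
  rcases k with v | ⟨e, ρ⟩ <;> simp [GraphCode.rhs, conCode, linearProgram]

/-- The lists of codes have no repetitions and contain exactly the codes of variables and
constraints, so they define the required enumerations. All coefficients are integers, hence the
denominators 1. -/
theorem exists_lpCode_eq : ∃ (n m : ℕ) (var : Fin n ≃ 𝒢.Var) (con : Fin m ≃ 𝒢.Con),
    GraphCode.lpCode (𝒢.code enumV enumE elemV elemE) = 𝒢.linearProgram.code var con := by
  obtain ⟨n, var, hvar⟩ := exists_enumeration (𝒢.varCode_injective enumV elemV) (nodup_vars _)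
    (𝒢.mem_vars_code enumV enumE elemV elemE)
  obtain ⟨m, con, hcon⟩ := exists_enumeration (𝒢.conCode_injective enumV enumE elemE)
    (nodup_cons _) (𝒢.mem_cons_code enumV enumE elemV elemE)
  refine ⟨n, m, var, con, ?_⟩
  rw [GraphCode.lpCode, hvar, hcon, LinearProgram.code]
  simp only [List.map_ofFn, Function.comp_def, ← objective_code 𝒢 enumV enumE elemV elemE,
    ← entry_code 𝒢 enumV enumE elemV elemE, ← rhs_code 𝒢 enumV enumE elemE, ratCode_intCast]

end GraphOfGroups

end

theorem theorem3 :
    -- the growth coefficient is the optimum of the linear program, and it is rational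
    (∀ (V E : Type*) [Fintype V] [Fintype E] (𝒢 : GraphOfGroups V E)
        (T : Set E) (_ : 𝒢.IsSpanningTree T)
        (Γ : Type*) [Group Γ] [Infinite Γ] (_ : Γ ≃* 𝒢.FundamentalGroup T),
      ∃ q : ℚ, 𝒢.linearProgram.IsOptimum (q : ℝ) ∧ growthCoeff Γ = ((q : ℝ) : EReal)) ∧
    -- one algorithm computes the linear program from the graph of groups
    (∃ f : GraphCode → LPCode, Computable f ∧
      ∀ (V E : Type*) [Fintype V] [Fintype E] (𝒢 : GraphOfGroups V E)
        (nV nE : ℕ) (enumV : Fin nV ≃ V) (enumE : Fin nE ≃ E)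
        (sV : V → ℕ) (elemV : ∀ v, Fin (sV v) ≃ 𝒢.vGroup v)
        (sE : E → ℕ) (elemE : ∀ e, Fin (sE e) ≃ 𝒢.eGroup e),
        ∃ (n m : ℕ) (var : Fin n ≃ 𝒢.Var) (con : Fin m ≃ 𝒢.Con),
          f (𝒢.code enumV enumE elemV elemE) = 𝒢.linearProgram.code var con) := by
  refine ⟨fun V E _ _ 𝒢 T hT Γ _ _ iso => 𝒢.exists_rat_growthCoeff hT Γ iso,
    GraphCode.lpCode, GraphCode.primrec_lpCode.to_comp,
    fun V E _ _ 𝒢 nV nE enumV enumE sV elemV sE elemE => ?_⟩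
  exact 𝒢.exists_lpCode_eq enumV enumE elemV elemE
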